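/- **Undirected Eulerian Extension (UEE).** Input: a finite undirected multigraph $G=(V,R)$ with no isolated vertices, a symmetric weight function $\omega:V\times V\to\mathbb N$ and an integer $\ell$. Question: is there a multiset $E'$ of unordered pairs $uv$ ($u,v\in V$) of total weight at most $\ell$ such that $G+E'=(V,R+E')$ is Eulerian, i.e. has a closed trail that includes all edges and all vertices? Parameter: the number $k$ of connected components of $G$. **Undirected Rural Postman Problem (URPP).** Input: a finite connected undirected multigraph $G=(V,E)$, a subset $R\subseteq E$, a weight function $\omega:E\to\mathbb N$ and an integer $\ell$. Question: is there a closed walk in $G$ that contains every edge of $R$ and has total weight (with repetitions) at most $\omega(R)+\ell$, where $\omega(R)=\sum_{e\in R}\omega(e)$? Parameter: the number $k$ of connected components of the subgraph $G[R]$ induced by $R$ (whose vertices are the end-vertices of the edges in $R$ and whose edges are those in $R$). **Theorem 6.** For each of these two problems, restricted to instances in which $\ell$ is bounded by a fixed polynomial in the number of vertices of $G$, there is a randomized algorithm that solves it in $O^*(2^k)$ time and space. That is, for every polynomial $p$ there are a randomized algorithm and a polynomial $q$ such that on every instance of bit length $N$ with $\ell\le p(|V|)$ the algorithm always halts within time $2^k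 q(N)$ and space $2^k q(N)$ (on a random access machine with logarithmic cost and access to fair random bits), accepts with probability at least $2/3$ if the answer is yes, and never accepts if the answer is no. -/

import Mathlib

open scoped ENNReal

noncomputable section

/-! ### Undirected multigraphs, walks, Eulerian multigraphs -/

/-- `IsWalk ends u es w`: in the undirected multigraph with vertex set `V` whose edges `e : E` have
the (unordered) end-vertices `ends e`, the sequence of edges `es` is traversed by a walk
from `u` to `w`. -/
inductive IsWalk {V E : Type} (ends : E → Sym2 V) : V → List E → V → Prop
  | nil (v : V) : IsWalk ends v [] v
  | cons {u v w : V} {e : E} {es : List E} :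
      ends e = s(u, v) → IsWalk ends v es w → IsWalk ends u (e :: es) w

/-- A multigraph on `V`, given by its multiset `M` of edges, is Eulerian if it has a closed trail
that includes all edges and all vertices. (An edge of multiplicity `j` in `M` stands for `j` parallel
edges; a trail that uses each edge exactly once is a walk whose multiset of edges is `M`.) -/
def IsEulerian {V : Type} (M : Multiset (Sym2 V)) : Prop :=
  ∃ (v : V) (es : List (Sym2 V)), IsWalk id v es v ∧ (es : Multiset (Sym2 V)) = M ∧
    ∀ x : V, x = v ∨ ∃ e ∈ es, x ∈ e

/-! ### Undirected Eulerian Extension -/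

/-- An instance of Undirected Eulerian Extension: a multigraph `(V, R)` with
`V = {0, …, n-1}`, with a list of `m` edges and without isolated vertices, a symmetric
weight function on pairs of vertices, and an integer `ℓ`. -/
structure UEEInstance where
  n : ℕ
  m : ℕ
  ends : Fin m → Fin n × Fin n
  weight : Fin n → Fin n → ℕ
  ℓ : ℤ
  weight_symm : ∀ u v, weight u v = weight v u
  no_isolated : ∀ v, ∃ i, v = (ends i).1 ∨ v = (ends i).2

namespace UEEInstance

variable (I : UEEInstance)

/-- The multiset `R` of edges. -/
def edges : Multiset (Sym2 (Fin I.n)) :=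
  Finset.univ.val.map fun i : Fin I.m => s((I.ends i).1, (I.ends i).2)

/-- The weight of an unordered pair of vertices. -/
def pairWeight : Sym2 (Fin I.n) → ℕ :=
  Sym2.lift ⟨I.weight, I.weight_symm⟩

/-- `X` is an Eulerian extension of the multigraph. -/
def IsEulerianExtension (X : Multiset (Sym2 (Fin I.n))) : Prop :=
  IsEulerian (I.edges + X)

/-- The question: is there an Eulerian extension of total weight at most `ℓ`? -/
def Yes : Prop :=
  ∃ X : Multiset (Sym2 (Fin I.n)), I.IsEulerianExtension X ∧
    (((X.map I.pairWeight).sum : ℕ) : ℤ) ≤ I.ℓ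

/-- The parameter: the number of connected components of the multigraph. -/
def k : ℕ :=
  Nat.card (SimpleGraph.fromEdgeSet {e | e ∈ I.edges}).ConnectedComponent

/-- The instance as a list of numbers. -/
def encode : List ℕ :=
  [I.n, I.m]
    ++ (List.finRange I.m).flatMap (fun i => [((I.ends i).1 : ℕ), ((I.ends i).2 : ℕ)])
    ++ (List.finRange I.n).flatMap (fun u => (List.finRange I.n).map fun v => I.weight u v)
    ++ [if I.ℓ < 0 then 1 else 0, I.ℓ.natAbs]

end UEEInstance

/-! ### Undirected Rural Postman Problem -/

/-- An instance of the Undirected Rural Postman Problem: a connected multigraph on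
`{0, …, n-1}` with edges `0, …, m-1`, a subset `R` of its edges, a weight for each
edge, and an integer `ℓ`. -/
structure URPPInstance where
  n : ℕ
  m : ℕ
  ends : Fin m → Fin n × Fin n
  R : Finset (Fin m)
  weight : Fin m → ℕ
  ℓ : ℤ
  connected : (SimpleGraph.fromEdgeSet
    (Set.range fun i => s((ends i).1, (ends i).2))).Connected

namespace URPPInstance

variable (I : URPPInstance)

/-- The unordered pair of end-vertices of an edge. -/
def endPair (i : Fin I.m) : Sym2 (Fin I.n) := s((I.ends i).1, (I.ends i).2)

/-- The question: is there a closed walk containing every edge of `R`, of total weight at most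
`ω(R) + ℓ`? (An edge is counted as often as the walk traverses it.) -/
def Yes : Prop :=
  ∃ (v : Fin I.n) (es : List (Fin I.m)), IsWalk I.endPair v es v ∧ (∀ e ∈ I.R, e ∈ es) ∧
    (((es.map I.weight).sum : ℕ) : ℤ) ≤ ((∑ e ∈ I.R, I.weight e : ℕ) : ℤ) + I.ℓ

/-- The parameter: the number of connected components of the subgraph induced by `R`; its
vertices are the end-vertices of the edges in `R`, and its edges are those in `R`. -/
def k : ℕ :=
  Nat.card ((SimpleGraph.fromEdgeSet (I.endPair '' (I.R : Set (Fin I.m)))).induce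
    {v | ∃ e ∈ I.R, v ∈ I.endPair e}).ConnectedComponent

open scoped Classical in
/-- The instance as a list of numbers. -/
def encode : List ℕ :=
  [I.n, I.m]
    ++ (List.finRange I.m).flatMap (fun i =>
        [((I.ends i).1 : ℕ), ((I.ends i).2 : ℕ), I.weight i, if i ∈ I.R then 1 else 0])
    ++ [if I.ℓ < 0 then 1 else 0, I.ℓ.natAbs]

end URPPInstance

/-! ### Randomized random access machines with logarithmic cost -/

namespace RAM

/-- Arithmetic and bitwise instructions on natural numbers (subtraction is truncated). -/
inductive Op
  | add | sub | mul | div | mod | land | lor | xor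

def Op.eval : Op → ℕ → ℕ → ℕ
  | add, a, b => a + b
  | sub, a, b => a - b
  | mul, a, b => a * b
  | div, a, b => a / b
  | mod, a, b => a % b
  | land, a, b => a &&& b
  | lor, a, b => a ||| b
  | xor, a, b => a ^^^ b

/-- Programs. The letters `x`, `y`, `z` are names of registers; besides its registers the machine has
a random access memory, whose cells are addressed by the contents of registers. -/
inductive Prog
  | skip
  /-- `x := c` -/
  | const (x c : ℕ)
  /-- `x := y o z` -/
  | op (o : Op) (x y z : ℕ)
  /-- `x := memory[y]` -/
  | load (x y : ℕ)
  /-- `memory[x] := y` -/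
  | store (x y : ℕ)
  /-- `x :=` a fresh random bit -/
  | flip (x : ℕ)
  | seq (p q : Prog)
  /-- if `x ≠ 0` then `p` else `q` -/
  | ite (x : ℕ) (p q : Prog)
  /-- while `x ≠ 0` do `p` -/
  | loop (x : ℕ) (p : Prog)

/-- A configuration: contents of the registers, contents of the memory cells, and the number of
random bits used so far. -/
structure State where
  reg : ℕ →₀ ℕ
  mem : ℕ →₀ ℕ
  flips : ℕ

/-- The space occupied by a configuration: the total bit length of the addresses and contents
of all nonzero registers and cells. -/
def State.space (s : State) : ℕ :=
  (s.reg.sum fun a c => a.size + c.size) + (s.mem.sum fun a c => a.size + c.size)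

def State.setReg (s : State) (x c : ℕ) : State := { s with reg := s.reg.update x c }

def State.setMem (s : State) (a c : ℕ) : State := { s with mem := s.mem.update a c }

/-- The effect of the basic instructions, with the infinite sequence `ω` of random bits, and their
logarithmic cost: one plus the bit lengths of all numbers and addresses involved. -/
inductive Basic (ω : ℕ → Bool) : Prog → State → ℕ → State → Prop
  | skip (s : State) : Basic ω .skip s 1 s
  | const (s : State) (x c : ℕ) :
      Basic ω (.const x c) s (1 + c.size) (s.setReg x c)
  | op (s : State) (o : Op) (x y z : ℕ) :
      Basic ω (.op o x y z) s
        (1 + (s.reg y).size + (s.reg z).size + (o.eval (s.reg y) (s.reg z)).size)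
        (s.setReg x (o.eval (s.reg y) (s.reg z)))
  | load (s : State) (x y : ℕ) :
      Basic ω (.load x y) s (1 + (s.reg y).size + (s.mem (s.reg y)).size)
        (s.setReg x (s.mem (s.reg y)))
  | store (s : State) (x y : ℕ) :
      Basic ω (.store x y) s (1 + (s.reg x).size + (s.reg y).size)
        (s.setMem (s.reg x) (s.reg y))
  | flip (s : State) (x : ℕ) :
      Basic ω (.flip x) s 1 { s.setReg x (ω s.flips).toNat with flips := s.flips + 1 }

/-- `Exec ω p s t b s'`: with the sequence `ω` of random bits, the program `p` started in the
configuration `s` halts in the configuration `s'`, takes time `t`, and `b` is the maximum space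
of a configuration that occurs in the run. -/
inductive Exec (ω : ℕ → Bool) : Prog → State → ℕ → ℕ → State → Prop
  | basic {p : Prog} {s s' : State} {t : ℕ} :
      Basic ω p s t s' → Exec ω p s t (max s.space s'.space) s'
  | seq {p q : Prog} {s s' s'' : State} {t t' b b' : ℕ} :
      Exec ω p s t b s' → Exec ω q s' t' b' s'' → Exec ω (.seq p q) s (t + t') (max b b') s''
  | ite_true {x : ℕ} {p q : Prog} {s s' : State} {t b : ℕ} :
      s.reg x ≠ 0 → Exec ω p s t b s' → Exec ω (.ite x p q) s (1 + (s.reg x).size + t) b s'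
  | ite_false {x : ℕ} {p q : Prog} {s s' : State} {t b : ℕ} :
      s.reg x = 0 → Exec ω q s t b s' → Exec ω (.ite x p q) s (1 + (s.reg x).size + t) b s'
  | loop_true {x : ℕ} {p : Prog} {s s' s'' : State} {t t' b b' : ℕ} :
      s.reg x ≠ 0 → Exec ω p s t b s' → Exec ω (.loop x p) s' t' b' s'' →
      Exec ω (.loop x p) s (1 + (s.reg x).size + t + t') (max b b') s''
  | loop_false {x : ℕ} {p : Prog} {s : State} :
      s.reg x = 0 → Exec ω (.loop x p) s (1 + (s.reg x).size) s.space s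

/-- The initial configuration: the input is stored in the memory cells `0, 1, 2, …`. -/
def init (input : List ℕ) : State where
  reg := 0
  mem := input.toFinsupp
  flips := 0

/-- The program halts with a nonzero number in register `0`. -/
def Accepts (p : Prog) (input : List ℕ) (ω : ℕ → Bool) : Prop :=
  ∃ t b s, Exec ω p (init input) t b s ∧ s.reg 0 ≠ 0

/-- The distribution of an infinite sequence of independent fair coin flips. -/
def coins : MeasureTheory.Measure (ℕ → Bool) :=
  MeasureTheory.Measure.infinitePi fun _ => (PMF.uniformOfFintype Bool).toMeasure

/-- On the given input, the randomized program `p` halts within time `B` and space `B` whatever the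
random bits are; if the right answer is yes, it accepts with probability at least `2/3`, and if
the right answer is no, it never accepts. -/
def Decides (p : Prog) (input : List ℕ) (answer : Prop) (B : ℕ) : Prop :=
  (∀ ω, ∃ t b s, Exec ω p (init input) t b s ∧ t ≤ B ∧ b ≤ B) ∧
  (answer → (2 / 3 : ℝ≥0∞) ≤ coins {ω | Accepts p input ω}) ∧
  (¬ answer → ∀ ω, ¬ Accepts p input ω)

/-- The size of an input: the total bit length of its numbers, with one separator for each. -/
def inputSize (input : List ℕ) : ℕ := (input.map fun c => c.size + 1).sum

end RAM

end

/-!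
Both problems come down to the following question about a multigraph with `k` components: is there
a set of additional edges, of weight at most `ℓ`, that makes all degrees even and the multigraph
connected? By Euler's theorem (`exists_euler_tour`) this is Undirected Eulerian Extension; for the
Rural Postman Problem one takes the multigraph of the required edges and the distances as weights,
since a closed walk is a closed trail through required edges and gaps, and gaps may be replaced by
shortest walks (`exists_extends_of_walk`, `IsWalk.fill_gaps`).

*Matchings.* A minimal extension has no loops and uses no edge more than twice, so that its degrees
are at most `2 * n`. Let every vertex have `2 * n + 1` copies for each end of a given edge. The number
of copies has the parity of the degree, so extensions correspond to perfect matchings of the copies,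
where copies of the same vertex are matched at no cost; an extension connects the multigraph if and
only if every nontrivial cut of the set of components is crossed by some matched pair. Such matchings
are called linkings (`RAM.Inp.Rep.linking_of_extends`, `RAM.Inp.Rep.extends_of_linking`).

*Algebra.* To a cut `S` belongs the symmetric matrix over `𝔽₂[X]` with ones on the diagonal and the
entry `X ^ x p q` for two copies `p ≠ q` on the same side of `S`, and zero for copies on different
sides. In characteristic two only the involutions contribute to its determinant, as a permutation
and its inverse cancel (`RAM.det_eq_sum_involutions`). In the sum of the determinants over the
`2 ^ (k - 1)` cuts that have a fixed component on the side `0`, an involution is counted as often as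
there are cuts that it does not cross; this number is a power of two, and odd if and only if only the
trivial cut is not crossed (`RAM.sum_cuts`). So the coefficients of the sum count linkings modulo two.
The exponents `x p q` consist of a large constant, which separates perfect matchings from involutions
with fixed points, of the weight, and of a random perturbation. By the isolation lemma
(`RAM.isolation`) the cheapest linking is unique with probability at least `2 / 3`, and then some
coefficient in the relevant range is odd (`RAM.Inp.card_reject`); conversely an odd coefficient
proves that there is a linking (`RAM.Inp.exists_linking`).

*Computation.* Since `1 + A` has in characteristic two the inverse `∑ A ^ j` if `A` is nilpotent, its
determinant is a product of Schur complements, which are polynomials in the entries without signs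
or divisions (`RAM.det_block`); nilpotency holds modulo a power of `X`, as the entries of `A` are
multiples of a power of `X`. All computations are done with natural numbers, where polynomials are
evaluated at a large power of two, so that their coefficients are digits of the result
(`RAM.eval_div_pow_mod`), and arrays are packed into numbers in the same way. For programs, `RAM.Comp`
expresses that a function is computable in time `2 ^ k` times a polynomial, or in polynomial time;
it is closed under arithmetic, sums, products, and iteration (`RAM.Comp.fold`). With logarithmic cost
the space is bounded by a constant times the time (`RAM.Exec.space_le`). The program first draws
random bits and then computes the sum over all cuts (`RAM.exists_decides`).
-/

noncomputable section

/-! ### Runs of random access machines: determinism and space -/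

namespace RAM

open Polynomial

theorem Basic.det {ω : ℕ → Bool} {p : Prog} {s s₁ s₂ : State} {t₁ t₂ : ℕ}
    (h₁ : Basic ω p s t₁ s₁) (h₂ : Basic ω p s t₂ s₂) : s₁ = s₂ := by
  cases h₁ <;> cases h₂ <;> rfl

theorem Exec.det {ω : ℕ → Bool} {p : Prog} {s s₁ : State} {t₁ b₁ : ℕ}
    (h₁ : Exec ω p s t₁ b₁ s₁) : ∀ {s₂ : State} {t₂ b₂ : ℕ}, Exec ω p s t₂ b₂ s₂ → s₁ = s₂ := by
  induction h₁ with
  | basic h =>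
    intro s₂ t₂ b₂ h₂
    cases h₂ with
    | basic h' => exact h.det h'
    | _ => cases h
  | seq _ _ ih₁ ih₂ =>
    intro s₂ t₂ b₂ h₂
    cases h₂ with
    | basic h' => cases h'
    | seq h h' =>
      obtain rfl := ih₁ h
      exact ih₂ h'
  | ite_true h _ ih =>
    intro s₂ t₂ b₂ h₂
    cases h₂ with
    | basic h' => cases h'
    | ite_true _ h' => exact ih h'
    | ite_false h0 _ => exact absurd h0 h
  | ite_false h _ ih =>
    intro s₂ t₂ b₂ h₂
    cases h₂ with
    | basic h' => cases h'
    | ite_true h0 _ => exact absurd h h0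
    | ite_false _ h' => exact ih h'
  | loop_true h _ _ ih₁ ih₂ =>
    intro s₂ t₂ b₂ h₂
    cases h₂ with
    | basic h' => cases h'
    | loop_true _ h1 h2 =>
      obtain rfl := ih₁ h1
      exact ih₂ h2
    | loop_false h0 => exact absurd h0 h
  | loop_false h =>
    intro s₂ t₂ b₂ h₂
    cases h₂ with
    | basic h' => cases h'
    | loop_true h0 _ _ => exact absurd h h0
    | loop_false _ => rfl

/-- Upper bound for the bit lengths of the names of the registers that a program writes. -/
def Prog.regSize : Prog → ℕ
  | .skip => 0
  | .const x _ => x.size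
  | .op _ x _ _ => x.size
  | .load x _ => x.size
  | .store _ _ => 0
  | .flip x => x.size
  | .seq p q => max p.regSize q.regSize
  | .ite _ p q => max p.regSize q.regSize
  | .loop _ p => p.regSize

/-- Changing one entry changes the space by at most the new address and content. -/
theorem sum_size_update_le (f : ℕ →₀ ℕ) (a c : ℕ) :
    ((f.update a c).sum fun a c => a.size + c.size) ≤
      (f.sum fun a c => a.size + c.size) + (a.size + c.size) := by
  classical
  have h1 : ((f.update a c).sum fun a c => a.size + c.size) =
      ∑ x ∈ insert a f.support, (if (f.update a c) x = 0 then 0 else x.size + ((f.update a c) x).size) := by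
    rw [Finsupp.sum]
    have : (f.update a c).support ⊆ insert a f.support := by
      intro x hx
      by_cases hxa : x = a
      · simp [hxa]
      · simp only [Finsupp.mem_support_iff, Finsupp.coe_update, Function.update_of_ne hxa] at hx
        simp [hx]
    rw [← Finset.sum_subset this]
    · apply Finset.sum_congr rfl
      intro x hx
      rw [if_neg (by simpa using hx)]
    · intro x _ hx
      rw [if_pos (by simpa using hx)]
  have h2 : (f.sum fun a c => a.size + c.size) =
      ∑ x ∈ insert a f.support, (if f x = 0 then 0 else x.size + (f x).size) := by
    rw [Finsupp.sum, ← Finset.sum_subset (Finset.subset_insert a f.support)]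
    · apply Finset.sum_congr rfl
      intro x hx
      rw [if_neg (by simpa using hx)]
    · intro x _ hx
      rw [if_pos (by simpa using hx)]
  have h3 : a.size + c.size = ∑ x ∈ insert a f.support, (if x = a then a.size + c.size else 0) := by
    simp
  rw [h1, h2, h3, ← Finset.sum_add_distrib]
  apply Finset.sum_le_sum
  intro x _
  by_cases hxa : x = a
  · subst hxa
    simp only [Finsupp.coe_update, Function.update_self]
    split_ifs <;> simp
  · simp only [Finsupp.coe_update, Function.update_of_ne hxa, if_neg hxa, add_zero]
    exact le_rfl

theorem State.space_setReg_le (s : State) (x c : ℕ) :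
    (s.setReg x c).space ≤ s.space + (x.size + c.size) := by
  have := sum_size_update_le s.reg x c
  simp only [State.space, State.setReg]
  omega

theorem State.space_setMem_le (s : State) (x c : ℕ) :
    (s.setMem x c).space ≤ s.space + (x.size + c.size) := by
  have := sum_size_update_le s.mem x c
  simp only [State.space, State.setMem]
  omega

theorem Basic.space_le {ω : ℕ → Bool} {p : Prog} {s s' : State} {t : ℕ}
    (h : Basic ω p s t s') : s'.space ≤ s.space + (p.regSize + 1) * t := by
  cases h with
  | skip => simp
  | const s x c =>
    have := s.space_setReg_le x c
    simp only [Prog.regSize]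
    nlinarith [Nat.zero_le (x.size * c.size)]
  | op s o x y z =>
    have := s.space_setReg_le x (o.eval (s.reg y) (s.reg z))
    simp only [Prog.regSize]
    nlinarith [Nat.zero_le (x.size * ((s.reg y).size + (s.reg z).size +
      (o.eval (s.reg y) (s.reg z)).size))]
  | load s x y =>
    have := s.space_setReg_le x (s.mem (s.reg y))
    simp only [Prog.regSize]
    nlinarith [Nat.zero_le (x.size * ((s.reg y).size + (s.mem (s.reg y)).size))]
  | store s x y =>
    have := s.space_setMem_le (s.reg x) (s.reg y)
    simp only [Prog.regSize]
    nlinarith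
  | flip s x =>
    have h1 := s.space_setReg_le x (ω s.flips).toNat
    have h2 : (ω s.flips).toNat.size ≤ 1 := by cases ω s.flips <;> simp
    simp only [Prog.regSize]
    change (s.setReg x (ω s.flips).toNat).space ≤ _
    omega

/-- The space of a run is controlled by its time, since with logarithmic cost every newly stored
bit has been paid for, up to the name of the register. -/
theorem Exec.space_le {ω : ℕ → Bool} {p : Prog} {s s' : State} {t b : ℕ}
    (h : Exec ω p s t b s') : ∀ K, p.regSize + 1 ≤ K →
      s'.space ≤ s.space + K * t ∧ b ≤ s.space + K * t := by
  induction h with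
  | basic h =>
    intro K hK
    have h1 := h.space_le
    have h2 := h1.trans (Nat.add_le_add_left (Nat.mul_le_mul_right _ hK) _)
    exact ⟨h2, max_le (by omega) h2⟩
  | seq _ _ ih₁ ih₂ =>
    intro K hK
    simp only [Prog.regSize] at hK
    have h1 := ih₁ K (by omega)
    have h2 := ih₂ K (by omega)
    rw [mul_add]
    exact ⟨by omega, max_le (by omega) (by omega)⟩
  | ite_true h _ ih =>
    intro K hK
    simp only [Prog.regSize] at hK
    have h1 := ih K (by omega)
    rw [mul_add]
    omega
  | ite_false h _ ih =>
    intro K hK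
    simp only [Prog.regSize] at hK
    have h1 := ih K (by omega)
    rw [mul_add]
    omega
  | loop_true h _ _ ih₁ ih₂ =>
    intro K hK
    have hK' := hK
    simp only [Prog.regSize] at hK
    have h1 := ih₁ K (by omega)
    have h2 := ih₂ K hK'
    rw [mul_add, mul_add]
    exact ⟨by omega, max_le (by omega) (by omega)⟩
  | loop_false h =>
    intro K hK
    constructor <;> omega

/-- `Run ω p s t s'`: the program `p` started in `s` halts in `s'` after time `t`. -/
def Run (ω : ℕ → Bool) (p : Prog) (s : State) (t : ℕ) (s' : State) : Prop :=
  ∃ b, Exec ω p s t b s'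

theorem Run.basic {ω : ℕ → Bool} {p : Prog} {s s' : State} {t : ℕ} (h : Basic ω p s t s') :
    Run ω p s t s' := ⟨_, .basic h⟩

theorem Run.seq {ω : ℕ → Bool} {p q : Prog} {s s' s'' : State} {t t' : ℕ}
    (h : Run ω p s t s') (h' : Run ω q s' t' s'') : Run ω (.seq p q) s (t + t') s'' := by
  obtain ⟨b, h⟩ := h
  obtain ⟨b', h'⟩ := h'
  exact ⟨_, .seq h h'⟩

theorem Run.loop_true {ω : ℕ → Bool} {x : ℕ} {p : Prog} {s s' s'' : State} {t t' : ℕ}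
    (h0 : s.reg x ≠ 0) (h : Run ω p s t s') (h' : Run ω (.loop x p) s' t' s'') :
    Run ω (.loop x p) s (1 + (s.reg x).size + t + t') s'' := by
  obtain ⟨b, h⟩ := h
  obtain ⟨b', h'⟩ := h'
  exact ⟨_, .loop_true h0 h h'⟩

theorem Run.loop_false {ω : ℕ → Bool} {x : ℕ} {p : Prog} {s : State} (h0 : s.reg x = 0) :
    Run ω (.loop x p) s (1 + (s.reg x).size) s := ⟨_, .loop_false h0⟩

@[simp] theorem State.setReg_reg (s : State) (x c y : ℕ) :
    (s.setReg x c).reg y = if y = x then c else s.reg y := by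
  simp [State.setReg, Function.update_apply]

@[simp] theorem State.setReg_mem (s : State) (x c : ℕ) : (s.setReg x c).mem = s.mem := rfl

@[simp] theorem State.setReg_flips (s : State) (x c : ℕ) : (s.setReg x c).flips = s.flips := rfl

/-! ### Contexts and polynomial bounds -/

/-- A context over a type `X` of data: the memory, a size parameter and the exponential parameter of
each datum, the set of data that have to be treated, and the list of variables, which are functions
of the datum whose values are available in registers. -/
structure Cx (X : Type) where
  mem : X → (ℕ →₀ ℕ)
  sz : X → ℕ
  κ : X → ℕ
  D : X → Prop
  Γ : List (X → ℕ)

variable {X Y Z : Type}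

/-- `PB C τ f`: on the domain of `C` the function `f` is bounded by a polynomial in the size, with
an additional factor `2 ^ κ` if `τ` is true. -/
def PB (C : Cx X) (τ : Bool) (f : X → ℕ) : Prop :=
  ∃ q : ℕ[X], ∀ x, C.D x → f x ≤ (bif τ then 2 ^ C.κ x else 1) * q.eval (C.sz x)

theorem PB.mono {C : Cx X} {τ : Bool} {f g : X → ℕ} (hg : PB C τ g) (h : ∀ x, C.D x → f x ≤ g x) :
    PB C τ f := by
  obtain ⟨q, hq⟩ := hg
  exact ⟨q, fun x hx => (h x hx).trans (hq x hx)⟩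

theorem PB.const (C : Cx X) (τ : Bool) (c : ℕ) : PB C τ fun _ => c := by
  refine ⟨Polynomial.C c, fun x _ => ?_⟩
  rw [Polynomial.eval_C]
  cases τ
  · simp
  · exact Nat.le_mul_of_pos_left _ (by simp)

theorem PB.add {C : Cx X} {τ : Bool} {f g : X → ℕ} (hf : PB C τ f) (hg : PB C τ g) :
    PB C τ fun x => f x + g x := by
  obtain ⟨q, hq⟩ := hf
  obtain ⟨r, hr⟩ := hg
  refine ⟨q + r, fun x hx => ?_⟩
  rw [Polynomial.eval_add, mul_add]
  exact Nat.add_le_add (hq x hx) (hr x hx)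

/-- At most one of the two factors may be exponential in `κ`. -/
theorem PB.mul' {C : Cx X} {τ₁ τ₂ : Bool} {f g : X → ℕ} (hf : PB C τ₁ f) (hg : PB C τ₂ g)
    (τ : Bool) (hτ : τ₁.toNat + τ₂.toNat ≤ τ.toNat) :
    PB C τ fun x => f x * g x := by
  obtain ⟨q, hq⟩ := hf
  obtain ⟨r, hr⟩ := hg
  refine ⟨q * r, fun x hx => (Nat.mul_le_mul (hq x hx) (hr x hx)).trans ?_⟩
  rw [Polynomial.eval_mul, mul_mul_mul_comm]
  apply Nat.mul_le_mul_right
  have : 1 ≤ 2 ^ C.κ x := Nat.one_le_two_pow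
  cases τ₁ <;> cases τ₂ <;> cases τ <;> simp_all

theorem PB.mul {C : Cx X} {f g : X → ℕ} (hf : PB C false f) (hg : PB C false g) :
    PB C false fun x => f x * g x := hf.mul' hg false (by simp)

theorem PB.weaken {C : Cx X} {f : X → ℕ} (hf : PB C false f) (τ : Bool) : PB C τ f := by
  refine (hf.mul' (PB.const C τ 1) τ (by simp)).mono fun x _ => by simp

theorem PB.sub {C : Cx X} {τ : Bool} {f g : X → ℕ} (hf : PB C τ f) : PB C τ fun x => f x - g x :=
  hf.mono fun _ _ => Nat.sub_le _ _

theorem PB.div {C : Cx X} {τ : Bool} {f g : X → ℕ} (hf : PB C τ f) : PB C τ fun x => f x / g x :=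
  hf.mono fun _ _ => Nat.div_le_self _ _

theorem PB.mod {C : Cx X} {τ : Bool} {f g : X → ℕ} (hf : PB C τ f) : PB C τ fun x => f x % g x :=
  hf.mono fun _ _ => Nat.mod_le _ _

theorem PB.min_right {C : Cx X} {τ : Bool} {f g : X → ℕ} (hg : PB C τ g) :
    PB C τ fun x => min (f x) (g x) :=
  hg.mono fun _ _ => min_le_right _ _

theorem PB.eval {C : Cx X} (q : ℕ[X]) : PB C false fun x => q.eval (C.sz x) :=
  ⟨q, fun x _ => by simp⟩

/-- `Ext C C' π`: the data of `C'` contain data of `C`, with the same memory and parameters, and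
all variables of `C` are available in `C'`. -/
structure Ext (C : Cx X) (C' : Cx Y) (π : Y → X) : Prop where
  mem : ∀ y, C'.mem y = C.mem (π y)
  sz : ∀ y, C'.sz y = C.sz (π y)
  κ : ∀ y, C'.κ y = C.κ (π y)
  D : ∀ y, C'.D y → C.D (π y)
  Γ : ∀ v ∈ C.Γ, (fun y => v (π y)) ∈ C'.Γ

theorem Ext.refl (C : Cx X) : Ext C C fun x => x := by
  constructor <;> intros <;> first | rfl | assumption

theorem Ext.trans {C : Cx X} {C' : Cx Y} {C'' : Cx Z} {π : Y → X} {ρ : Z → Y} (h : Ext C C' π)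
    (h' : Ext C' C'' ρ) : Ext C C'' fun z => π (ρ z) where
  mem z := (h'.mem z).trans (h.mem _)
  sz z := (h'.sz z).trans (h.sz _)
  κ z := (h'.κ z).trans (h.κ _)
  D z hz := h.D _ (h'.D z hz)
  Γ v hv := h'.Γ _ (h.Γ v hv)

theorem PB.lift {C : Cx X} {C' : Cx Y} {π : Y → X} {τ : Bool} {f : X → ℕ} (hf : PB C τ f)
    (h : Ext C C' π) : PB C' τ fun y => f (π y) := by
  obtain ⟨q, hq⟩ := hf
  refine ⟨q, fun y hy => ?_⟩
  rw [h.κ, h.sz]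
  exact hq _ (h.D y hy)

/-- Add a variable `z.2`, restricted by the condition `P`. -/
def Cx.push (C : Cx X) (P : X → ℕ → Prop) : Cx (X × ℕ) where
  mem z := C.mem z.1
  sz z := C.sz z.1
  κ z := C.κ z.1
  D z := C.D z.1 ∧ P z.1 z.2
  Γ := (fun z => z.2) :: C.Γ.map fun v z => v z.1

theorem Cx.ext_push (C : Cx X) (P : X → ℕ → Prop) : Ext C (C.push P) Prod.fst where
  mem _ := rfl
  sz _ := rfl
  κ _ := rfl
  D _ h := h.1
  Γ v hv := List.mem_cons_of_mem _ (List.mem_map.2 ⟨v, hv, rfl⟩)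

/-! ### Functions computable by random access machines -/

/-- `Comp C τ f`: there is one program which on all data `x` of the context `C` computes `f x`. It
may use all registers from a given one, `base`, on, and it finds the values of the variables in
registers below `base`. It takes polynomial time, with an additional factor `2 ^ κ` if `τ` is
true, and `f x` has polynomial bit length. -/
def Comp (C : Cx X) (τ : Bool) (f : X → ℕ) : Prop :=
  PB C false (fun x => (f x).size) ∧
  ∃ (P : List ℕ → ℕ → Prog) (T : X → ℕ), PB C τ T ∧
    ∀ (locs : List ℕ) (base : ℕ), (∀ l ∈ locs, l < base) → ∀ (ω : ℕ → Bool) (x : X) (s : State),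
      C.D x → locs.map s.reg = C.Γ.map (fun v => v x) → s.mem = C.mem x →
      ∃ t s', Run ω (P locs base) s t s' ∧ t ≤ T x ∧ s'.reg base = f x ∧
        (∀ l < base, s'.reg l = s.reg l) ∧ s'.mem = s.mem ∧ s'.flips = s.flips

theorem Comp.size {C : Cx X} {τ : Bool} {f : X → ℕ} (h : Comp C τ f) :
    PB C false fun x => (f x).size := h.1

theorem Comp.congr {C : Cx X} {τ : Bool} {f g : X → ℕ} (hf : Comp C τ f)
    (h : ∀ x, C.D x → g x = f x) : Comp C τ g := by
  obtain ⟨hb, P, T, hT, H⟩ := hf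
  refine ⟨hb.mono fun x hx => by rw [h x hx], P, T, hT, fun locs base hl ω x s hx => ?_⟩
  rw [h x hx]
  exact H locs base hl ω x s hx

theorem Comp.weaken {C : Cx X} {f : X → ℕ} (hf : Comp C false f) (τ : Bool) : Comp C τ f := by
  obtain ⟨hb, P, T, hT, H⟩ := hf
  exact ⟨hb, P, T, hT.weaken τ, H⟩

/-- A program stays usable if variables are added to the context: it is told their registers. -/
theorem Comp.lift {C : Cx X} {C' : Cx Y} {π : Y → X} {τ : Bool} {f : X → ℕ} (hf : Comp C τ f)
    (h : Ext C C' π) : Comp C' τ fun y => f (π y) := by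
  obtain ⟨hb, P, T, hT, H⟩ := hf
  refine ⟨hb.lift h, ?_⟩
  -- the registers of the variables of `C` among those of `C'`
  have hidx : ∀ v ∈ C.Γ, ∃ i, ∃ hi : i < C'.Γ.length, C'.Γ[i] = fun y => v (π y) := by
    intro v hv
    exact List.mem_iff_getElem.1 (h.Γ v hv)
  choose! idx hidx using hidx
  refine ⟨fun locs base => P (C.Γ.map fun v => locs.getD (idx v) 0) base, _, hT.lift h, ?_⟩
  intro locs base hl ω y s hy hs hm
  have hlen : locs.length = C'.Γ.length := by simpa using congrArg List.length hs
  have hget : ∀ v ∈ C.Γ, ∃ h' : idx v < locs.length, s.reg locs[idx v] = v (π y) := by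
    intro v hv
    obtain ⟨h1, h2⟩ := hidx v hv
    refine ⟨by omega, ?_⟩
    have h3 : (locs.map s.reg)[idx v]? = (C'.Γ.map fun v => v y)[idx v]? := by rw [hs]
    have h4 : idx v < locs.length := by omega
    simp only [List.getElem?_map, List.getElem?_eq_getElem h4, List.getElem?_eq_getElem h1,
      Option.map_some, Option.some.injEq] at h3
    rw [h3, h2]
  refine H _ base ?_ ω (π y) s (h.D y hy) ?_ (hm.trans (h.mem y))
  · intro l hl'
    obtain ⟨v, hv, rfl⟩ := List.mem_map.1 hl'
    obtain ⟨h', _⟩ := hget v hv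
    rw [List.getD_eq_getElem _ _ h']
    exact hl _ (List.getElem_mem h')
  · rw [List.map_map]
    apply List.map_congr_left
    intro v hv
    obtain ⟨h', h2⟩ := hget v hv
    simp only [Function.comp_apply]
    rw [List.getD_eq_getElem _ _ h', h2]

theorem Comp.var {C : Cx X} {τ : Bool} {v : X → ℕ} (hv : v ∈ C.Γ)
    (hb : PB C false fun x => (v x).size) : Comp C τ v := by
  obtain ⟨i, hi, hiv⟩ := List.mem_iff_getElem.1 hv
  refine ⟨hb, fun locs base => .seq (.const base 0) (.op .add base (locs.getD i 0) base), _,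
    (((PB.const C false 2).add hb).add hb).weaken τ, ?_⟩
  intro locs base hl ω x s hx hs hm
  have hlen : locs.length = C.Γ.length := by simpa using congrArg List.length hs
  have h4 : i < locs.length := by omega
  have h3 : (locs.map s.reg)[i]? = (C.Γ.map fun v => v x)[i]? := by rw [hs]
  simp only [List.getElem?_map, List.getElem?_eq_getElem h4, List.getElem?_eq_getElem hi,
      Option.map_some, Option.some.injEq] at h3
  have hne : locs[i] ≠ base := (hl _ (List.getElem_mem h4)).ne
  refine ⟨_, _, (Run.basic (.const _ _ _)).seq (.basic (.op _ _ _ _ _)), ?_, ?_, ?_, ?_, ?_⟩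
  · simp only [List.getD_eq_getElem _ _ h4, State.setReg_reg, hne, if_false, if_true, h3, hiv,
      Op.eval]
    simp
    omega
  · simp only [List.getD_eq_getElem _ _ h4, State.setReg_reg, hne, if_false, if_true, h3, hiv,
      Op.eval, add_zero]
  · intro l hl'
    simp [hl'.ne]
  · simp
  · simp

theorem Comp.const (C : Cx X) (τ : Bool) (c : ℕ) : Comp C τ fun _ => c := by
  refine ⟨PB.const C false _, fun _ base => .const base c, _, PB.const C τ (1 + c.size), ?_⟩
  intro locs base hl ω x s hx hs hm
  refine ⟨_, _, .basic (.const _ _ _), le_rfl, by simp, ?_, by simp, by simp⟩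
  intro l hl'
  simp [hl'.ne]

theorem Comp.op {C : Cx X} {τ : Bool} {f g : X → ℕ} (o : Op)
    (ho : ∀ a b, (o.eval a b).size ≤ a.size + b.size + 1)
    (hf : Comp C τ f) (hg : Comp C τ g) : Comp C τ fun x => o.eval (f x) (g x) := by
  obtain ⟨hbf, P, T, hT, H⟩ := hf
  obtain ⟨hbg, P', T', hT', H'⟩ := hg
  have hb : PB C false (fun x => (o.eval (f x) (g x)).size) :=
    ((hbf.add hbg).add (PB.const C false 1)).mono fun x _ => ho _ _
  refine ⟨hb, fun locs base => .seq (P locs base) (.seq (P' locs (base + 1))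
    (.op o base base (base + 1))), _,
    (hT.add (hT'.add (((((PB.const C false 1).add hbf).add hbg).add hb).weaken τ))), ?_⟩
  intro locs base hl ω x s hx hs hm
  obtain ⟨t, s₁, r₁, ht, hr₁, hreg₁, hmem₁, hfl₁⟩ := H locs base hl ω x s hx hs hm
  have hs₁ : locs.map s₁.reg = C.Γ.map fun v => v x := by
    rw [← hs]
    exact List.map_congr_left fun l hl' => hreg₁ l (hl l hl')
  obtain ⟨t', s₂, r₂, ht', hr₂, hreg₂, hmem₂, hfl₂⟩ :=
    H' locs (base + 1) (fun l hl' => (hl l hl').trans (Nat.lt_succ_self _)) ω x s₁ hx hs₁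
      (hmem₁.trans hm)
  have e1 : s₂.reg base = f x := by rw [hreg₂ _ (Nat.lt_succ_self _), hr₁]
  refine ⟨_, _, r₁.seq (r₂.seq (.basic (.op _ _ _ _ _))), ?_, ?_, ?_, ?_, ?_⟩
  · rw [e1, hr₂]
    omega
  · simp [e1, hr₂]
  · intro l hl'
    rw [State.setReg_reg, if_neg hl'.ne, hreg₂ _ (by omega), hreg₁ _ hl']
  · simp [hmem₁, hmem₂]
  · simp [hfl₁, hfl₂]

theorem size_add_le (a b : ℕ) : (a + b).size ≤ a.size + b.size + 1 := by
  rw [Nat.size_le]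
  have h1 := Nat.lt_size_self a
  have h2 := Nat.lt_size_self b
  have h3 : 2 ^ a.size ≤ 2 ^ (a.size + b.size) := Nat.pow_le_pow_right (by simp) (by omega)
  have h4 : 2 ^ b.size ≤ 2 ^ (a.size + b.size) := Nat.pow_le_pow_right (by simp) (by omega)
  rw [pow_succ]
  omega

theorem size_mul_le (a b : ℕ) : (a * b).size ≤ a.size + b.size := by
  rw [Nat.size_le, pow_add]
  exact Nat.mul_lt_mul'' (Nat.lt_size_self a) (Nat.lt_size_self b)

theorem Comp.add {C : Cx X} {τ : Bool} {f g : X → ℕ} (hf : Comp C τ f) (hg : Comp C τ g) :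
    Comp C τ fun x => f x + g x := hf.op .add size_add_le hg

theorem Comp.mul {C : Cx X} {τ : Bool} {f g : X → ℕ} (hf : Comp C τ f) (hg : Comp C τ g) :
    Comp C τ fun x => f x * g x :=
  hf.op .mul (fun a b => (size_mul_le a b).trans (Nat.le_succ _)) hg

theorem Comp.sub {C : Cx X} {τ : Bool} {f g : X → ℕ} (hf : Comp C τ f) (hg : Comp C τ g) :
    Comp C τ fun x => f x - g x :=
  hf.op .sub (fun a b => (Nat.size_le_size (Nat.sub_le a b)).trans (by omega)) hg

theorem Comp.div {C : Cx X} {τ : Bool} {f g : X → ℕ} (hf : Comp C τ f) (hg : Comp C τ g) :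
    Comp C τ fun x => f x / g x :=
  hf.op .div (fun a b => (Nat.size_le_size (Nat.div_le_self a b)).trans (by omega)) hg

theorem Comp.mod {C : Cx X} {τ : Bool} {f g : X → ℕ} (hf : Comp C τ f) (hg : Comp C τ g) :
    Comp C τ fun x => f x % g x :=
  hf.op .mod (fun a b => (Nat.size_le_size (Nat.mod_le a b)).trans (by omega)) hg

/-- Reading the memory, if its cells have polynomial bit length. -/
theorem Comp.load {C : Cx X} {τ : Bool} {f : X → ℕ} (hf : Comp C τ f)
    (hb : PB C false fun x => (C.mem x (f x)).size) : Comp C τ fun x => C.mem x (f x) := by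
  obtain ⟨hbf, P, T, hT, H⟩ := hf
  refine ⟨hb, fun locs base => .seq (P locs base) (.load base base), _,
    hT.add ((((PB.const C false 1).add hbf).add hb).weaken τ), ?_⟩
  intro locs base hl ω x s hx hs hm
  obtain ⟨t, s₁, r₁, ht, hr₁, hreg₁, hmem₁, hfl₁⟩ := H locs base hl ω x s hx hs hm
  refine ⟨_, _, r₁.seq (.basic (.load _ _ _)), ?_, ?_, ?_, ?_, ?_⟩
  · rw [hr₁, hmem₁, hm]
    omega
  · simp [hr₁, hmem₁, hm]
  · intro l hl'
    rw [State.setReg_reg, if_neg hl'.ne, hreg₁ _ hl']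
  · simp [hmem₁]
  · simp [hfl₁]

/-- Bounded iteration. The body is executed in a context that has as additional variables the
index and the current value; the latter is known to be the actual iterate `it x i`. -/
theorem Comp.fold {C : Cx X} {τ₁ τ₂ τ : Bool} (hτ : τ₁.toNat + τ₂.toNat ≤ τ.toNat) {b init : X → ℕ}
    {step : X → ℕ → ℕ → ℕ} {it : X → ℕ → ℕ} (hb : Comp C τ b) (hb' : PB C τ₂ b) (hi : Comp C τ init)
    (hit0 : ∀ x, it x 0 = init x) (hit1 : ∀ x j, it x (j + 1) = step x j (it x j))
    (hacc : PB (C.push fun x i => i ≤ b x) false fun z => (it z.1 z.2).size)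
    (hs : Comp ((C.push fun x i => i < b x).push fun z a => a = it z.1 z.2) τ₁
      fun z => step z.1.1 z.1.2 z.2) :
    Comp C τ fun x => it x (b x) := by
  obtain ⟨hbb, Pb, Tb, hTb, Hb⟩ := hb
  obtain ⟨hbi, Pi, Ti, hTi, Hi⟩ := hi
  obtain ⟨hbs, Ps, Ts, ⟨qs, hqs⟩, Hs⟩ := hs
  obtain ⟨qa, hqa⟩ := hacc
  have hsz : ∀ x, C.D x → ∀ i ≤ b x, (it x i).size ≤ qa.eval (C.sz x) := by
    intro x hx i hi
    have := hqa (x, i) ⟨hx, hi⟩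
    rwa [cond_false, one_mul] at this
  have hres : PB C false fun x => (it x (b x)).size :=
    ⟨qa, fun x hx => by rw [cond_false, one_mul]; exact hsz x hx (b x) le_rfl⟩
  -- A register is copied by adding a register with the value `0` to it.
  refine ⟨hres, fun locs base =>
    .seq (Pb locs base) (.seq (Pi locs (base + 1)) (.seq (.const (base + 2) 0) (.seq
      (.loop base (.seq (Ps ((base + 1) :: (base + 2) :: locs) (base + 3))
        (.seq (.const (base + 4) 0) (.seq (.op .add (base + 1) (base + 3) (base + 4))
        (.seq (.const (base + 4) 1) (.seq (.op .add (base + 2) (base + 2) (base + 4))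
        (.op .sub base base (base + 4))))))))
      (.seq (.const (base + 2) 0) (.op .add base (base + 1) (base + 2)))))), ?_⟩
  -- one iteration: the body, and register operations on the new value, the index and the counter
  set I : X → ℕ := fun x => (bif τ₁ then 2 ^ C.κ x else 1) * qs.eval (C.sz x) +
    (20 + 5 * (b x).size + 5 * qa.eval (C.sz x)) with hI
  have hIpb : PB C τ₁ I := by
    refine PB.add ⟨qs, fun x _ => le_rfl⟩ ?_
    exact (((PB.const C false 20).add ((PB.const C false 5).mul hbb)).add
      ((PB.const C false 5).mul (PB.eval qa))).weaken τ₁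
  refine ⟨fun x => Tb x + (Ti x + (1 + (((I x * b x) + (1 + 0)) +
    (1 + (1 + 2 * qa.eval (C.sz x)))))), ?_, ?_⟩
  · refine hTb.add (hTi.add ((PB.const C τ 1).add (((hIpb.mul' hb' τ hτ).add
      (PB.const C τ _)).add ((PB.const C τ _).add ((PB.const C τ _).add
        (((PB.const C false 2).mul (PB.eval qa)).weaken τ))))))
  intro locs base hl ω x s hx hs hm
  obtain ⟨t₁, s₁, r₁, ht₁, hr₁, hreg₁, hmem₁, hfl₁⟩ := Hb locs base hl ω x s hx hs hm
  have hs₁ : locs.map s₁.reg = C.Γ.map fun v => v x := by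
    rw [← hs]
    exact List.map_congr_left fun l hl' => hreg₁ l (hl l hl')
  obtain ⟨t₂, s₂, r₂, ht₂, hr₂, hreg₂, hmem₂, hfl₂⟩ :=
    Hi locs (base + 1) (fun l hl' => (hl l hl').trans (Nat.lt_succ_self _)) ω x s₁ hx hs₁
      (hmem₁.trans hm)
  -- `d` iterations remain; register `base` counts down, `base + 1` holds the value, `base + 2` the index
  have key : ∀ d j, j + d = b x → ∀ s' : State, s'.reg base = d → s'.reg (base + 1) = it x j →
      s'.reg (base + 2) = j → (∀ l < base, s'.reg l = s.reg l) → s'.mem = s.mem →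
      s'.flips = s.flips → ∃ t s'', Run ω
      (.loop base (.seq (Ps ((base + 1) :: (base + 2) :: locs) (base + 3))
        (.seq (.const (base + 4) 0) (.seq (.op .add (base + 1) (base + 3) (base + 4))
        (.seq (.const (base + 4) 1) (.seq (.op .add (base + 2) (base + 2) (base + 4))
        (.op .sub base base (base + 4)))))))) s' t s'' ∧ t ≤ I x * d + (1 + 0) ∧
        s''.reg (base + 1) = it x (b x) ∧ (∀ l < base, s''.reg l = s.reg l) ∧ s''.mem = s.mem ∧
        s''.flips = s.flips := by
    intro d
    induction d with
    | zero =>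
      intro j hj s' h0 h1 h2 hreg hmem hfl
      refine ⟨_, _, .loop_false h0, by simp [h0], ?_, hreg, hmem, hfl⟩
      rw [h1, ← hj, add_zero]
    | succ d ih =>
      intro j hj s' h0 h1 h2 hreg hmem hfl
      have hz : ((C.push fun x i => i < b x).push
          fun z a => a = it z.1 z.2).D
          ((x, j), it x j) := ⟨⟨hx, by show j < b x; omega⟩, rfl⟩
      obtain ⟨t, u, r, ht, hr, hregu, hmemu, hflu⟩ := Hs ((base + 1) :: (base + 2) :: locs) (base + 3)
        (by
          intro l hl'
          simp only [List.mem_cons] at hl'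
          rcases hl' with rfl | rfl | hl'
          · omega
          · omega
          · have := hl l hl'
            omega) ω ((x, j), it x j) s' hz
        (by
          simp only [Cx.push, List.map_cons, List.map_map, h1, h2, List.cons.injEq, true_and]
          have : locs.map s'.reg = locs.map s.reg :=
            List.map_congr_left fun l hl' => hreg l (hl l hl')
          rw [this, hs]
          rfl) (hmem.trans hm)
      have htime := ht.trans (hqs _ hz)
      simp only at hr
      set u' : State := ((((u.setReg (base + 4) 0).setReg (base + 1) (it x (j + 1))).setReg
        (base + 4) 1).setReg (base + 2) (j + 1)).setReg base d with hu'
      have eu0 : u.reg base = d + 1 := by rw [hregu _ (by omega), h0]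
      have eu2 : u.reg (base + 2) = j := by rw [hregu _ (by omega), h2]
      have eu3 : u.reg (base + 3) = it x (j + 1) := by rw [hr, hit1]
      have R1 : Run ω (.op .add (base + 1) (base + 3) (base + 4)) (u.setReg (base + 4) 0)
          (1 + (it x (j + 1)).size + 0 + (it x (j + 1)).size)
          ((u.setReg (base + 4) 0).setReg (base + 1) (it x (j + 1))) := by
        have := Basic.op (ω := ω) (u.setReg (base + 4) 0) .add (base + 1) (base + 3) (base + 4)
        simp [Op.eval, eu3] at this
        exact .basic this
      have R2 : Run ω (.op .add (base + 2) (base + 2) (base + 4))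
          (((u.setReg (base + 4) 0).setReg (base + 1) (it x (j + 1))).setReg (base + 4) 1)
          (1 + j.size + 1 + (j + 1).size)
          ((((u.setReg (base + 4) 0).setReg (base + 1) (it x (j + 1))).setReg (base + 4) 1).setReg
            (base + 2) (j + 1)) := by
        have := Basic.op (ω := ω)
          (((u.setReg (base + 4) 0).setReg (base + 1) (it x (j + 1))).setReg (base + 4) 1)
          .add (base + 2) (base + 2) (base + 4)
        simp [Op.eval, eu2] at this
        exact .basic this
      have R3 : Run ω (.op .sub base base (base + 4))
          ((((u.setReg (base + 4) 0).setReg (base + 1) (it x (j + 1))).setReg (base + 4) 1).setReg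
            (base + 2) (j + 1))
          (1 + (d + 1).size + 1 + d.size) u' := by
        have := Basic.op (ω := ω)
          ((((u.setReg (base + 4) 0).setReg (base + 1) (it x (j + 1))).setReg (base + 4) 1).setReg
            (base + 2) (j + 1))
          .sub base base (base + 4)
        simp [Op.eval, eu0] at this
        exact .basic this
      obtain ⟨t', s'', r', ht', hr', hreg', hmem', hfl'⟩ := ih (j + 1) (by omega) u' (by simp [hu'])
        (by simp [hu']) (by simp [hu'])
        (by
          intro l hl'
          have e1 : l ≠ base + 4 := by omega
          have e2 : l ≠ base + 1 := by omega
          have e3 : l ≠ base + 2 := by omega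
          have e4 : l ≠ base := by omega
          simp only [hu', State.setReg_reg, e1, e2, e3, e4, if_false]
          rw [hregu _ (by omega), hreg _ hl'])
        (by simp [hu', hmemu, hmem]) (by simp [hu', hflu, hfl])
      refine ⟨_, _, .loop_true (by rw [h0]; simp) (r.seq ((Run.basic (.const _ _ _)).seq (R1.seq
        ((Run.basic (.const _ _ _)).seq (R2.seq R3))))) r', ?_, hr', hreg', hmem', hfl'⟩
      have b1 := hsz x hx (j + 1) (by omega)
      have b2 : (j + 1).size ≤ (b x).size := Nat.size_le_size (by omega)
      have b3 : j.size ≤ (b x).size := Nat.size_le_size (by omega)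
      have b4 : d.size ≤ (b x).size := Nat.size_le_size (by omega)
      have b5 : (d + 1).size ≤ (b x).size := Nat.size_le_size (by omega)
      rw [h0, mul_add, mul_one]
      have e0 : Nat.size 0 = 0 := rfl
      have e1 : Nat.size 1 = 1 := by simp
      rw [e0, e1]
      have htime' : t ≤ (bif τ₁ then 2 ^ C.κ x else 1) * qs.eval (C.sz x) := htime
      have hIx : I x = (bif τ₁ then 2 ^ C.κ x else 1) * qs.eval (C.sz x) +
        (20 + 5 * (b x).size + 5 * qa.eval (C.sz x)) := rfl
      omega
  obtain ⟨t₃, s₃, r₃, ht₃, hr₃, hreg₃, hmem₃, hfl₃⟩ := key (b x) 0 (by simp)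
    (s₂.setReg (base + 2) 0)
    (by simp [hreg₂ base (by omega), hr₁]) (by simp [hr₂, hit0]) (by simp)
    (by
      intro l hl'
      have e3 : l ≠ base + 2 := by omega
      simp only [State.setReg_reg, e3, if_false]
      rw [hreg₂ _ (by omega), hreg₁ _ hl'])
    (by simp [hmem₂, hmem₁]) (by simp [hfl₂, hfl₁])
  have R4 : Run ω (.op .add base (base + 1) (base + 2)) (s₃.setReg (base + 2) 0)
      (1 + (it x (b x)).size + 0 + (it x (b x)).size)
      ((s₃.setReg (base + 2) 0).setReg base (it x (b x))) := by
    have := Basic.op (ω := ω) (s₃.setReg (base + 2) 0) .add base (base + 1) (base + 2)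
    simp [Op.eval, hr₃] at this
    exact .basic this
  refine ⟨_, _, r₁.seq (r₂.seq ((Run.basic (.const _ _ _)).seq (r₃.seq
    ((Run.basic (.const _ _ _)).seq R4)))), ?_, by simp, ?_, by simp [hmem₃], by simp [hfl₃]⟩
  · have b1 := hsz x hx (b x) le_rfl
    have e0 : Nat.size 0 = 0 := rfl
    change _ ≤ Tb x + (Ti x + (1 + (I x * b x + (1 + 0) + (1 + (1 + 2 * qa.eval (C.sz x))))))
    rw [e0]
    omega
  · intro l hl'
    have e3 : l ≠ base + 2 := by omega
    have e4 : l ≠ base := by omega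
    simp only [State.setReg_reg, e3, e4, if_false]
    exact hreg₃ l hl'

end RAM

/-! ### Closure properties of computability -/

namespace RAM

open Polynomial

variable {X Y Z : Type}

theorem PB.size {C : Cx X} {τ : Bool} {f : X → ℕ} (h : PB C τ f) : PB C τ fun x => (f x).size :=
  h.mono fun _ _ => Nat.size_le.2 Nat.lt_two_pow_self

/-- Conditional expressions are computed by arithmetic with truncated subtraction. -/
theorem Comp.ite_le {C : Cx X} {τ : Bool} {f g a b : X → ℕ} (hf : Comp C τ f) (hg : Comp C τ g)
    (ha : Comp C τ a) (hb : Comp C τ b) : Comp C τ fun x => if f x ≤ g x then a x else b x := by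
  refine Comp.congr (((((Comp.const C τ 1).sub (hf.sub hg))).mul ha).add
    (((Comp.const C τ 1).sub ((Comp.const C τ 1).sub (hf.sub hg))).mul hb)) fun x _ => ?_
  split_ifs with h
  · simp [Nat.sub_eq_zero_of_le h]
  · have : 1 - (f x - g x) = 0 := by omega
    simp [this]

theorem Comp.ite_eq {C : Cx X} {τ : Bool} {f g a b : X → ℕ} (hf : Comp C τ f) (hg : Comp C τ g)
    (ha : Comp C τ a) (hb : Comp C τ b) : Comp C τ fun x => if f x = g x then a x else b x := by
  refine Comp.congr (Comp.ite_le hf hg (Comp.ite_le hg hf ha hb) hb) fun x _ => ?_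
  split_ifs <;> first | rfl | omega

theorem Comp.min {C : Cx X} {τ : Bool} {f g : X → ℕ} (hf : Comp C τ f) (hg : Comp C τ g) :
    Comp C τ fun x => min (f x) (g x) :=
  (Comp.ite_le hf hg hf hg).congr fun _ _ => min_def _ _

theorem Comp.max {C : Cx X} {τ : Bool} {f g : X → ℕ} (hf : Comp C τ f) (hg : Comp C τ g) :
    Comp C τ fun x => max (f x) (g x) :=
  (Comp.ite_le hf hg hg hf).congr fun _ _ => max_def _ _

theorem Comp.var_push {C : Cx X} {τ : Bool} {P : X → ℕ → Prop}
    (h : PB (C.push P) false fun z => z.2.size) : Comp (C.push P) τ fun z => z.2 :=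
  Comp.var (List.mem_cons_self ..) h

theorem PB.var_lt {C : Cx X} {τ : Bool} {b : X → ℕ} (hb : PB C τ b) :
    PB (C.push fun x i => i < b x) τ fun z => z.2 :=
  (hb.lift (C.ext_push _)).mono fun _ hz => hz.2.le

theorem PB.var_lt_size {C : Cx X} {τ : Bool} {b : X → ℕ} (hb : PB C τ fun x => (b x).size) :
    PB (C.push fun x i => i < b x) τ fun z => z.2.size :=
  (hb.lift (C.ext_push _)).mono fun _ hz => Nat.size_le_size hz.2.le

theorem PB.var_eq {C : Cx X} {b : X → ℕ} {it : X → ℕ → ℕ}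
    (h : PB (C.push fun x i => i ≤ b x) false fun z => (it z.1 z.2).size) :
    PB ((C.push fun x i => i < b x).push fun z a => a = it z.1 z.2) false fun z => z.2.size := by
  obtain ⟨q, hq⟩ := h
  refine ⟨q, ?_⟩
  rintro ⟨z, a⟩ ⟨⟨h1, h2⟩, h3 : a = it z.1 z.2⟩
  subst h3
  exact hq z ⟨h1, h2.le⟩

/-- Sums of a number of terms that may be exponential in `κ` if `τ₂` is true. -/
theorem Comp.sum_lt {C : Cx X} {τ₁ τ₂ τ : Bool} (hτ : τ₁.toNat + τ₂.toNat ≤ τ.toNat) {b : X → ℕ}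
    {f : X → ℕ → ℕ} (hb : Comp C τ b) (hb' : PB C τ₂ b)
    (hf : Comp (C.push fun x i => i < b x) τ₁ fun z => f z.1 z.2) :
    Comp C τ fun x => ∑ i ∈ Finset.range (b x), f x i := by
  have hacc : PB (C.push fun x i => i ≤ b x) false
      fun z => (∑ i ∈ Finset.range z.2, f z.1 i).size := by
    obtain ⟨q, hq⟩ := hf.size
    refine PB.mono (((hb.size.lift (C.ext_push _)).add (PB.eval q)).add (PB.const _ _ 1))
      fun z hz => ?_
    rw [add_assoc]
    have h1 : ∑ i ∈ Finset.range z.2, f z.1 i ≤ b z.1 * 2 ^ (q.eval (C.sz z.1)) := by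
      calc ∑ i ∈ Finset.range z.2, f z.1 i
          ≤ ∑ i ∈ Finset.range z.2, 2 ^ (q.eval (C.sz z.1)) := by
            refine Finset.sum_le_sum fun i hi => ?_
            have := hq (z.1, i) ⟨hz.1, (Finset.mem_range.1 hi).trans_le hz.2⟩
            rw [cond_false, one_mul] at this
            exact (Nat.size_le.1 this).le
        _ ≤ _ := by
            rw [Finset.sum_const, Finset.card_range, smul_eq_mul]
            exact Nat.mul_le_mul_right _ hz.2
    refine (Nat.size_le_size h1).trans ((size_mul_le _ _).trans ?_)
    rw [Nat.size_pow]
    exact le_rfl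
  exact Comp.fold (τ₁ := τ₁) (τ₂ := τ₂) hτ (step := fun x i a => a + f x i)
    (it := fun x j => ∑ i ∈ Finset.range j, f x i) hb hb' (Comp.const C τ 0) (fun _ => rfl)
    (fun x j => Finset.sum_range_succ _ _) hacc
    (Comp.add (Comp.var_push (PB.var_eq (it := fun x j => ∑ i ∈ Finset.range j, f x i) hacc))
      (hf.lift (Cx.ext_push _ _)))

/-- The number of terms is polynomial. The terms have to be computable in any context that has the
summation index as an additional variable of polynomial size. -/
theorem Comp.sum {C : Cx X} {τ : Bool} {b : X → ℕ} {f : X → ℕ → ℕ} (hb : Comp C τ b)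
    (hb' : PB C false b)
    (hf : ∀ C' : Cx (X × ℕ), Ext C C' Prod.fst → (∀ τ', Comp C' τ' fun z => z.2) →
      (PB C' false fun z => z.2) → Comp C' τ fun z => f z.1 z.2) :
    Comp C τ fun x => ∑ i ∈ Finset.range (b x), f x i :=
  Comp.sum_lt (by simp) hb hb' (hf _ (Cx.ext_push _ _)
    (fun _ => Comp.var_push (PB.var_lt_size hb.size)) (PB.var_lt hb'))

theorem Comp.prod {C : Cx X} {τ : Bool} {b : X → ℕ} {f : X → ℕ → ℕ} (hb : Comp C τ b)
    (hb' : PB C false b)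
    (hf' : ∀ C' : Cx (X × ℕ), Ext C C' Prod.fst → (∀ τ', Comp C' τ' fun z => z.2) →
      (PB C' false fun z => z.2) → Comp C' τ fun z => f z.1 z.2) :
    Comp C τ fun x => ∏ i ∈ Finset.range (b x), f x i := by
  have hf := hf' _ (Cx.ext_push _ _)
    (fun _ => Comp.var_push (PB.var_lt_size hb.size)) (PB.var_lt hb')
  have hacc : PB (C.push fun x i => i ≤ b x) false
      fun z => (∏ i ∈ Finset.range z.2, f z.1 i).size := by
    obtain ⟨q, hq⟩ := hf.size
    refine PB.mono (((PB.eval q).mul (hb'.lift (C.ext_push _))).add (PB.const _ _ 1))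
      fun z hz => ?_
    have h1 : ∏ i ∈ Finset.range z.2, f z.1 i ≤ 2 ^ (q.eval (C.sz z.1) * b z.1) := by
      calc ∏ i ∈ Finset.range z.2, f z.1 i
          ≤ ∏ i ∈ Finset.range z.2, 2 ^ (q.eval (C.sz z.1)) := by
            refine Finset.prod_le_prod' fun i hi => ?_
            have := hq (z.1, i) ⟨hz.1, (Finset.mem_range.1 hi).trans_le hz.2⟩
            rw [cond_false, one_mul] at this
            exact (Nat.size_le.1 this).le
        _ ≤ _ := by
            rw [Finset.prod_const, Finset.card_range, ← pow_mul]
            exact Nat.pow_le_pow_right (by simp) (Nat.mul_le_mul_left _ hz.2)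
    refine (Nat.size_le_size h1).trans ?_
    rw [Nat.size_pow]
    exact le_rfl
  exact Comp.fold (τ₁ := τ) (τ₂ := false) (by simp) (step := fun x i a => a * f x i)
    (it := fun x j => ∏ i ∈ Finset.range j, f x i) hb hb' (Comp.const C τ 1) (fun _ => rfl)
    (fun x j => Finset.prod_range_succ _ _) hacc
    (Comp.mul (Comp.var_push (PB.var_eq (it := fun x j => ∏ i ∈ Finset.range j, f x i) hacc))
      (hf.lift (Cx.ext_push _ _)))

theorem Comp.pow {C : Cx X} {τ : Bool} {f g : X → ℕ} (hf : Comp C τ f) (hg : Comp C τ g)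
    (hg' : PB C false g) : Comp C τ fun x => f x ^ g x := by
  refine (Comp.prod (f := fun x _ => f x) hg hg' fun C' hE _ _ => hf.lift hE).congr fun x _ => ?_
  rw [Finset.prod_const, Finset.card_range]

/-- The bit length of a number of polynomial size is the number of powers of two below it. -/
theorem Comp.bitLength {C : Cx X} {f : X → ℕ} (hf : Comp C false f)
    (hf' : PB C false f) : Comp C false fun x => (f x).size := by
  refine (Comp.sum (f := fun x t => if 2 ^ t ≤ f x then 1 else 0) hf hf' fun C' hE h1 h2 =>
    Comp.ite_le ((Comp.const _ _ 2).pow (h1 _) h2) (hf.lift hE) (Comp.const _ _ 1)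
      (Comp.const _ _ 0)).congr fun x _ => ?_
  rw [Finset.sum_boole, Nat.cast_id]
  have : (Finset.range (f x)).filter (fun t => 2 ^ t ≤ f x) = Finset.range (f x).size := by
    ext t
    rw [Finset.mem_filter, Finset.mem_range, Finset.mem_range, Nat.lt_size]
    exact ⟨fun h => h.2, fun h => ⟨Nat.lt_two_pow_self.trans_le h, h⟩⟩
  rw [this, Finset.card_range]

/-! ### Arrays packed into numbers -/

/-- The number whose `n` lowest digits in base `H` are the numbers `f i % H`. -/
def pack (H n : ℕ) (f : ℕ → ℕ) : ℕ := ∑ i ∈ Finset.range n, f i % H * H ^ i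

/-- The digit number `i` of `v` in base `H`. -/
def digit (H v i : ℕ) : ℕ := v / H ^ i % H

theorem digit_lt {H : ℕ} (hH : 0 < H) (v i : ℕ) : digit H v i < H := Nat.mod_lt _ hH

theorem pack_lt {H : ℕ} (hH : 0 < H) (n : ℕ) (f : ℕ → ℕ) : pack H n f < H ^ n := by
  induction n with
  | zero => simp [pack]
  | succ n ih =>
    rw [pack, Finset.sum_range_succ, ← pack, pow_succ]
    have h1 : f n % H + 1 ≤ H := Nat.mod_lt _ hH
    have h2 := Nat.mul_le_mul_right (H ^ n) h1
    rw [add_mul, one_mul, mul_comm H] at h2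
    omega

theorem digit_pack {H : ℕ} (hH : 0 < H) {n : ℕ} (f : ℕ → ℕ) {i : ℕ} (hi : i < n) :
    digit H (pack H n f) i = f i % H := by
  induction n with
  | zero => omega
  | succ n ih =>
    rw [pack, Finset.sum_range_succ, ← pack, digit]
    rcases Nat.lt_succ_iff_lt_or_eq.1 hi with h | rfl
    · obtain ⟨c, rfl⟩ := Nat.exists_eq_add_of_lt h
      have : f (i + c + 1) % H * H ^ (i + c + 1) = H ^ i * (H * (f (i + c + 1) % H * H ^ c)) := by
        ring
      rw [this, Nat.add_mul_div_left _ _ (by positivity), Nat.add_mul_mod_self_left]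
      exact ih h
    · rw [Nat.add_mul_div_right _ _ (by positivity), Nat.div_eq_of_lt (pack_lt hH _ _), zero_add,
        Nat.mod_mod]

/-- Iteration of a transformation of arrays, on packed arrays. -/
def vecIter (H n : ℕ) (init : ℕ → ℕ) (step : ℕ → (ℕ → ℕ) → ℕ → ℕ) (t : ℕ) : ℕ :=
  Nat.rec (pack H n init) (fun j a => pack H n (step j (digit H a))) t

theorem vecIter_lt {H : ℕ} (hH : 0 < H) (n : ℕ) (init : ℕ → ℕ) (step : ℕ → (ℕ → ℕ) → ℕ → ℕ)
    (t : ℕ) : vecIter H n init step t < H ^ n := by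
  cases t <;> exact pack_lt hH _ _

/-- The packed iteration computes the iteration of arrays `u`, provided that the entries stay
below the base and that the step does not look beyond the end of the array. -/
theorem digit_vecIter {H n : ℕ} {init : ℕ → ℕ} {step : ℕ → (ℕ → ℕ) → ℕ → ℕ} (hH : 0 < H)
    (u : ℕ → ℕ → ℕ) {T : ℕ} (h0 : ∀ i < n, u 0 i = init i)
    (hs : ∀ t < T, ∀ v, (∀ i < n, v i = u t i) → ∀ i < n, step t v i = u (t + 1) i)
    (hlt : ∀ t ≤ T, ∀ i < n, u t i < H) :
    ∀ t ≤ T, ∀ i < n, digit H (vecIter H n init step t) i = u t i := by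
  intro t
  induction t with
  | zero =>
    intro ht i hi
    change digit H (pack H n init) i = _
    rw [digit_pack hH _ hi, ← h0 i hi, Nat.mod_eq_of_lt (hlt 0 ht i hi)]
  | succ t ih =>
    intro ht i hi
    change digit H (pack H n (step t (digit H (vecIter H n init step t)))) i = _
    rw [digit_pack hH _ hi, hs t (by omega) _ (ih (by omega)) i hi,
      Nat.mod_eq_of_lt (hlt _ ht i hi)]

theorem Comp.digit {C : Cx X} {τ : Bool} {H v i : X → ℕ} (hH : Comp C τ H) (hv : Comp C τ v)
    (hi : Comp C τ i) (hi' : PB C false i) : Comp C τ fun x => RAM.digit (H x) (v x) (i x) :=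
  (hv.div (hH.pow hi hi')).mod hH

theorem Comp.pack {C : Cx X} {τ : Bool} {H n : X → ℕ} {f : X → ℕ → ℕ} (hH : Comp C τ H)
    (hn : Comp C τ n) (hn' : PB C false n)
    (hf : ∀ C' : Cx (X × ℕ), Ext C C' Prod.fst → (∀ τ', Comp C' τ' fun z => z.2) →
      (PB C' false fun z => z.2) → Comp C' τ fun z => f z.1 z.2) :
    Comp C τ fun x => RAM.pack (H x) (n x) (f x) :=
  Comp.sum (f := fun x i => f x i % H x * H x ^ i) hn hn' fun C' hE h1 h2 =>
    ((hf C' hE h1 h2).mod (hH.lift hE)).mul ((hH.lift hE).pow (h1 _) h2)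

/-- Iteration of array transformations. The step has access to the variables of the context, the
round `z.1.1.2`, the packed array `z.1.2`, and the index `z.2` of the entry to be computed. -/
theorem Comp.vecIter {C : Cx X} {τ : Bool} {H n T : X → ℕ} {init : X → ℕ → ℕ}
    {step : X → ℕ → (ℕ → ℕ) → ℕ → ℕ} (hpos : ∀ x, C.D x → 0 < H x) (hH : Comp C τ H)
    (hn : Comp C τ n) (hn' : PB C false n) (hT : Comp C τ T) (hT' : PB C false T)
    (hi : ∀ C' : Cx (X × ℕ), Ext C C' Prod.fst → (∀ τ', Comp C' τ' fun z => z.2) →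
      (PB C' false fun z => z.2) → Comp C' τ fun z => init z.1 z.2)
    (hs : ∀ C' : Cx (((X × ℕ) × ℕ) × ℕ), Ext C C' (fun z => z.1.1.1) →
      (∀ τ', Comp C' τ' fun z => z.1.1.2) → (PB C' false fun z => z.1.1.2) →
      (∀ τ', Comp C' τ' fun z => z.1.2) →
      (∀ τ', Comp C' τ' fun z => z.2) → (PB C' false fun z => z.2) →
      Comp C' τ fun z => step z.1.1.1 z.1.1.2 (RAM.digit (H z.1.1.1) z.1.2) z.2) :
    Comp C τ fun x => RAM.vecIter (H x) (n x) (init x) (step x) (T x) := by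
  obtain ⟨it, hit⟩ : ∃ it : X → ℕ → ℕ,
    it = fun x j => RAM.vecIter (H x) (n x) (init x) (step x) j := ⟨_, rfl⟩
  have hacc : PB (C.push fun x i => i ≤ T x) false fun z => (it z.1 z.2).size := by
    refine PB.mono ((hH.pow hn hn').size.lift (C.ext_push _)) fun z hz => ?_
    rw [hit]
    exact Nat.size_le_size (vecIter_lt (hpos z.1 hz.1) _ _ _ _).le
  have h := Comp.fold (τ₁ := τ) (τ₂ := false) (τ := τ) (by simp)
    (step := fun x j a => RAM.pack (H x) (n x) (step x j (RAM.digit (H x) a)))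
    (it := it) hT hT' (Comp.pack hH hn hn' hi) (fun _ => by rw [hit]; rfl)
    (fun _ _ => by rw [hit]; rfl) hacc ?_
  · rwa [hit] at h
  have hvar := PB.var_eq hacc
  clear hit
  have hE := (Cx.ext_push C fun x i => i < T x).trans (Cx.ext_push (C.push fun x i => i < T x)
    fun z a => a = it z.1 z.2)
  have hH' := hH.lift hE
  have hn₁ := hn.lift hE
  have hn₂ := hn'.lift hE
  have hp := Comp.pack (X := (X × ℕ) × ℕ) (H := fun z => H z.1.1) (n := fun z => n z.1.1)
    (f := fun z => step z.1.1 z.1.2 (RAM.digit (H z.1.1) z.2)) hH' hn₁ hn₂ ?_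
  · exact hp
  intro C' hE' h1 h2
  have e1 := (Cx.ext_push (C.push fun x i => i < T x) fun z a => a = it z.1 z.2).trans hE'
  have v1 : ∀ τ', Comp C' τ' fun z => z.1.1.2 := fun τ' =>
    Comp.lift (Comp.var_push (τ := τ') (PB.var_lt_size hT.size)) e1
  have v2 : PB C' false fun z => z.1.1.2 := PB.lift (PB.var_lt hT') e1
  have v3 : ∀ τ', Comp C' τ' fun z => z.1.2 := fun τ' =>
    Comp.lift (Comp.var_push (τ := τ') hvar) hE'
  exact hs C' (hE.trans hE') v1 v2 v3 h1 h2

end RAM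

/-! ### The algorithm as a function on natural numbers -/

namespace RAM

variable {X Y Z : Type}

/-- The data for the main computation: the number `n` of names of vertices, the number `m` of edges
that have to be covered, the vertex `e q` at the end `q < 2 * m` of an edge (the ends of the edge
`i` are `2 * i` and `2 * i + 1`), the weights `w`, the bound `ℓ`, and a random number `R`. -/
structure Inp where
  n : ℕ
  m : ℕ
  ℓ : ℕ
  R : ℕ
  e : ℕ → ℕ
  w : ℕ → ℕ → ℕ

namespace Inp

variable (I : Inp)

/-- The number of copies of vertices; there are `2 * n + 1` copies for each end of an edge. -/
def N : ℕ := 2 * I.m * (2 * I.n + 1)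

/-- The vertex of a copy. -/
def h (p : ℕ) : ℕ := I.e (p % (2 * I.m))

/-- The component of a vertex, found by processing the edges one by one: the `t`-th edge merges
the classes of its ends. -/
def lab (v : ℕ) : ℕ :=
  digit (I.n + 1) (vecIter (I.n + 1) (I.n + 1) (fun v => v)
    (fun t u v => if u v = u (I.e (2 * t + 1)) then u (I.e (2 * t)) else u v) I.m) v

/-- Whether `j` is the class of a vertex on an edge. -/
def att (j : ℕ) : ℕ := min 1 (∑ q ∈ Finset.range (2 * I.m), if I.lab (I.e q) = j then 1 else 0)

/-- The number of the component of a vertex, in a numbering by `0, …, k - 1`. -/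
def comp (v : ℕ) : ℕ := ∑ j ∈ Finset.range (I.lab v), I.att j

/-- The number of components. -/
def k : ℕ := ∑ j ∈ Finset.range (I.n + 1), I.att j

/-- The random perturbation of a weight is a number below `W`; this is a power of two, and larger
than three times the number of pairs of copies. -/
def W : ℕ := 2 ^ (3 * I.N ^ 2).size

/-- Factor by which weights are multiplied, so that they dominate the perturbation. -/
def K : ℕ := I.N * I.W + 1

/-- Bound for the perturbed weights. -/
def xm : ℕ := I.K * (I.ℓ + 2)

/-- Exponent to be added for each matched copy; it ensures that perfect matchings and involutions with fixed points
have their terms in separate ranges of degrees. -/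
def C : ℕ := (I.N + 2) * I.xm

/-- The weight of a pair of vertices, capped, and zero for a pair of equal vertices. -/
def wt (u v : ℕ) : ℕ := if u = v then 0 else min (I.w u v) (I.ℓ + 1)

/-- The exponent of the indeterminate in the matrix entry of two copies. -/
def x (p q : ℕ) : ℕ :=
  if p = q then 0 else
    I.C + I.K * I.wt (I.h p) (I.h q) + digit I.W I.R (max p q + I.N * min p q)

/-- Number of bits provided for each coefficient of a polynomial. The sum over at most `2 ^ n` cuts of
products of `N` factors with value at most `(N + 2) ^ (N + 3)` at `1` stays below `2 ^ B`. -/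
def B : ℕ := I.n + (I.N + 2) * (I.N + 3) * I.N + 2

/-- The side of a vertex in the cut number `S` of the set of components. -/
def side (S v : ℕ) : ℕ := S / 2 ^ I.comp v % 2

/-- The matrix for the cut `S`, with the indeterminate replaced by `2 ^ B`. -/
def ent (S p q : ℕ) : ℕ :=
  if p = q then 0 else if I.side S (I.h p) = I.side S (I.h q) then (2 ^ I.B) ^ I.x p q else 0

/-- Base for packed vectors. -/
def H : ℕ := (2 ^ (I.B * (I.C + I.xm)) * (I.N + 1)) ^ (I.N + 2) + 1

/-- The vector `A ^ j * c`, packed, for the leading block `A` of size `r` and the part `c` of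
column `r` above the diagonal. -/
def wv (S r j : ℕ) : ℕ :=
  vecIter I.H r (fun i => I.ent S i r)
    (fun _ u i => ∑ i' ∈ Finset.range r, I.ent S i i' * u i') j

/-- One factor of the determinant for the cut `S`, with the indeterminate replaced by `2 ^ B`. -/
def fac (S r : ℕ) : ℕ :=
  1 + ∑ j ∈ Finset.range (I.N + 1), ∑ i ∈ Finset.range r, I.ent S r i * digit I.H (I.wv S r j) i

/-- The sum of the computed polynomials over all cuts with the last component on the side `0`. -/
def tot : ℕ := ∑ S ∈ Finset.range (2 ^ (I.k - 1)), ∏ r ∈ Finset.range I.N, I.fac S r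

/-- The number of odd coefficients in the range of degrees of the perfect matchings of weight at most
`ℓ`: each matched pair counts twice, so that `d` is less than `K * (2 * ℓ + 1)`. -/
def accept : ℕ :=
  ∑ d ∈ Finset.range (I.K * (2 * I.ℓ + 1)), I.tot / (2 ^ I.B) ^ (I.C * I.N + d) % 2

theorem W_pos : 0 < I.W := by
  unfold W
  positivity

end Inp

/-- The data `d` are computable in the context `C`, and of polynomial size. -/
structure InpOK (C : Cx X) (d : X → Inp) : Prop where
  n : Comp C false fun x => (d x).n
  m : Comp C false fun x => (d x).m
  ℓ : Comp C false fun x => (d x).ℓ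
  n' : PB C false fun x => (d x).n
  m' : PB C false fun x => (d x).m
  ℓ' : PB C false fun x => (d x).ℓ
  e : ∀ {Y : Type} (C' : Cx Y) (π : Y → X) (i : Y → ℕ), Ext C C' π → Comp C' false i →
    PB C' false i → Comp C' false fun y => (d (π y)).e (i y)
  w : ∀ {Y : Type} (C' : Cx Y) (π : Y → X) (i j : Y → ℕ), Ext C C' π → Comp C' false i →
    PB C' false i → Comp C' false j → PB C' false j → Comp C' false fun y => (d (π y)).w (i y) (j y)
  e_le : ∀ x, C.D x → ∀ q, (d x).e q ≤ (d x).n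

/-! For a quantity `F` of the data, the lemma `cF` says that it is computable, and `pF` that it is
polynomially bounded. -/

namespace InpOK

theorem lift {C : Cx X} {C' : Cx Y} {d : X → Inp} {π : Y → X} (hd : InpOK C d) (h : Ext C C' π) :
    InpOK C' fun y => d (π y) where
  n := hd.n.lift h
  m := hd.m.lift h
  ℓ := hd.ℓ.lift h
  n' := hd.n'.lift h
  m' := hd.m'.lift h
  ℓ' := hd.ℓ'.lift h
  e C'' ρ i h' := hd.e C'' (fun z => π (ρ z)) i (h.trans h')
  w C'' ρ i j h' := hd.w C'' (fun z => π (ρ z)) i j (h.trans h')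
  e_le y hy := hd.e_le (π y) (h.D y hy)

variable {C : Cx X} {d : X → Inp} (hd : InpOK C d)
include hd

theorem ce {i : X → ℕ} (hi : Comp C false i) (hi' : PB C false i) :
    Comp C false fun x => (d x).e (i x) := hd.e C _ i (Ext.refl C) hi hi'

theorem pe (i : X → ℕ) : PB C false fun x => (d x).e (i x) := hd.n'.mono fun x hx => hd.e_le x hx _

theorem cM : Comp C false fun x => 2 * (d x).m := (Comp.const _ _ 2).mul hd.m

theorem pM : PB C false fun x => 2 * (d x).m := (PB.const _ _ 2).mul hd.m'

theorem cN : Comp C false fun x => (d x).N :=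
  hd.cM.mul (((Comp.const _ _ 2).mul hd.n).add (Comp.const _ _ 1))

theorem pN : PB C false fun x => (d x).N :=
  hd.pM.mul (((PB.const _ _ 2).mul hd.n').add (PB.const _ _ 1))

theorem cH {p : X → ℕ} (hp : Comp C false p) (hp' : PB C false p) :
    Comp C false fun x => (d x).h (p x) := hd.ce (hp.mod hd.cM) hp'.mod

theorem ph (p : X → ℕ) : PB C false fun x => (d x).h (p x) := hd.pe _

theorem cn1 : Comp C false fun x => (d x).n + 1 := hd.n.add (Comp.const _ _ 1)

theorem pn1 : PB C false fun x => (d x).n + 1 := hd.n'.add (PB.const _ _ 1)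

theorem clab {v : X → ℕ} (hv : Comp C false v) (hv' : PB C false v) :
    Comp C false fun x => (d x).lab (v x) := by
  refine Comp.digit hd.cn1 (Comp.vecIter
    (step := fun x t u v => if u v = u ((d x).e (2 * t + 1)) then u ((d x).e (2 * t)) else u v)
    (fun x _ => Nat.succ_pos _) hd.cn1 hd.cn1 hd.pn1 hd.m hd.m' (fun C' _ h1 _ => h1 _) ?_) hv hv'
  intro C' hE ht ht' ha hi hi'
  have hd' := hd.lift hE
  have c2 : Comp C' false fun z => 2 * z.1.1.2 := (Comp.const _ _ 2).mul (ht _)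
  have p2 : PB C' false fun z => 2 * z.1.1.2 := (PB.const _ _ 2).mul ht'
  have dg : ∀ {i : ((X × ℕ) × ℕ) × ℕ → ℕ}, Comp C' false i → PB C' false i →
      Comp C' false fun z => digit ((d z.1.1.1).n + 1) z.1.2 (i z) :=
    fun h h' => Comp.digit hd'.cn1 (ha _) h h'
  exact Comp.ite_eq (dg (hi _) hi')
    (dg (hd'.ce (c2.add (Comp.const _ _ 1)) (p2.add (PB.const _ _ 1))) (hd'.pe _))
    (dg (hd'.ce c2 p2) (hd'.pe _)) (dg (hi _) hi')

theorem plab (v : X → ℕ) : PB C false fun x => (d x).lab (v x) :=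
  hd.pn1.mono fun _ _ => (digit_lt (Nat.succ_pos _) _ _).le

theorem catt {j : X → ℕ} (hj : Comp C false j) : Comp C false fun x => (d x).att (j x) := by
  refine (Comp.const _ _ 1).min (Comp.sum
    (f := fun x q => if (d x).lab ((d x).e q) = j x then 1 else 0) hd.cM hd.pM ?_)
  intro C' hE h1 h2
  have hd' := hd.lift hE
  exact Comp.ite_eq (hd'.clab (hd'.ce (h1 _) h2) (hd'.pe _)) (hj.lift hE) (Comp.const _ _ 1)
    (Comp.const _ _ 0)

theorem ccomp {v : X → ℕ} (hv : Comp C false v) (hv' : PB C false v) :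
    Comp C false fun x => (d x).comp (v x) :=
  Comp.sum (f := fun x j => (d x).att j) (hd.clab hv hv') (hd.plab v) fun _ hE h1 _ =>
    (hd.lift hE).catt (h1 _)

end InpOK

theorem Inp.att_le (I : Inp) (j : ℕ) : I.att j ≤ 1 := min_le_left _ _

theorem Inp.comp_le (I : Inp) (v : ℕ) : I.comp v ≤ I.lab v := by
  refine (Finset.sum_le_sum fun j _ => I.att_le j).trans ?_
  simp

theorem Inp.k_le (I : Inp) : I.k ≤ I.n + 1 := by
  refine (Finset.sum_le_sum fun j _ => I.att_le j).trans ?_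
  simp

namespace InpOK

variable {C : Cx X} {d : X → Inp} (hd : InpOK C d)
include hd

theorem pcomp (v : X → ℕ) : PB C false fun x => (d x).comp (v x) :=
  (hd.plab v).mono fun _ _ => Inp.comp_le _ _

theorem ck : Comp C false fun x => (d x).k :=
  Comp.sum (f := fun x j => (d x).att j) hd.cn1 hd.pn1 fun _ hE h1 _ => (hd.lift hE).catt (h1 _)

theorem pk : PB C false fun x => (d x).k := hd.pn1.mono fun _ _ => Inp.k_le _

theorem c3N : Comp C false fun x => 3 * (d x).N ^ 2 :=
  (Comp.const _ _ 3).mul (hd.cN.pow (Comp.const _ _ 2) (PB.const _ _ 2))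

theorem p3N : PB C false fun x => 3 * (d x).N ^ 2 :=
  (PB.const _ _ 3).mul ((hd.pN.mul hd.pN).mono fun _ _ => (sq _).le)

/-- The number of random bits for one pair of copies. -/
theorem cs : Comp C false fun x => (3 * (d x).N ^ 2).size := hd.c3N.bitLength hd.p3N

theorem cW : Comp C false fun x => (d x).W := (Comp.const _ _ 2).pow hd.cs hd.p3N.size

theorem pW : PB C false fun x => (d x).W := by
  refine (((PB.const _ _ 2).mul hd.p3N).add (PB.const _ _ 1)).mono fun x _ => ?_
  rw [Inp.W]
  rcases Nat.eq_zero_or_pos (3 * (d x).N ^ 2) with h | h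
  · simp [h]
  · have h1 : 0 < (3 * (d x).N ^ 2).size := Nat.size_pos.2 h
    have h2 : 2 ^ ((3 * (d x).N ^ 2).size - 1) ≤ 3 * (d x).N ^ 2 := by
      rw [← Nat.lt_size]
      omega
    have h3 : 2 ^ (3 * (d x).N ^ 2).size = 2 * 2 ^ ((3 * (d x).N ^ 2).size - 1) := by
      rw [← pow_succ']
      congr 1
      omega
    omega

theorem cK : Comp C false fun x => (d x).K := (hd.cN.mul hd.cW).add (Comp.const _ _ 1)

theorem pK : PB C false fun x => (d x).K := (hd.pN.mul hd.pW).add (PB.const _ _ 1)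

theorem cxm : Comp C false fun x => (d x).xm := hd.cK.mul (hd.ℓ.add (Comp.const _ _ 2))

theorem pxm : PB C false fun x => (d x).xm := hd.pK.mul (hd.ℓ'.add (PB.const _ _ 2))

theorem cC : Comp C false fun x => (d x).C := (hd.cN.add (Comp.const _ _ 2)).mul hd.cxm

theorem pC : PB C false fun x => (d x).C := (hd.pN.add (PB.const _ _ 2)).mul hd.pxm

theorem cwt {u v : X → ℕ} (hu : Comp C false u) (hu' : PB C false u) (hv : Comp C false v)
    (hv' : PB C false v) : Comp C false fun x => (d x).wt (u x) (v x) :=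
  Comp.ite_eq hu hv (Comp.const _ _ 0) ((hd.w C _ u v (Ext.refl C) hu hu' hv hv').min
    (hd.ℓ.add (Comp.const _ _ 1)))

theorem pwt (u v : X → ℕ) : PB C false fun x => (d x).wt (u x) (v x) := by
  refine (hd.ℓ'.add (PB.const _ _ 1)).mono fun x _ => ?_
  rw [Inp.wt]
  split_ifs
  · exact Nat.zero_le _
  · exact min_le_right _ _

theorem cB : Comp C false fun x => (d x).B :=
  (hd.n.add (((hd.cN.add (Comp.const _ _ 2)).mul (hd.cN.add (Comp.const _ _ 3))).mul hd.cN)).add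
    (Comp.const _ _ 2)

theorem pB : PB C false fun x => (d x).B :=
  (hd.n'.add (((hd.pN.add (PB.const _ _ 2)).mul (hd.pN.add (PB.const _ _ 3))).mul hd.pN)).add
    (PB.const _ _ 2)

theorem cx (hR : Comp C false fun x => (d x).R) {p q : X → ℕ} (hp : Comp C false p)
    (hp' : PB C false p) (hq : Comp C false q) (hq' : PB C false q) :
    Comp C false fun x => (d x).x (p x) (q x) := by
  refine Comp.ite_eq hp hq (Comp.const _ _ 0) ((hd.cC.add (hd.cK.mul
    (hd.cwt (hd.cH hp hp') (hd.ph _) (hd.cH hq hq') (hd.ph _)))).add (Comp.digit hd.cW hR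
      ((hp.max hq).add (hd.cN.mul (hp.min hq))) ?_))
  refine PB.add ((hp'.add hq').mono fun x _ => ?_) (hd.pN.mul hq'.min_right)
  exact max_le (Nat.le_add_right _ _) (Nat.le_add_left _ _)

theorem px (p q : X → ℕ) : PB C false fun x => (d x).x (p x) (q x) := by
  refine ((hd.pC.add (hd.pK.mul (hd.pwt (fun x => (d x).h (p x)) fun x => (d x).h (q x)))).add
    hd.pW).mono fun x _ => ?_
  rw [Inp.x]
  split_ifs
  · exact Nat.zero_le _
  · exact Nat.add_le_add_left (digit_lt (Inp.W_pos _) _ _).le _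

theorem cside {S v : X → ℕ} (hS : Comp C false S) (hv : Comp C false v) (hv' : PB C false v) :
    Comp C false fun x => (d x).side (S x) (v x) :=
  (hS.div ((Comp.const _ _ 2).pow (hd.ccomp hv hv') (hd.pcomp v))).mod (Comp.const _ _ 2)

theorem cent (hR : Comp C false fun x => (d x).R) {S p q : X → ℕ} (hS : Comp C false S)
    (hp : Comp C false p) (hp' : PB C false p) (hq : Comp C false q) (hq' : PB C false q) :
    Comp C false fun x => (d x).ent (S x) (p x) (q x) :=
  Comp.ite_eq hp hq (Comp.const _ _ 0) (Comp.ite_eq (hd.cside hS (hd.cH hp hp') (hd.ph _))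
    (hd.cside hS (hd.cH hq hq') (hd.ph _))
    (((Comp.const _ _ 2).pow hd.cB hd.pB).pow (hd.cx hR hp hp' hq hq') (hd.px p q))
    (Comp.const _ _ 0))

theorem cHv : Comp C false fun x => (d x).H := by
  refine ((Comp.mul (Comp.pow (Comp.const _ _ 2) (hd.cB.mul (hd.cC.add hd.cxm))
    (hd.pB.mul (hd.pC.add hd.pxm))) (hd.cN.add (Comp.const _ _ 1))).pow
    (hd.cN.add (Comp.const _ _ 2)) (hd.pN.add (PB.const _ _ 2))).add (Comp.const _ _ 1)

theorem cwv (hR : Comp C false fun x => (d x).R) {S r j : X → ℕ} (hS : Comp C false S)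
    (hr : Comp C false r) (hr' : PB C false r) (hj : Comp C false j) (hj' : PB C false j) :
    Comp C false fun x => (d x).wv (S x) (r x) (j x) := by
  refine Comp.vecIter (init := fun x i => (d x).ent (S x) i (r x))
    (step := fun x _ u i => ∑ i' ∈ Finset.range (r x), (d x).ent (S x) i i' * u i')
    (fun x _ => Nat.succ_pos _) hd.cHv hr hr' hj hj' ?_ ?_
  · intro C' hE h1 h2
    exact (hd.lift hE).cent (hR.lift hE) (hS.lift hE) (h1 _) h2 (hr.lift hE) (hr'.lift hE)
  · intro C' hE ht ht' ha hi hi'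
    have hr₁ : Comp C' false fun z => r z.1.1.1 := hr.lift hE
    have hr₂ : PB C' false fun z => r z.1.1.1 := hr'.lift hE
    have hsum := Comp.sum (X := ((X × ℕ) × ℕ) × ℕ) (f := fun z i' =>
      (d z.1.1.1).ent (S z.1.1.1) z.2 i' * digit (d z.1.1.1).H z.1.2 i') hr₁ hr₂ ?_
    · exact hsum
    intro C'' hE' h1 h2
    have hd' : InpOK C'' fun z => d z.1.1.1.1 := hd.lift (hE.trans hE')
    have hR' : Comp C'' false fun z => (d z.1.1.1.1).R := hR.lift (hE.trans hE')
    have hS' : Comp C'' false fun z => S z.1.1.1.1 := hS.lift (hE.trans hE')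
    have hi₁ : Comp C'' false fun z => z.1.2 := (hi _).lift hE'
    have hi₂ : PB C'' false fun z => z.1.2 := hi'.lift hE'
    have ha' : Comp C'' false fun z => z.1.1.2 := (ha _).lift hE'
    exact (hd'.cent hR' hS' hi₁ hi₂ (h1 _) h2).mul (Comp.digit hd'.cHv ha' (h1 _) h2)

theorem cfac (hR : Comp C false fun x => (d x).R) {S r : X → ℕ} (hS : Comp C false S)
    (hr : Comp C false r) (hr' : PB C false r) :
    Comp C false fun x => (d x).fac (S x) (r x) := by
  refine (Comp.const _ _ 1).add (Comp.sum (f := fun x j => ∑ i ∈ Finset.range (r x),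
    (d x).ent (S x) (r x) i * digit (d x).H ((d x).wv (S x) (r x) j) i)
    (hd.cN.add (Comp.const _ _ 1)) (hd.pN.add (PB.const _ _ 1)) ?_)
  intro C' hE h1 h2
  have hsum := Comp.sum (X := X × ℕ) (f := fun z i => (d z.1).ent (S z.1) (r z.1) i *
    digit (d z.1).H ((d z.1).wv (S z.1) (r z.1) z.2) i) (hr.lift hE) (hr'.lift hE) ?_
  · exact hsum
  intro C'' hE' h3 h4
  have hd' : InpOK C'' fun z => d z.1.1 := hd.lift (hE.trans hE')
  have hR' : Comp C'' false fun z => (d z.1.1).R := hR.lift (hE.trans hE')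
  have hS' : Comp C'' false fun z => S z.1.1 := hS.lift (hE.trans hE')
  have hr₁ : Comp C'' false fun z => r z.1.1 := hr.lift (hE.trans hE')
  have hr₂ : PB C'' false fun z => r z.1.1 := hr'.lift (hE.trans hE')
  have hj₁ : Comp C'' false fun z => z.1.2 := (h1 _).lift hE'
  have hj₂ : PB C'' false fun z => z.1.2 := h2.lift hE'
  exact (hd'.cent hR' hS' hr₁ hr₂ (h3 _) h4).mul (Comp.digit hd'.cHv
    (hd'.cwv hR' hS' hr₁ hr₂ hj₁ hj₂) (h3 _) h4)

theorem ctot (hR : Comp C false fun x => (d x).R) (hκ : ∀ x, C.D x → (d x).k ≤ C.κ x) :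
    Comp C true fun x => (d x).tot := by
  have hc : Comp C false fun x => 2 ^ ((d x).k - 1) :=
    (Comp.const _ _ 2).pow (hd.ck.sub (Comp.const _ _ 1)) hd.pk.sub
  have hp : PB C true fun x => 2 ^ ((d x).k - 1) := by
    refine ⟨1, fun x hx => ?_⟩
    rw [Polynomial.eval_one, mul_one]
    exact Nat.pow_le_pow_right (by simp) ((Nat.sub_le _ _).trans (hκ x hx))
  have hS₀ := Comp.var_push (τ := false) (PB.var_lt_size hc.size)
  have hE := Cx.ext_push C fun x S => S < 2 ^ ((d x).k - 1)
  have hd' : InpOK (C.push fun x S => S < 2 ^ ((d x).k - 1)) fun z => d z.1 := hd.lift hE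
  refine Comp.sum_lt (τ₁ := false) (τ₂ := true) (by simp)
    (f := fun x S => ∏ r ∈ Finset.range (d x).N, (d x).fac S r) (hc.weaken _) hp ?_
  have hprod := Comp.prod (X := X × ℕ) (f := fun z r => (d z.1).fac z.2 r) hd'.cN hd'.pN ?_
  · exact hprod
  intro C' hE' h1 h2
  have hd'' : InpOK C' fun z => d z.1.1 := hd'.lift hE'
  have hR' : Comp C' false fun z => (d z.1.1).R := hR.lift (hE.trans hE')
  have hS' : Comp C' false fun z => z.1.2 := hS₀.lift hE'
  exact hd''.cfac hR' hS' (h1 _) h2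

theorem caccept (hR : Comp C false fun x => (d x).R) (hκ : ∀ x, C.D x → (d x).k ≤ C.κ x) :
    Comp C true fun x => (d x).accept := by
  refine Comp.sum (f := fun x t => (d x).tot / (2 ^ (d x).B) ^ ((d x).C * (d x).N + t) % 2)
    ((hd.cK.mul (((Comp.const _ _ 2).mul hd.ℓ).add (Comp.const _ _ 1))).weaken _)
    (hd.pK.mul (((PB.const _ _ 2).mul hd.ℓ').add (PB.const _ _ 1))) ?_
  intro C' hE h1 h2
  have hd' : InpOK C' fun z => d z.1 := hd.lift hE
  have ht : Comp C' true fun z => (d z.1).tot := (hd.ctot hR hκ).lift hE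
  have hp : Comp C' false fun z => (2 ^ (d z.1).B) ^ ((d z.1).C * (d z.1).N + z.2) :=
    ((Comp.const _ _ 2).pow hd'.cB hd'.pB).pow ((hd'.cC.mul hd'.cN).add (h1 _))
      ((hd'.pC.mul hd'.pN).add h2)
  exact (ht.div (hp.weaken true)).mod (Comp.const _ _ 2)

end InpOK

end RAM

/-! ### Division-free determinants in characteristic two -/

namespace RAM

open Polynomial

section Det

variable {R : Type*}

/-- The entry `i` of `A ^ j * c`, where `A` is the leading block of size `r` of the matrix `a` and
`c` is the part of its column `r` above the diagonal. -/
def walkVec [CommSemiring R] (a : ℕ → ℕ → R) (r : ℕ) : ℕ → ℕ → R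
  | 0, i => a i r
  | j + 1, i => ∑ i' ∈ Finset.range r, a i i' * walkVec a r j i'

/-- The factor by which the determinant of `1 + a` grows with row and column `r`. -/
def detFactor [CommSemiring R] (a : ℕ → ℕ → R) (J r : ℕ) : R :=
  1 + ∑ j ∈ Finset.range J, ∑ i ∈ Finset.range r, a r i * walkVec a r j i

theorem map_walkVec [CommSemiring R] {R' : Type*} [CommSemiring R'] (φ : R →+* R')
    (a : ℕ → ℕ → R) (r j i : ℕ) :
    φ (walkVec a r j i) = walkVec (fun p q => φ (a p q)) r j i := by
  induction j generalizing i with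
  | zero => rfl
  | succ j ih => simp [walkVec, map_sum, ih]

theorem map_detFactor [CommSemiring R] {R' : Type*} [CommSemiring R'] (φ : R →+* R')
    (a : ℕ → ℕ → R) (J r : ℕ) :
    φ (detFactor a J r) = detFactor (fun p q => φ (a p q)) J r := by
  simp [detFactor, map_sum, map_walkVec]

theorem walkVec_le {a : ℕ → ℕ → ℕ} {Y N : ℕ} (ha : ∀ p q, a p q ≤ Y) {r : ℕ} (hr : r ≤ N) (j i : ℕ) :
    walkVec a r j i ≤ (Y * (N + 1)) ^ (j + 1) := by
  induction j generalizing i with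
  | zero =>
    rw [zero_add, pow_one]
    exact (ha i r).trans (Nat.le_mul_of_pos_right _ (by omega))
  | succ j ih =>
    calc walkVec a r (j + 1) i
        ≤ ∑ i' ∈ Finset.range r, Y * (Y * (N + 1)) ^ (j + 1) :=
          Finset.sum_le_sum fun i' _ => Nat.mul_le_mul (ha _ _) (ih i')
      _ = r * (Y * (Y * (N + 1)) ^ (j + 1)) := by simp
      _ ≤ (N + 1) * (Y * (Y * (N + 1)) ^ (j + 1)) := Nat.mul_le_mul_right _ (by omega)
      _ = (Y * (N + 1)) ^ (j + 1 + 1) := by ring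

theorem detFactor_le {a : ℕ → ℕ → ℕ} {N : ℕ} (ha : ∀ p q, a p q ≤ 1) {r : ℕ} (hr : r ≤ N) :
    detFactor a (N + 1) r ≤ (N + 2) ^ (N + 3) := by
  have h : ∀ j ∈ Finset.range (N + 1), ∑ i ∈ Finset.range r, a r i * walkVec a r j i ≤
      (N + 1) ^ (N + 2) := by
    intro j hj
    calc ∑ i ∈ Finset.range r, a r i * walkVec a r j i
        ≤ ∑ i ∈ Finset.range r, (N + 1) ^ (N + 1) := by
          refine Finset.sum_le_sum fun i _ => ?_
          refine (Nat.mul_le_mul (ha _ _) (walkVec_le ha hr j i)).trans ?_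
          rw [one_mul, one_mul]
          exact Nat.pow_le_pow_right (by omega) (by have := Finset.mem_range.1 hj; omega)
      _ = r * (N + 1) ^ (N + 1) := by simp
      _ ≤ (N + 1) * (N + 1) ^ (N + 1) := Nat.mul_le_mul_right _ (by omega)
      _ = (N + 1) ^ (N + 2) := by ring
  have h2 := Finset.sum_le_sum h
  rw [Finset.sum_const, Finset.card_range, smul_eq_mul] at h2
  have h3 : (N + 1) * (N + 1) ^ (N + 2) = (N + 1) ^ (N + 3) := by ring
  have h4 : (N + 1) ^ (N + 3) < (N + 2) ^ (N + 3) := Nat.pow_lt_pow_left (by omega) (by omega)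
  rw [detFactor]
  omega

variable [CommRing R]

/-- The leading block of size `r`. -/
def block (a : ℕ → ℕ → R) (r : ℕ) : Matrix (Fin r) (Fin r) R := Matrix.of fun i j => a i j

theorem walkVec_eq (a : ℕ → ℕ → R) (r j : ℕ) (i : Fin r) :
    walkVec a r j i = (block a r ^ j).mulVec (fun i => a i r) i := by
  induction j generalizing i with
  | zero => simp [walkVec]
  | succ j ih =>
    rw [walkVec, pow_succ', ← Matrix.mulVec_mulVec, Matrix.mulVec, dotProduct,
      Finset.sum_range]
    simp only [ih]
    rfl

/-- If all entries are multiples of a nilpotent element, then the blocks are nilpotent. -/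
theorem block_pow_eq_zero {a b : ℕ → ℕ → R} {c : R} {J : ℕ} (hab : ∀ i j, a i j = c * b i j)
    (hc : c ^ J = 0) (r : ℕ) : block a r ^ J = 0 := by
  have : block a r = c • block b r := by
    ext i j
    simp [block, hab]
  rw [this, _root_.smul_pow, hc, zero_smul]

/-- Schur complement: in characteristic two the inverse of `1 + A` for a nilpotent matrix `A`
is a geometric sum. -/
theorem det_block_succ (h2 : (2 : R) = 0) {a : ℕ → ℕ → R} {J r : ℕ} (hJ : block a r ^ J = 0)
    (hr : a r r = 0) :
    (1 + block a (r + 1)).det = (1 + block a r).det * detFactor a J r := by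
  have hneg : ∀ x : R, -x = x := fun x => by
    have : x + x = 0 := by rw [← two_mul, h2, zero_mul]
    exact neg_eq_of_add_eq_zero_left this
  have hA : 1 + block a r = 1 - block a r := by
    rw [sub_eq_add_neg]
    congr 1
    ext i j
    simp [hneg]
  have h1 : (1 + block a r) * ∑ j ∈ Finset.range J, block a r ^ j = 1 := by
    rw [hA, mul_neg_geom_sum, hJ, sub_zero]
  have : Invertible (1 + block a r) := invertibleOfRightInverse _ _ h1
  have hinv : ⅟(1 + block a r) = ∑ j ∈ Finset.range J, block a r ^ j :=
    invOf_eq_right_inv h1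
  -- The last row and column are split off.
  have hblocks : (1 + block a (r + 1)).submatrix finSumFinEquiv finSumFinEquiv =
      Matrix.fromBlocks (1 + block a r) (Matrix.of fun (i : Fin r) (_ : Fin 1) => a i r)
        (Matrix.of fun (_ : Fin 1) (j : Fin r) => a r j) 1 := by
    ext i j
    rcases i with i | i <;> rcases j with j | j
    · simp [block, Matrix.one_apply]
    · have : (Fin.castAdd 1 i : Fin (r + 1)) ≠ Fin.natAdd r j := by
        intro h
        have := congrArg Fin.val h
        simp at this
        omega
      simp [block, this]
    · have : (Fin.natAdd r i : Fin (r + 1)) ≠ Fin.castAdd 1 j := by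
        intro h
        have := congrArg Fin.val h
        simp at this
        omega
      simp [block, this]
    · obtain rfl := Subsingleton.elim i j
      simp [block, hr]
  rw [← Matrix.det_submatrix_equiv_self finSumFinEquiv, hblocks, Matrix.det_fromBlocks₁₁, hinv]
  congr 1
  rw [Matrix.det_unique, detFactor, Matrix.sub_apply, Matrix.one_apply_eq, sub_eq_add_neg, hneg]
  congr 1
  rw [Matrix.mul_sum, Matrix.sum_mul, Matrix.sum_apply]
  refine Finset.sum_congr rfl fun j _ => ?_
  rw [Matrix.mul_assoc, Matrix.mul_apply, Finset.sum_range]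
  refine Finset.sum_congr rfl fun i _ => ?_
  rw [walkVec_eq]
  rfl

/-- The determinant of `1 + a` as a product of Schur complements. -/
theorem det_block (h2 : (2 : R) = 0) {a : ℕ → ℕ → R} {J : ℕ} (hJ : ∀ r, block a r ^ J = 0)
    (hr : ∀ r, a r r = 0) (N : ℕ) :
    (1 + block a N).det = ∏ r ∈ Finset.range N, detFactor a J r := by
  induction N with
  | zero => simp
  | succ N ih => rw [Finset.prod_range_succ, ← ih, det_block_succ h2 (hJ N) (hr N)]

/-- In characteristic two, only the involutions contribute to the determinant of a symmetric
matrix. -/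
theorem det_eq_sum_involutions (h2 : (2 : R) = 0) {n : Type*} [Fintype n] [DecidableEq n]
    (M : Matrix n n R) (hM : ∀ i j, M i j = M j i) :
    M.det = ∑ σ : Equiv.Perm n with σ * σ = 1, ∏ i, M (σ i) i := by
  have hself : ∀ x : R, x + x = 0 := fun x => by rw [← two_mul, h2, zero_mul]
  have hneg : ∀ x : R, -x = x := fun x => neg_eq_of_add_eq_zero_left (hself x)
  have h1 : M.det = ∑ σ : Equiv.Perm n, ∏ i, M (σ i) i := by
    rw [Matrix.det_apply]
    refine Finset.sum_congr rfl fun σ _ => ?_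
    rcases Int.units_eq_one_or (Equiv.Perm.sign σ) with h | h <;> rw [h]
    · simp
    · rw [Units.neg_smul, one_smul, hneg]
  rw [h1, ← Finset.sum_filter_add_sum_filter_not Finset.univ (fun σ : Equiv.Perm n => σ * σ = 1)]
  refine add_eq_left.2 (Finset.sum_involution (fun σ _ => σ⁻¹) ?_ ?_ ?_ ?_)
  -- As `M` is symmetric, `σ` and `σ⁻¹` have equal terms, which cancel in characteristic two.
  · intro σ _
    have : ∏ i, M (σ⁻¹ i) i = ∏ i, M (σ i) i := by
      rw [← Equiv.prod_comp σ]
      refine Finset.prod_congr rfl fun i _ => ?_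
      rw [Equiv.Perm.inv_def, Equiv.symm_apply_apply, hM]
    rw [this, hself]
  · intro σ hσ _ h
    refine (Finset.mem_filter.1 hσ).2 ?_
    nth_rewrite 1 [← h]
    exact inv_mul_cancel σ
  · intro σ hσ
    rw [Finset.mem_filter] at hσ ⊢
    refine ⟨Finset.mem_univ _, fun h => hσ.2 ?_⟩
    rw [← mul_inv_rev, inv_eq_one] at h
    exact h
  · intro σ _
    exact inv_inv σ

end Det

/-! ### Cuts -/

open scoped Classical in
/-- The number of cuts that separate nothing is odd only if there is just the trivial one:
otherwise, a nontrivial one acts by symmetric difference. -/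
theorem sum_cuts {T : Type*} (pairs : T → ℕ × ℕ) (k : ℕ) :
    (∑ S ∈ Finset.range (2 ^ k),
        if ∀ t, S.testBit (pairs t).1 = S.testBit (pairs t).2 then (1 : ZMod 2) else 0) =
      if ∀ S < 2 ^ k, (∀ t, S.testBit (pairs t).1 = S.testBit (pairs t).2) → S = 0 then 1
        else 0 := by
  split_ifs with h
  · rw [Finset.sum_eq_single 0]
    · simp
    · intro S hS h0
      rw [if_neg]
      exact fun h' => h0 (h S (Finset.mem_range.1 hS) h')
    · intro h'
      exact absurd (Finset.mem_range.2 (by positivity)) h'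
  · push Not at h
    obtain ⟨U, hU, hc, h0⟩ := h
    refine Finset.sum_involution (fun S _ => S ^^^ U) ?_ ?_ ?_ ?_
    · intro S _
      have : (∀ t, (S ^^^ U).testBit (pairs t).1 = (S ^^^ U).testBit (pairs t).2) ↔
          ∀ t, S.testBit (pairs t).1 = S.testBit (pairs t).2 := by
        refine forall_congr' fun t => ?_
        rw [Nat.testBit_xor, Nat.testBit_xor, hc t]
        cases S.testBit (pairs t).1 <;> cases S.testBit (pairs t).2 <;>
          cases U.testBit (pairs t).2 <;> simp
      simp only [this]
      exact CharTwo.add_self_eq_zero _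
    · intro S _ _ h
      apply h0
      have := congrArg (S ^^^ ·) h
      simpa [← Nat.xor_assoc] using this
    · intro S hS
      exact Finset.mem_range.2 (Nat.xor_lt_two_pow (Finset.mem_range.1 hS) hU)
    · intro S _
      simp

/-! ### Generating functions of involutions -/

section Gen

variable (x : ℕ → ℕ → ℕ) (side : ℕ → ℕ → ℕ)

/-- The matrix of monomials for the cut `S`. -/
def monoEnt (R : Type*) [CommSemiring R] (S p q : ℕ) : R[X] :=
  if p = q then 0 else if side S p = side S q then X ^ x p q else 0

variable {x side}

/-- The determinant is the generating function of the involutions that do not cross the cut. -/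
theorem det_monoEnt (hsymm : ∀ p q, x p q = x q p) (hdiag : ∀ p, x p p = 0) (N S : ℕ) :
    (1 + block (monoEnt x side (ZMod 2) S) N).det =
      ∑ σ : Equiv.Perm (Fin N) with σ * σ = 1,
        if ∀ i, side S (σ i) = side S i then (X : (ZMod 2)[X]) ^ ∑ i, x (σ i) i else 0 := by
  have h2 : (2 : (ZMod 2)[X]) = 0 := by
    have := CharTwo.two_eq_zero (R := (ZMod 2)[X])
    exact this
  have hent : ∀ i j : Fin N, (1 + block (monoEnt x side (ZMod 2) S) N) i j =
      if side S i = side S j then (X : (ZMod 2)[X]) ^ x i j else 0 := by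
    intro i j
    rw [Matrix.add_apply, block, Matrix.of_apply, monoEnt, Matrix.one_apply]
    by_cases h : i = j
    · subst h
      simp [hdiag]
    · have : (i : ℕ) ≠ j := fun h' => h (Fin.ext h')
      simp [h, this]
  rw [det_eq_sum_involutions h2]
  · refine Finset.sum_congr rfl fun σ _ => ?_
    simp only [hent]
    split_ifs with h
    · rw [← Finset.prod_pow_eq_pow_sum]
      exact Finset.prod_congr rfl fun i _ => if_pos (h i)
    · push Not at h
      obtain ⟨i, hi⟩ := h
      exact Finset.prod_eq_zero (Finset.mem_univ i) (if_neg hi)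
  · intro i j
    rw [hent, hent, hsymm]
    simp only [eq_comm]

/-- Below the degree `T`, the parities of the coefficients of the computed polynomial, summed over
all cuts, count the involutions that no nontrivial cut respects. -/
theorem coeff_sum_detFactor (hsymm : ∀ p q, x p q = x q p) (hdiag : ∀ p, x p p = 0) {N J c T k d : ℕ}
    (hc : ∀ p q, p ≠ q → c ≤ x p q) (hT : T ≤ c * J) (hd : d < T) (lab : ℕ → ℕ)
    (hside : ∀ S p q, side S p = side S q ↔ S.testBit (lab p) = S.testBit (lab q)) :
    (((∑ S ∈ Finset.range (2 ^ k), ∏ r ∈ Finset.range N,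
      detFactor (monoEnt x side ℕ S) J r).coeff d : ℕ) : ZMod 2) =
      ((Finset.univ.filter fun σ : Equiv.Perm (Fin N) => σ * σ = 1 ∧
        (∀ S < 2 ^ k, (∀ i, S.testBit (lab (σ i)) = S.testBit (lab i)) → S = 0) ∧
        ∑ i, x (σ i) i = d).card : ZMod 2) := by
  classical
  have h2 : (2 : (ZMod 2)[X]) = 0 := CharTwo.two_eq_zero (R := (ZMod 2)[X])
  set φ := Polynomial.mapRingHom (Nat.castRingHom (ZMod 2)) with hφ
  have hφent : ∀ S p q, φ (monoEnt x side ℕ S p q) = monoEnt x side (ZMod 2) S p q := by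
    intro S p q
    unfold monoEnt
    split_ifs <;> simp [hφ]
  set I : Ideal (ZMod 2)[X] := Ideal.span {X ^ T} with hI
  set π := Ideal.Quotient.mk I with hπ
  -- Modulo `X ^ T` the matrix is nilpotent, as its entries are multiples of `X ^ c` and `T ≤ c * J`.
  -- So the product of the factors is the determinant there, and lower coefficients agree.
  have key : ∀ S, π (∏ r ∈ Finset.range N, detFactor (monoEnt x side (ZMod 2) S) J r) =
      π (1 + block (monoEnt x side (ZMod 2) S) N).det := by
    intro S
    have hq2 : (2 : (ZMod 2)[X] ⧸ I) = 0 := by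
      have := congrArg π h2
      rwa [map_ofNat, map_zero] at this
    have h0 : ∀ r, block (fun p q => π (monoEnt x side (ZMod 2) S p q)) r ^ J = 0 := by
      refine block_pow_eq_zero (b := fun p q => π (if p = q then 0 else
        if side S p = side S q then X ^ (x p q - c) else 0)) (c := π (X ^ c)) ?_ ?_
      · intro p q
        rw [← map_mul, monoEnt]
        split_ifs with h1 h2
        · simp
        · rw [← pow_add, Nat.add_sub_cancel' (hc p q h1)]
        · simp
      · rw [← map_pow, ← pow_mul, hπ, Ideal.Quotient.eq_zero_iff_mem, hI,
          Ideal.mem_span_singleton]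
        exact pow_dvd_pow _ hT
    rw [map_prod, RingHom.map_det]
    simp only [map_detFactor]
    rw [← det_block hq2 h0 (by intro r; simp [monoEnt])]
    congr 1
    ext i j
    simp [block, Matrix.one_apply, apply_ite π]
  have hsum : (Polynomial.coeff (φ (∑ S ∈ Finset.range (2 ^ k), ∏ r ∈ Finset.range N,
      detFactor (monoEnt x side ℕ S) J r)) d) =
      (∑ S ∈ Finset.range (2 ^ k), (1 + block (monoEnt x side (ZMod 2) S) N).det).coeff d := by
    have h1 : π (φ (∑ S ∈ Finset.range (2 ^ k), ∏ r ∈ Finset.range N,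
        detFactor (monoEnt x side ℕ S) J r)) =
        π (∑ S ∈ Finset.range (2 ^ k), (1 + block (monoEnt x side (ZMod 2) S) N).det) := by
      simp only [map_sum, ← key, map_prod, map_detFactor, hφent]
    rw [hπ, Ideal.Quotient.eq, hI, Ideal.mem_span_singleton, Polynomial.X_pow_dvd_iff] at h1
    have := h1 d hd
    rwa [Polynomial.coeff_sub, sub_eq_zero] at this
  have hcast : (((∑ S ∈ Finset.range (2 ^ k), ∏ r ∈ Finset.range N,
      detFactor (monoEnt x side ℕ S) J r).coeff d : ℕ) : ZMod 2) =
      (φ (∑ S ∈ Finset.range (2 ^ k), ∏ r ∈ Finset.range N,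
        detFactor (monoEnt x side ℕ S) J r)).coeff d := by
    rw [hφ, Polynomial.coe_mapRingHom, Polynomial.coeff_map]
    rfl
  -- The sum over the cuts is evaluated for each involution separately.
  rw [hcast, hsum]
  simp only [det_monoEnt hsymm hdiag]
  rw [Finset.sum_comm, Polynomial.finsetSum_coeff, Finset.natCast_card_filter,
    Finset.sum_filter]
  refine Finset.sum_congr rfl fun σ _ => ?_
  have hcuts := sum_cuts (fun i : Fin N => (lab (σ i), lab i)) k
  simp only [← hside] at hcuts ⊢
  have h3 : (∑ S ∈ Finset.range (2 ^ k),
      if ∀ i : Fin N, side S (σ i) = side S i then (X : (ZMod 2)[X]) ^ ∑ i, x (σ i) i else 0) =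
      Polynomial.C (∑ S ∈ Finset.range (2 ^ k),
        if ∀ i : Fin N, side S (σ i) = side S i then (1 : ZMod 2) else 0) * X ^ ∑ i, x (σ i) i := by
    rw [map_sum, Finset.sum_mul]
    refine Finset.sum_congr rfl fun S _ => ?_
    split_ifs <;> simp
  rw [h3, Polynomial.coeff_C_mul, Polynomial.coeff_X_pow]
  have h4 : (∑ S ∈ Finset.range (2 ^ k),
        if ∀ i : Fin N, side S (σ i) = side S i then (1 : ZMod 2) else 0) =
      if ∀ S < 2 ^ k, (∀ i : Fin N, side S (σ i) = side S i) → S = 0 then 1 else 0 := by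
    convert hcuts
  rw [h4]
  by_cases hσ : σ * σ = 1
  · by_cases hS : ∀ S < 2 ^ k, (∀ i : Fin N, side S (σ i) = side S i) → S = 0
    · by_cases hx : ∑ i, x (σ i) i = d
      · simp [hσ, hx]
      · rw [if_pos hσ, if_pos hS, if_neg (fun h => hx h.symm), if_neg (by tauto), mul_zero]
    · rw [if_neg hS, zero_mul, ite_self, if_neg (by tauto)]
  · rw [if_neg hσ, if_neg (by tauto)]

end Gen

/-- Kronecker substitution: a coefficient is a digit of the value at a large number. -/
theorem eval_div_pow_mod {b : ℕ} (p : ℕ[X]) (h : ∀ i, p.coeff i < b) (d : ℕ) :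
    p.eval b / b ^ d % b = p.coeff d := by
  induction d generalizing p with
  | zero =>
    nth_rewrite 1 [← Polynomial.divX_mul_X_add p]
    rw [pow_zero, Nat.div_one, Polynomial.eval_add, Polynomial.eval_mul, Polynomial.eval_X,
      Polynomial.eval_C, mul_comm, Nat.mul_add_mod, Nat.mod_eq_of_lt (h 0)]
  | succ d ih =>
    have h1 : p.eval b / b = p.divX.eval b := by
      nth_rewrite 1 [← Polynomial.divX_mul_X_add p]
      have hb : 0 < b := (Nat.zero_le _).trans_lt (h 0)
      rw [Polynomial.eval_add, Polynomial.eval_mul, Polynomial.eval_X, Polynomial.eval_C,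
        mul_comm, Nat.mul_add_div hb, Nat.div_eq_of_lt (h 0), add_zero]
    rw [pow_succ', ← Nat.div_div_eq_div_mul, h1, ih _ fun i => ?_, Polynomial.coeff_divX]
    rw [Polynomial.coeff_divX]
    exact h _

theorem coeff_le_eval_one (p : ℕ[X]) (i : ℕ) : p.coeff i ≤ p.eval 1 := by
  rw [Polynomial.eval_eq_sum, Polynomial.sum]
  by_cases h : i ∈ p.support
  · simpa using Finset.single_le_sum (f := fun i => p.coeff i) (fun _ _ => Nat.zero_le _) h
  · rw [Polynomial.notMem_support_iff.1 h]
    exact Nat.zero_le _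

end RAM

/-! ### Isolation -/

namespace RAM

open Polynomial

/-- The isolation lemma: with random weights `ρ e < W` of the elements `e`, the probability that a
family of sets has two members of minimal weight is at most `|E| / W`. If there are two such
members, some `e` belongs to one of them only, and then the weights of the other elements
determine `ρ e`. -/
theorem isolation {ι E : Type*} [Fintype E] [DecidableEq E] (W : ℕ) (F : Finset ι)
    (hF : F.Nonempty) (base : ι → ℕ) (inc : ι → Finset E) (hinj : Set.InjOn inc F)
    (bad : Finset (E → Fin W))
    (hbad : ∀ ρ ∈ bad, ¬ ∃ σ ∈ F, ∀ τ ∈ F, τ ≠ σ →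
      base σ + 2 * ∑ e ∈ inc σ, (ρ e : ℕ) < base τ + 2 * ∑ e ∈ inc τ, (ρ e : ℕ)) :
    W * bad.card ≤ Fintype.card E * W ^ Fintype.card E := by
  classical
  set y : (E → Fin W) → ι → ℕ := fun ρ σ => base σ + 2 * ∑ e ∈ inc σ, (ρ e : ℕ) with hy
  set badE : E → Finset (E → Fin W) := fun e => Finset.univ.filter fun ρ =>
    ∃ σ ∈ F, ∃ τ ∈ F, (∀ υ ∈ F, y ρ σ ≤ y ρ υ) ∧ (∀ υ ∈ F, y ρ τ ≤ y ρ υ) ∧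
      e ∈ inc σ ∧ e ∉ inc τ with hbadE
  have hsub : bad ⊆ Finset.univ.biUnion badE := by
    intro ρ hρ
    obtain ⟨σ, hσ, hmin⟩ := Finset.exists_min_image F (y ρ) hF
    have := hbad ρ hρ
    push Not at this
    obtain ⟨τ, hτ, hne, hle⟩ := this σ hσ
    have hmin' : ∀ υ ∈ F, y ρ τ ≤ y ρ υ := fun υ hυ => hle.trans (hmin υ hυ)
    have hinc : inc τ ≠ inc σ := fun h => hne (hinj hτ hσ h)
    rw [Finset.mem_biUnion]
    by_cases h : ∃ e ∈ inc σ, e ∉ inc τ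
    · obtain ⟨e, h1, h2⟩ := h
      exact ⟨e, Finset.mem_univ _, Finset.mem_filter.2 ⟨Finset.mem_univ _, σ, hσ, τ, hτ, hmin, hmin', h1, h2⟩⟩
    · push Not at h
      obtain ⟨e, h1, h2⟩ : ∃ e ∈ inc τ, e ∉ inc σ := by
        by_contra h'
        push Not at h'
        exact hinc (Finset.Subset.antisymm h' h)
      exact ⟨e, Finset.mem_univ _, Finset.mem_filter.2 ⟨Finset.mem_univ _, τ, hτ, σ, hσ, hmin', hmin, h1, h2⟩⟩
  -- On `badE e` the value `ρ e` is redundant: overwriting it is injective on `badE e × Fin W`.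
  have hE : ∀ e, W * (badE e).card ≤ W ^ Fintype.card E := by
    intro e
    have h1 : Fintype.card (E → Fin W) = W ^ Fintype.card E := by simp
    have h2 : (badE e ×ˢ (Finset.univ : Finset (Fin W))).card = W * (badE e).card := by
      rw [Finset.card_product, Finset.card_univ, Fintype.card_fin, mul_comm]
    rw [← h1, ← Finset.card_univ, ← h2]
    refine Finset.card_le_card_of_injOn (fun z => Function.update z.1 e z.2)
      (fun _ _ => Finset.mem_coe.2 (Finset.mem_univ _)) ?_
    rintro ⟨ρ, v⟩ hρ ⟨ρ', v'⟩ hρ' heq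
    simp only [Finset.coe_product, Set.mem_prod, Finset.mem_coe, hbadE, Finset.mem_filter] at hρ hρ'
    obtain ⟨⟨-, σ, hσ, τ, hτ, hm, hn, i1, i2⟩, -⟩ := hρ
    obtain ⟨⟨-, σ', hσ', τ', hτ', hm', hn', i1', i2'⟩, -⟩ := hρ'
    simp only at heq
    have hv : v = v' := by simpa using congrFun heq e
    have hoff : ∀ e', e' ≠ e → ρ e' = ρ' e' := by
      intro e' he
      have := congrFun heq e'
      rwa [Function.update_of_ne he, Function.update_of_ne he] at this
    have hout : ∀ (s : Finset E), e ∉ s → ∑ e ∈ s, (ρ e : ℕ) = ∑ e ∈ s, (ρ' e : ℕ) := by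
      intro s hs
      refine Finset.sum_congr rfl fun e' he' => ?_
      rw [hoff e' (fun h => hs (h ▸ he'))]
    have hy1 : ∀ υ, e ∉ inc υ → y ρ υ = y ρ' υ := fun υ h => by simp only [hy, hout _ h]
    have hy2 : ∀ υ, e ∈ inc υ → y ρ υ + 2 * ρ' e = y ρ' υ + 2 * ρ e := by
      intro υ h
      have h3 := hout _ (Finset.notMem_erase e (inc υ))
      simp only [hy]
      rw [← Finset.add_sum_erase _ _ h, ← Finset.add_sum_erase _ (fun e => (ρ' e : ℕ)) h, h3]
      ring
    -- By minimality, `ρ e` is the difference of the weights of `τ` and `σ` without the term of `e`.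
    have a1 := hm τ hτ
    have a2 := hn σ hσ
    have a3 := hm' τ' hτ'
    have a4 := hn' σ' hσ'
    have a5 := hm σ' hσ'
    have a6 := hm' σ hσ
    have a7 := hn τ' hτ'
    have a8 := hn' τ hτ
    have b1 := hy1 τ i2
    have b2 := hy1 τ' i2'
    have b3 := hy2 σ i1
    have b4 := hy2 σ' i1'
    have : (ρ e : ℕ) = ρ' e := by omega
    have hρe : ρ = ρ' := by
      funext e'
      by_cases h : e' = e
      · rw [h]
        exact Fin.ext this
      · exact hoff e' h
    rw [hρe, hv]
  calc W * bad.card ≤ W * ∑ e, (badE e).card :=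
        Nat.mul_le_mul_left _ ((Finset.card_le_card hsub).trans Finset.card_biUnion_le)
    _ = ∑ e, W * (badE e).card := by rw [Finset.mul_sum]
    _ ≤ ∑ _e : E, W ^ Fintype.card E := Finset.sum_le_sum fun e _ => hE e
    _ = _ := by simp

/-- A sum over an involution without fixed points, arranged by its orbits. -/
theorem sum_involution_eq {N : ℕ} {M : Type*} [AddCommMonoid M] {σ : Fin N → Fin N}
    (h1 : ∀ i, σ (σ i) = i) (h2 : ∀ i, σ i ≠ i) (g : Fin N → M) :
    ∑ i, g i = ∑ i with i < σ i, (g i + g (σ i)) := by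
  rw [← Finset.sum_filter_add_sum_filter_not Finset.univ (fun i => i < σ i),
    Finset.sum_add_distrib]
  congr 1
  refine Finset.sum_nbij' σ σ ?_ ?_ ?_ ?_ ?_
  · intro i hi
    have := h2 i
    simp only [Finset.mem_filter, Finset.mem_univ, true_and, not_lt, h1] at hi ⊢
    exact lt_of_le_of_ne hi this
  · intro i hi
    simp only [Finset.mem_filter, Finset.mem_univ, true_and, not_lt, h1] at hi ⊢
    exact hi.le
  · exact fun i _ => h1 i
  · exact fun i _ => h1 i
  · exact fun i _ => by rw [h1]

/-! ### Correctness of the algorithm in terms of involutions -/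

namespace Inp

variable (I : Inp)

/-- A perfect matching of the copies, given as an involution, such that no nontrivial cut of the
set of components is respected. -/
structure Linking (σ : Equiv.Perm (Fin I.N)) : Prop where
  invol : σ * σ = 1
  ne : ∀ i, σ i ≠ i
  conn : ∀ S < 2 ^ (I.k - 1),
    (∀ i, S.testBit (I.comp (I.h (σ i))) = S.testBit (I.comp (I.h i))) → S = 0

/-- The weight of an involution of the copies; each matched pair counts twice. -/
def cost (σ : Equiv.Perm (Fin I.N)) : ℕ := ∑ i, I.wt (I.h (σ i)) (I.h i)

/-- The algorithm in terms of polynomials. -/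
def poly : ℕ[X] :=
  ∑ S ∈ Finset.range (2 ^ (I.k - 1)), ∏ r ∈ Finset.range I.N,
    detFactor (monoEnt I.x (fun S p => I.side S (I.h p)) ℕ S) (I.N + 1) r

theorem wt_le (u v : ℕ) : I.wt u v ≤ I.ℓ + 1 := by
  rw [wt]
  split_ifs
  · exact Nat.zero_le _
  · exact min_le_right _ _

theorem x_le (hN : 0 < I.N) (p q : ℕ) : I.x p q ≤ I.C + I.xm := by
  rw [x]
  split_ifs
  · exact Nat.zero_le _
  · have h1 := Nat.mul_le_mul_left I.K (I.wt_le (I.h p) (I.h q))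
    have h2 : digit I.W I.R (max p q + I.N * min p q) ≤ I.W := (digit_lt I.W_pos _ _).le
    have h3 : I.W ≤ I.K := by
      rw [K]
      nlinarith
    have h4 : I.xm = I.K * (I.ℓ + 1) + I.K := by
      rw [xm]
      ring
    omega

/-- No entry of the packed vectors overflows, so they hold the vectors `walkVec`. -/
theorem fac_eq (S : ℕ) {r : ℕ} (hr : r < I.N) : I.fac S r = detFactor (I.ent S) (I.N + 1) r := by
  have hN : 0 < I.N := by omega
  have hent : ∀ p q, I.ent S p q ≤ 2 ^ (I.B * (I.C + I.xm)) := by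
    intro p q
    rw [ent]
    split_ifs
    · exact Nat.zero_le _
    · rw [← pow_mul]
      exact Nat.pow_le_pow_right (by simp) (Nat.mul_le_mul_left _ (I.x_le hN p q))
    · exact Nat.zero_le _
  have hH : 0 < I.H := Nat.succ_pos _
  rw [fac, detFactor]
  congr 1
  refine Finset.sum_congr rfl fun j hj => Finset.sum_congr rfl fun i hi => ?_
  congr 1
  refine digit_vecIter hH (fun j i => walkVec (I.ent S) r j i) (T := I.N) (fun _ _ => rfl) ?_ ?_ j
    (Nat.lt_succ_iff.1 (Finset.mem_range.1 hj)) i (Finset.mem_range.1 hi)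
  · intro t _ v hv i _
    exact Finset.sum_congr rfl fun i' hi' => by rw [hv i' (Finset.mem_range.1 hi')]
  · intro t ht i _
    refine (walkVec_le hent hr.le t i).trans_lt (Nat.lt_succ_of_le ?_)
    exact Nat.pow_le_pow_right (by positivity) (by omega)

theorem tot_eq : I.tot = I.poly.eval (2 ^ I.B) := by
  rw [tot, poly, ← Polynomial.coe_evalRingHom, map_sum]
  refine Finset.sum_congr rfl fun S _ => ?_
  rw [map_prod]
  refine Finset.prod_congr rfl fun r hr => ?_
  rw [map_detFactor, I.fac_eq S (Finset.mem_range.1 hr)]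
  congr 1
  funext p q
  rw [monoEnt, ent]
  split_ifs <;> simp

/-- The coefficients are small enough to be read off from the value at `2 ^ B`. -/
theorem coeff_lt (i : ℕ) : I.poly.coeff i < 2 ^ I.B := by
  refine (coeff_le_eval_one _ i).trans_lt ?_
  rw [poly, ← Polynomial.coe_evalRingHom, map_sum]
  have h1 : ∀ S ∈ Finset.range (2 ^ (I.k - 1)), Polynomial.evalRingHom 1 (∏ r ∈ Finset.range I.N,
      detFactor (monoEnt I.x (fun S p => I.side S (I.h p)) ℕ S) (I.N + 1) r) ≤
      2 ^ ((I.N + 2) * (I.N + 3) * I.N) := by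
    intro S _
    rw [map_prod]
    calc _ ≤ ∏ r ∈ Finset.range I.N, (I.N + 2) ^ (I.N + 3) := by
          refine Finset.prod_le_prod' fun r hr => ?_
          rw [map_detFactor]
          refine detFactor_le (fun p q => ?_) (Finset.mem_range.1 hr).le
          rw [monoEnt]
          split_ifs <;> simp
      _ = (I.N + 2) ^ ((I.N + 3) * I.N) := by simp [← pow_mul]
      _ ≤ (2 ^ (I.N + 2)) ^ ((I.N + 3) * I.N) := Nat.pow_le_pow_left Nat.lt_two_pow_self.le _
      _ = _ := by rw [← pow_mul, mul_assoc]
  refine (Finset.sum_le_sum h1).trans_lt ?_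
  rw [Finset.sum_const, Finset.card_range, smul_eq_mul, ← pow_add, B]
  have := I.k_le
  exact Nat.pow_lt_pow_right (by simp) (by omega)

variable {I} (hw : ∀ u v, I.w u v = I.w v u)
include hw

theorem x_symm (p q : ℕ) : I.x p q = I.x q p := by
  have h : ∀ u v, I.wt u v = I.wt v u := by
    intro u v
    rw [wt, wt, hw]
    simp only [eq_comm]
  rw [x, x, max_comm, min_comm, h]
  simp only [eq_comm]

/-- The algorithm accepts if and only if for some degree in the relevant range the number of
involutions of this degree that cross all nontrivial cuts is odd. -/
theorem accept_iff : I.accept ≠ 0 ↔ ∃ d < I.K * (2 * I.ℓ + 1),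
    (((Finset.univ.filter fun σ : Equiv.Perm (Fin I.N) => σ * σ = 1 ∧
        (∀ S < 2 ^ (I.k - 1), (∀ i, S.testBit (I.comp (I.h (σ i))) =
          S.testBit (I.comp (I.h i))) → S = 0) ∧
        ∑ i, I.x (σ i) i = I.C * I.N + d).card : ZMod 2) ≠ 0) := by
  have hcoeff : ∀ d < I.K * (2 * I.ℓ + 1),
      (I.tot / (2 ^ I.B) ^ (I.C * I.N + d) % 2 ≠ 0 ↔
      (((Finset.univ.filter fun σ : Equiv.Perm (Fin I.N) => σ * σ = 1 ∧
        (∀ S < 2 ^ (I.k - 1), (∀ i, S.testBit (I.comp (I.h (σ i))) =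
          S.testBit (I.comp (I.h i))) → S = 0) ∧
        ∑ i, I.x (σ i) i = I.C * I.N + d).card : ZMod 2) ≠ 0)) := by
    intro d hd
    have hC : I.K * (2 * I.ℓ + 1) ≤ I.C := by
      rw [C, xm]
      nlinarith [Nat.zero_le (I.N * (I.K * (I.ℓ + 2)))]
    have h1 := coeff_sum_detFactor (x := I.x) (side := fun S p => I.side S (I.h p)) (x_symm hw)
      (fun p => by simp [x]) (N := I.N) (J := I.N + 1) (c := I.C) (T := I.C * (I.N + 1))
      (k := I.k - 1) (d := I.C * I.N + d)
      (fun p q hpq => by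
        rw [x, if_neg hpq]
        omega) le_rfl (by rw [mul_add, mul_one]; omega) (fun p => I.comp (I.h p))
      (fun S p q => by
        rw [side, side, Nat.testBit_eq_decide_div_mod_eq, Nat.testBit_eq_decide_div_mod_eq]
        simp only [decide_eq_decide]
        omega)
    rw [← h1]
    change _ ↔ ((I.poly.coeff (I.C * I.N + d) : ℕ) : ZMod 2) ≠ 0
    have h2 := eval_div_pow_mod I.poly I.coeff_lt (I.C * I.N + d)
    have h3 : 2 ∣ 2 ^ I.B := dvd_pow_self 2 (by rw [B]; omega)
    rw [I.tot_eq, ← Nat.mod_mod_of_dvd _ h3, h2, Ne, Ne, ZMod.natCast_eq_zero_iff,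
      Nat.dvd_iff_mod_eq_zero]
  rw [accept, Ne, Finset.sum_eq_zero_iff]
  push Not
  constructor
  · rintro ⟨d, hd, h⟩
    rw [Finset.mem_range] at hd
    exact ⟨d, hd, (hcoeff d hd).1 h⟩
  · rintro ⟨d, hd, h⟩
    exact ⟨d, Finset.mem_range.2 hd, (hcoeff d hd).2 h⟩

omit hw in
/-- The random perturbation of the weight of `σ`. -/
theorem sum_x_eq {σ : Equiv.Perm (Fin I.N)} (hne : ∀ i, σ i ≠ i) :
    ∑ i, I.x (σ i) i = I.C * I.N + (I.K * I.cost σ + ∑ i : Fin I.N,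
      digit I.W I.R (max (σ i : ℕ) i + I.N * min (σ i : ℕ) i)) := by
  have : ∀ i : Fin I.N, I.x (σ i) i = I.C + (I.K * I.wt (I.h (σ i)) (I.h i) +
      digit I.W I.R (max (σ i : ℕ) i + I.N * min (σ i : ℕ) i)) := by
    intro i
    rw [x, if_neg (fun h => hne i (Fin.ext h)), add_assoc]
  simp only [this]
  rw [Finset.sum_add_distrib, Finset.sum_add_distrib, ← Finset.mul_sum, Finset.sum_const,
    Finset.card_univ, Fintype.card_fin, smul_eq_mul, mul_comm I.N, cost]

omit hw in
/-- An involution with a fixed point has small degree. -/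
theorem ne_of_le_sum_x {σ : Equiv.Perm (Fin I.N)} (h : I.C * I.N ≤ ∑ i, I.x (σ i) i) (i : Fin I.N) :
    σ i ≠ i := by
  intro hi
  have hN : 0 < I.N := i.pos
  rw [← Finset.add_sum_erase _ _ (Finset.mem_univ i), hi] at h
  have h1 : I.x i i = 0 := by simp [x]
  have h2 : ∑ j ∈ Finset.univ.erase i, I.x (σ j) j ≤ (I.N - 1) * (I.C + I.xm) := by
    refine (Finset.sum_le_sum fun j _ => I.x_le hN _ _).trans ?_
    rw [Finset.sum_const, Finset.card_erase_of_mem (Finset.mem_univ i), Finset.card_univ,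
      Fintype.card_fin, smul_eq_mul]
  obtain ⟨c, hc⟩ : ∃ c, I.N = c + 1 := ⟨I.N - 1, by omega⟩
  have h3 : I.C = (I.N + 2) * I.xm := rfl
  have h4 : 0 < I.xm := by
    rw [xm, K]
    positivity
  rw [h1, zero_add] at h
  have h5 := h.trans h2
  rw [hc] at h5 h3
  simp only [Nat.add_sub_cancel] at h5
  nlinarith

/-- The algorithm accepts only if there is a cheap linking, whatever the random number is. -/
theorem exists_linking (h : I.accept ≠ 0) : ∃ σ, I.Linking σ ∧ I.cost σ ≤ 2 * I.ℓ := by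
  obtain ⟨d, hd, hcard⟩ := (accept_iff hw).1 h
  have : (Finset.univ.filter fun σ : Equiv.Perm (Fin I.N) => σ * σ = 1 ∧
        (∀ S < 2 ^ (I.k - 1), (∀ i, S.testBit (I.comp (I.h (σ i))) =
          S.testBit (I.comp (I.h i))) → S = 0) ∧
        ∑ i, I.x (σ i) i = I.C * I.N + d).Nonempty := by
    rw [Finset.nonempty_iff_ne_empty]
    intro h
    rw [h] at hcard
    simp at hcard
  obtain ⟨σ, hσ⟩ := this
  obtain ⟨-, h1, h2, h3⟩ := Finset.mem_filter.1 hσ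
  have hne := ne_of_le_sum_x (σ := σ) (by omega)
  refine ⟨σ, ⟨h1, hne, h2⟩, ?_⟩
  rw [sum_x_eq hne] at h3
  have : I.K * I.cost σ < I.K * (2 * I.ℓ + 1) := by omega
  exact Nat.lt_succ_iff.1 (Nat.lt_of_mul_lt_mul_left this)

end Inp

/-- The digits of a random number are independent random numbers. -/
def digitsEquiv (W N : ℕ) : Fin (W ^ (N * N)) ≃ (Fin N × Fin N → Fin W) :=
  finFunctionFinEquiv.symm.trans (Equiv.arrowCongr finProdFinEquiv.symm (Equiv.refl _))

theorem digitsEquiv_apply (W N : ℕ) (R : Fin (W ^ (N * N))) (i j : Fin N) :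
    (digitsEquiv W N R (i, j) : ℕ) = digit W R (j + N * i) := by
  simp [digitsEquiv, digit, finFunctionFinEquiv]

/-- If there is a cheap linking, then at most one third of the random numbers is rejected. -/
theorem Inp.card_reject (I : Inp) (hw : ∀ u v, I.w u v = I.w v u)
    {σ₀ : Equiv.Perm (Fin I.N)} (hσ₀ : I.Linking σ₀) (hcost : I.cost σ₀ ≤ 2 * I.ℓ) :
    3 * ((Finset.range (I.W ^ (I.N * I.N))).filter fun R => ({I with R := R} : Inp).accept = 0).card ≤
      I.W ^ (I.N * I.N) := by
  classical
  set F : Finset (Equiv.Perm (Fin I.N)) := Finset.univ.filter fun σ => I.Linking σ with hF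
  set inc : Equiv.Perm (Fin I.N) → Finset (Fin I.N × Fin I.N) := fun σ =>
    (Finset.univ.filter fun i => i < σ i).image fun i => (i, σ i) with hinc
  have hσσ : ∀ σ ∈ F, ∀ i, σ (σ i) = i := by
    intro σ hσ i
    have := (Finset.mem_filter.1 hσ).2.invol
    exact congrArg (fun τ : Equiv.Perm (Fin I.N) => τ i) this
  have hne : ∀ σ ∈ F, ∀ i, σ i ≠ i := fun σ hσ => (Finset.mem_filter.1 hσ).2.ne
  have hmem : ∀ σ i j, (i, j) ∈ inc σ ↔ i < j ∧ σ i = j := by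
    intro σ i j
    simp only [hinc, Finset.mem_image, Finset.mem_filter, Finset.mem_univ, true_and,
      Prod.mk.injEq]
    constructor
    · rintro ⟨i, h, rfl, rfl⟩
      exact ⟨h, rfl⟩
    · rintro ⟨h, rfl⟩
      exact ⟨i, h, rfl, rfl⟩
  have hinj : Set.InjOn inc F := by
    intro σ hσ τ hτ h
    ext i
    rcases lt_or_gt_of_ne (hne σ hσ i) with h1 | h1
    · have h2 : (σ i, i) ∈ inc τ := h ▸ (hmem σ _ _).2 ⟨h1, hσσ σ hσ i⟩
      have h3 := ((hmem τ _ _).1 h2).2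
      rw [← hσσ τ hτ (σ i), h3]
    · have h2 : (i, σ i) ∈ inc τ := h ▸ (hmem σ _ _).2 ⟨h1, rfl⟩
      rw [((hmem τ _ _).1 h2).2]
  -- The two ends of a pair have the same digit, so that the perturbation of each pair counts twice.
  have hy : ∀ σ ∈ F, ∀ R : Fin (I.W ^ (I.N * I.N)), ∑ i : Fin I.N,
      digit I.W R (max (σ i : ℕ) i + I.N * min (σ i : ℕ) i) =
      2 * ∑ e ∈ inc σ, (digitsEquiv I.W I.N R e : ℕ) := by
    intro σ hσ R
    rw [sum_involution_eq (hσσ σ hσ) (hne σ hσ), hinc, Finset.mul_sum,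
      Finset.sum_image (fun i _ j _ h => (Prod.ext_iff.1 h).1)]
    refine Finset.sum_congr rfl fun i hi => ?_
    have hi' : (i : ℕ) < σ i := (Finset.mem_filter.1 hi).2
    rw [digitsEquiv_apply, hσσ σ hσ, max_eq_left hi'.le, min_eq_right hi'.le, max_eq_right hi'.le,
      min_eq_left hi'.le, two_mul]
  set bad : Finset (Fin I.N × Fin I.N → Fin I.W) :=
    (Finset.univ.filter fun R : Fin (I.W ^ (I.N * I.N)) =>
      ({I with R := (R : ℕ)} : Inp).accept = 0).map (digitsEquiv I.W I.N).toEmbedding with hbad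
  have hcard : bad.card = ((Finset.range (I.W ^ (I.N * I.N))).filter
      fun R => ({I with R := R} : Inp).accept = 0).card := by
    rw [hbad, Finset.card_map, ← Finset.card_map (Fin.valEmbedding)]
    congr 1
    ext R
    simp only [Finset.mem_map, Finset.mem_filter, Finset.mem_univ, true_and, Fin.valEmbedding_apply,
      Finset.mem_range]
    constructor
    · rintro ⟨R, h, rfl⟩
      exact ⟨R.2, h⟩
    · rintro ⟨h1, h2⟩
      exact ⟨⟨R, h1⟩, h2, rfl⟩
  have hiso := isolation I.W F ⟨σ₀, Finset.mem_filter.2 ⟨Finset.mem_univ _, hσ₀⟩⟩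
    (fun σ => I.K * I.cost σ) inc hinj bad ?_
  · rw [hcard, Fintype.card_prod, Fintype.card_fin] at hiso
    have hW : 3 * (I.N * I.N) ≤ I.W := by
      rw [W, ← sq]
      exact (Nat.lt_size_self _).le
    have h1 : I.W * (3 * ((Finset.range (I.W ^ (I.N * I.N))).filter
        fun R => ({I with R := R} : Inp).accept = 0).card) ≤ I.W * I.W ^ (I.N * I.N) := by
      calc _ = 3 * (I.W * ((Finset.range (I.W ^ (I.N * I.N))).filter
            fun R => ({I with R := R} : Inp).accept = 0).card) := by ring
        _ ≤ 3 * (I.N * I.N * I.W ^ (I.N * I.N)) := Nat.mul_le_mul_left _ hiso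
        _ = 3 * (I.N * I.N) * I.W ^ (I.N * I.N) := by ring
        _ ≤ _ := Nat.mul_le_mul_right _ hW
    exact Nat.le_of_mul_le_mul_left h1 I.W_pos
  · rintro ρ hρ ⟨σ, hσ, huniq⟩
    obtain ⟨R, hR, rfl⟩ := Finset.mem_map.1 hρ
    refine absurd (Finset.mem_filter.1 hR).2 ?_
    have huniq' : ∀ τ ∈ F, τ ≠ σ →
        I.K * I.cost σ + ∑ i : Fin I.N, digit I.W R (max (σ i : ℕ) i + I.N * min (σ i : ℕ) i) <
        I.K * I.cost τ + ∑ i : Fin I.N, digit I.W R (max (τ i : ℕ) i + I.N * min (τ i : ℕ) i) := by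
      intro τ hτ h
      rw [hy σ hσ, hy τ hτ]
      exact huniq τ hτ h
    rw [← Ne, accept_iff (I := {I with R := (R : ℕ)}) hw]
    -- The coefficient at the degree of the unique cheapest linking `σ` is odd.
    refine ⟨I.K * I.cost σ + ∑ i : Fin I.N,
      digit I.W R (max (σ i : ℕ) i + I.N * min (σ i : ℕ) i), ?_, ?_⟩
    -- This degree is in the range that is inspected, as `σ` is not heavier than `σ₀`.
    · have hle : I.K * I.cost σ + ∑ i : Fin I.N,
          digit I.W R (max (σ i : ℕ) i + I.N * min (σ i : ℕ) i) ≤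
          I.K * I.cost σ₀ + ∑ i : Fin I.N,
          digit I.W R (max (σ₀ i : ℕ) i + I.N * min (σ₀ i : ℕ) i) := by
        by_cases h : σ₀ = σ
        · rw [h]
        · exact (huniq' σ₀ (Finset.mem_filter.2 ⟨Finset.mem_univ _, hσ₀⟩) h).le
      have h1 : ∑ i : Fin I.N, digit I.W R (max (σ₀ i : ℕ) i + I.N * min (σ₀ i : ℕ) i) ≤
          I.N * I.W := by
        refine (Finset.sum_le_sum fun i _ => (digit_lt I.W_pos _ _).le).trans ?_
        simp
      have h2 := Nat.mul_le_mul_left I.K hcost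
      have h3 : I.K = I.N * I.W + 1 := rfl
      change _ < I.K * (2 * I.ℓ + 1)
      rw [mul_add, mul_one]
      omega
    -- No other involution that crosses all cuts has this degree.
    · have : (Finset.univ.filter fun τ : Equiv.Perm (Fin I.N) => τ * τ = 1 ∧
          (∀ S < 2 ^ (I.k - 1), (∀ i, S.testBit (I.comp (I.h (τ i))) =
            S.testBit (I.comp (I.h i))) → S = 0) ∧
          ∑ i, ({I with R := (R : ℕ)} : Inp).x (τ i) i = I.C * I.N + (I.K * I.cost σ + ∑ i : Fin I.N,
            digit I.W R (max (σ i : ℕ) i + I.N * min (σ i : ℕ) i))) = {σ} := by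
        ext τ
        rw [Finset.mem_filter, Finset.mem_singleton]
        constructor
        · rintro ⟨-, h1, h2, h3⟩
          by_contra hτσ
          have hτne : ∀ i, τ i ≠ i :=
            ne_of_le_sum_x (I := {I with R := (R : ℕ)}) (σ := τ) ((Nat.le_add_right _ _).trans h3.ge)
          have := huniq' τ (Finset.mem_filter.2 ⟨Finset.mem_univ _, h1, hτne, h2⟩) hτσ
          have h4 := sum_x_eq (I := {I with R := (R : ℕ)}) hτne
          exact this.ne' (Nat.add_left_cancel (h4.symm.trans h3))
        · rintro rfl
          have hL := (Finset.mem_filter.1 hσ).2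
          exact ⟨Finset.mem_univ _, hL.invol, hL.conn,
            sum_x_eq (I := {I with R := (R : ℕ)}) hL.ne⟩
      have h1 := congrArg (fun s : Finset (Equiv.Perm (Fin I.N)) => ((s.card : ℕ) : ZMod 2)) this
      refine ne_of_eq_of_ne h1 ?_
      simp

end RAM

/-! ### Euler's theorem for multigraphs -/

open scoped Classical in
/-- How often a vertex is an end of an edge; this is `2` for a loop. -/
def endCount {V : Type} (x : V) : Sym2 V → ℕ :=
  Sym2.lift ⟨fun a b => (if a = x then 1 else 0) + (if b = x then 1 else 0), fun _ _ => add_comm _ _⟩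

/-- The degree of a vertex in a multigraph. -/
def deg {V : Type} (M : Multiset (Sym2 V)) (x : V) : ℕ := (M.map (endCount x)).sum

/-- All edges of the multigraph belong to one component: every union of components contains all
edges or none. -/
def EdgeConn {V : Type} (M : Multiset (Sym2 V)) : Prop :=
  ∀ U : V → Prop, (∀ a b, s(a, b) ∈ M → (U a ↔ U b)) →
    (∀ a b, s(a, b) ∈ M → U a) ∨ (∀ a b, s(a, b) ∈ M → ¬ U a)

section Euler

variable {V E : Type}

open scoped Classical in
theorem endCount_mk (x a b : V) :
    endCount x s(a, b) = (if a = x then 1 else 0) + (if b = x then 1 else 0) := rfl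

theorem deg_add (M M' : Multiset (Sym2 V)) (x : V) : deg (M + M') x = deg M x + deg M' x := by
  simp [deg]

theorem deg_cons (e : Sym2 V) (M : Multiset (Sym2 V)) (x : V) :
    deg (e ::ₘ M) x = endCount x e + deg M x := by
  simp [deg]

@[simp] theorem deg_zero (x : V) : deg (0 : Multiset (Sym2 V)) x = 0 := rfl

theorem mem_of_endCount_ne_zero {x : V} {e : Sym2 V} (h : endCount x e ≠ 0) : x ∈ e := by
  induction e with
  | h a b =>
    rw [endCount_mk] at h
    rw [Sym2.mem_iff]
    by_contra! h'
    simp [h'.1.symm, h'.2.symm] at h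

theorem exists_mem_of_deg_ne_zero {M : Multiset (Sym2 V)} {x : V} (h : deg M x ≠ 0) :
    ∃ y, s(x, y) ∈ M := by
  induction M using Multiset.induction with
  | empty => simp at h
  | cons e M ih =>
    rw [deg_cons] at h
    by_cases h' : deg M x = 0
    · rw [h', add_zero] at h
      obtain ⟨y, rfl⟩ := mem_of_endCount_ne_zero h
      exact ⟨y, Multiset.mem_cons_self _ _⟩
    · obtain ⟨y, hy⟩ := ih h'
      exact ⟨y, Multiset.mem_cons_of_mem hy⟩

theorem deg_ne_zero_of_mem {M : Multiset (Sym2 V)} {x y : V} (h : s(x, y) ∈ M) : deg M x ≠ 0 := by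
  obtain ⟨M, rfl⟩ := Multiset.exists_cons_of_mem h
  rw [deg_cons, endCount_mk]
  simp

theorem IsWalk.append {ends : E → Sym2 V} {u v w : V} {l₁ l₂ : List E} (h₁ : IsWalk ends u l₁ v)
    (h₂ : IsWalk ends v l₂ w) : IsWalk ends u (l₁ ++ l₂) w := by
  induction h₁ with
  | nil => exact h₂
  | cons h _ ih => exact .cons h (ih h₂)

theorem IsWalk.single {ends : E → Sym2 V} {u v : V} {e : E} (h : ends e = s(u, v)) :
    IsWalk ends u [e] v := .cons h (.nil v)

theorem IsWalk.reverse {ends : E → Sym2 V} {u w : V} {l : List E} (h : IsWalk ends u l w) :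
    IsWalk ends w l.reverse u := by
  induction h with
  | nil v => exact .nil v
  | cons h _ ih =>
    rw [List.reverse_cons]
    exact ih.append (.single (h.trans Sym2.eq_swap))

/-- A walk may be cut at any vertex that it visits. -/
theorem IsWalk.split {u w : V} {l : List (Sym2 V)} (h : IsWalk id u l w) (x : V)
    (hx : x = u ∨ ∃ e ∈ l, x ∈ e) :
    ∃ l₁ l₂, l = l₁ ++ l₂ ∧ IsWalk id u l₁ x ∧ IsWalk id x l₂ w := by
  induction h with
  | nil v =>
    obtain rfl : x = v := by simpa using hx
    exact ⟨[], [], rfl, .nil _, .nil _⟩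
  | @cons u v w e es he hes ih =>
    by_cases hxu : x = u
    · subst hxu
      exact ⟨[], e :: es, rfl, .nil _, .cons he hes⟩
    · have : x = v ∨ ∃ e ∈ es, x ∈ e := by
        rcases hx with h | ⟨e', he', hxe⟩
        · exact absurd h hxu
        · rcases List.mem_cons.1 he' with rfl | h
          · rw [show e' = s(u, v) from he, Sym2.mem_iff] at hxe
            exact .inl (hxe.resolve_left hxu)
          · exact .inr ⟨e', h, hxe⟩
      obtain ⟨l₁, l₂, rfl, h1, h2⟩ := ih this
      exact ⟨e :: l₁, l₂, rfl, .cons he h1, h2⟩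

open scoped Classical in
/-- A walk has odd degree at its two ends only, if these are different. -/
theorem IsWalk.deg_mod {u w : V} {l : List (Sym2 V)} (h : IsWalk id u l w) (x : V) :
    (deg (l : Multiset (Sym2 V)) x + (if u = x then 1 else 0) + (if w = x then 1 else 0)) % 2 = 0 := by
  induction h with
  | nil v =>
    simp only [Multiset.coe_nil, deg_zero]
    split_ifs <;> rfl
  | @cons u v w e es he _ ih =>
    rw [← Multiset.cons_coe, deg_cons, show e = s(u, v) from he, endCount_mk]
    omega

/-- Walks stay inside unions of components. -/
theorem IsWalk.mem_iff {u w : V} {l : List (Sym2 V)} (h : IsWalk id u l w)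
    (U : V → Prop) (hU : ∀ a b, s(a, b) ∈ l → (U a ↔ U b)) :
    (U u ↔ U w) ∧ ∀ a b, s(a, b) ∈ l → (U a ↔ U u) := by
  induction h with
  | nil v => simp
  | @cons u v w e es he _ ih =>
    have he' : e = s(u, v) := he
    have h1 : U u ↔ U v := hU u v (by simp [he'])
    obtain ⟨h2, h3⟩ := ih fun a b hab => hU a b (List.mem_cons_of_mem _ hab)
    refine ⟨h1.trans h2, fun a b hab => ?_⟩
    rcases List.mem_cons.1 hab with h | h
    · rw [he', Sym2.eq_iff] at h
      rcases h with ⟨rfl, rfl⟩ | ⟨rfl, rfl⟩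
      · exact Iff.rfl
      · exact h1.symm
    · exact (h3 a b h).trans h1.symm

theorem even_deg_of_closed {u : V} {l : List (Sym2 V)} (h : IsWalk id u l u) (x : V) :
    Even (deg (l : Multiset (Sym2 V)) x) := by
  classical
  have := h.deg_mod x
  rw [Nat.even_iff]
  split_ifs at this <;> omega

theorem edgeConn_of_walk {u w : V} {l : List (Sym2 V)} (h : IsWalk id u l w) :
    EdgeConn (l : Multiset (Sym2 V)) := by
  intro U hU
  obtain ⟨-, h2⟩ := h.mem_iff U fun a b hab => hU a b (Multiset.mem_coe.2 hab)
  by_cases hu : U u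
  · exact .inl fun a b hab => (h2 a b (Multiset.mem_coe.1 hab)).2 hu
  · exact .inr fun a b hab h => hu ((h2 a b (Multiset.mem_coe.1 hab)).1 h)

/-- If all degrees are even, then any trail can be continued to a closed one. -/
theorem exists_closing {M : Multiset (Sym2 V)} (hM : ∀ x, Even (deg M x)) (n : ℕ) :
    ∀ {u z : V} {l : List (Sym2 V)}, IsWalk id u l z → (l : Multiset (Sym2 V)) ≤ M →
      M.card ≤ l.length + n →
      ∃ l', IsWalk id z l' u ∧ ((l ++ l' : List (Sym2 V)) : Multiset (Sym2 V)) ≤ M := by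
  classical
  induction n with
  | zero =>
    intro u z l hl hle hc
    have : (l : Multiset (Sym2 V)) = M := Multiset.eq_of_le_of_card_le hle (by simpa using hc)
    have h1 := hl.deg_mod z
    have h2 := hM z
    rw [← this, Nat.even_iff] at h2
    have huz : u = z := by
      by_contra h
      simp only [h, if_false, if_true] at h1
      omega
    subst huz
    exact ⟨[], .nil _, by simpa using hle⟩
  | succ n ih =>
    intro u z l hl hle hc
    by_cases huz : u = z
    · subst huz
      exact ⟨[], .nil _, by simpa using hle⟩
    · obtain ⟨M', rfl⟩ := Multiset.le_iff_exists_add.1 hle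
      have h1 := hl.deg_mod z
      have h2 := hM z
      rw [deg_add, Nat.even_iff] at h2
      simp only [huz, if_false, if_true] at h1
      obtain ⟨y, hy⟩ := exists_mem_of_deg_ne_zero (M := M') (x := z) (by omega)
      obtain ⟨M'', rfl⟩ := Multiset.exists_cons_of_mem hy
      have hle' : ((l ++ [s(z, y)] : List (Sym2 V)) : Multiset (Sym2 V)) ≤
          (l : Multiset (Sym2 V)) + s(z, y) ::ₘ M'' := by
        rw [← Multiset.coe_add]
        refine add_le_add_right ?_ _
        rw [Multiset.coe_singleton, ← Multiset.singleton_add]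
        exact Multiset.le_add_right _ _
      obtain ⟨l', h3, h4⟩ := ih (hl.append (.single rfl)) hle'
        (by rw [List.length_append, List.length_singleton]; omega)
      refine ⟨s(z, y) :: l', .cons rfl h3, ?_⟩
      rwa [List.append_assoc] at h4

/-- Euler's theorem: closed trails can be enlarged by splicing in another closed trail, until
they contain all edges. -/
theorem exists_euler_tour {M : Multiset (Sym2 V)} (hM : ∀ x, Even (deg M x)) (hc : EdgeConn M) {v : V}
    (hv : M = 0 ∨ ∃ y, s(v, y) ∈ M) : ∃ l, IsWalk id v l v ∧ (l : Multiset (Sym2 V)) = M := by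
  suffices H : ∀ n, ∀ l : List (Sym2 V), IsWalk id v l v → (l : Multiset (Sym2 V)) ≤ M →
      M.card ≤ l.length + n → ∃ l, IsWalk id v l v ∧ (l : Multiset (Sym2 V)) = M from
    H M.card [] (.nil _) (Multiset.zero_le _) (by simp)
  intro n
  induction n with
  | zero =>
    intro l hl hle hcard
    exact ⟨l, hl, Multiset.eq_of_le_of_card_le hle (by simpa using hcard)⟩
  | succ n ih =>
    intro l hl hle hcard
    obtain ⟨M', hM'⟩ := Multiset.le_iff_exists_add.1 hle
    by_cases h0 : M' = 0
    · exact ⟨l, hl, by rw [hM', h0, add_zero]⟩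
    have hM'even : ∀ x, Even (deg M' x) := by
      intro x
      have h1 := hM x
      have h2 := even_deg_of_closed hl x
      rw [hM', deg_add] at h1
      exact (Nat.even_add.1 h1).1 h2
    -- As all edges belong to one component, some remaining edge has an end on the trail.
    obtain ⟨x, y, hxy, hx⟩ : ∃ x y, s(x, y) ∈ M' ∧ (x = v ∨ ∃ e ∈ l, x ∈ e) := by
      by_contra! hno
      have hclosed : ∀ a b, s(a, b) ∈ M → ((a = v ∨ ∃ e ∈ l, a ∈ e) ↔ (b = v ∨ ∃ e ∈ l, b ∈ e)) := by
        intro a b hab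
        rw [hM', Multiset.mem_add, Multiset.mem_coe] at hab
        rcases hab with hab | hab
        · exact iff_of_true (.inr ⟨_, hab, Sym2.mem_mk_left _ _⟩)
            (.inr ⟨_, hab, Sym2.mem_mk_right _ _⟩)
        · have h1 := hno a b hab
          have h2 := hno b a (by rwa [Sym2.eq_swap])
          exact iff_of_false (by simpa using h1) (by simpa using h2)
      obtain ⟨e, he⟩ := Multiset.exists_mem_of_ne_zero h0
      induction e with
      | h a b =>
        have haM : s(a, b) ∈ M := by
          rw [hM', Multiset.mem_add]
          exact .inr he
        have h1 := hno a b he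
        rcases hc _ hclosed with h | h
        · exact absurd (h a b haM) (by simpa using h1)
        · rcases hv with rfl | ⟨y, hy⟩
          · simp at haM
          · exact h v y hy (.inl rfl)
    obtain ⟨l', hl', hle'⟩ := exists_closing hM'even M'.card (IsWalk.single (ends := id)
      (show id s(x, y) = s(x, y) from rfl))
      (by rw [Multiset.coe_singleton]; exact Multiset.singleton_le.2 hxy) (by simp)
    -- The edge is continued to a closed trail of remaining edges, spliced in at `x`.
    obtain ⟨l₁, l₂, rfl, h1, h2⟩ := hl.split x hx
    have hs : IsWalk id x [s(x, y)] y := IsWalk.single rfl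
    refine ih (l₁ ++ (([s(x, y)] ++ l') ++ l₂)) (h1.append ((hs.append hl').append h2)) ?_ ?_
    · rw [hM', ← Multiset.coe_add, ← Multiset.coe_add, ← Multiset.coe_add (l₁) l₂,
        add_comm ((([s(x, y)] ++ l' : List (Sym2 V)) : Multiset (Sym2 V))), ← add_assoc]
      exact add_le_add_right hle' _
    · simp only [List.length_append, List.length_singleton] at hcard ⊢
      omega

end Euler

/-! ### Eulerian extensions and matchings of copies -/

section Matching

variable {V P : Type}

/-- `X` extends the multigraph `M` to one that has an Euler tour, without new vertices. -/
structure Extends (M X : Multiset (Sym2 V)) : Prop where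
  even : ∀ x, Even (deg (M + X) x)
  conn : EdgeConn (M + X)
  supp : ∀ a b, s(a, b) ∈ X → ∃ c, s(a, c) ∈ M

/-- Two out of three parallel edges may be omitted. -/
theorem Extends.of_add_two {M X : Multiset (Sym2 V)} {e : Sym2 V}
    (h : Extends M (e ::ₘ e ::ₘ e ::ₘ X)) : Extends M (e ::ₘ X) where
  even x := by
    have := h.even x
    rw [deg_add, deg_cons, deg_cons, deg_cons, Nat.even_iff] at this
    rw [deg_add, deg_cons, Nat.even_iff]
    omega
  conn U hU := by
    have hm : ∀ e', e' ∈ M + e ::ₘ e ::ₘ e ::ₘ X ↔ e' ∈ M + e ::ₘ X := by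
      intro e'
      simp only [Multiset.mem_add, Multiset.mem_cons]
      tauto
    have := h.conn U
    simp only [hm] at this
    exact this hU
  supp a b hab := h.supp a b (Multiset.mem_cons_of_mem (Multiset.mem_cons_of_mem hab))

/-- A loop may be omitted: the vertex of a loop in an extension belongs to other edges. -/
theorem Extends.of_loop {M X : Multiset (Sym2 V)} {a : V} (h : Extends M (s(a, a) ::ₘ X)) :
    Extends M X where
  even x := by
    have := h.even x
    rw [deg_add, deg_cons, endCount_mk, Nat.even_iff] at this
    rw [deg_add, Nat.even_iff]
    omega
  conn U hU := by
    have hm : ∀ e', e' ∈ M + s(a, a) ::ₘ X ↔ e' = s(a, a) ∨ e' ∈ M + X := by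
      intro e'
      simp only [Multiset.mem_add, Multiset.mem_cons]
      tauto
    refine (h.conn U fun b c hbc => ?_).imp (fun h b c hbc => ?_) fun h b c hbc => ?_
    · rcases (hm _).1 hbc with h | h
      · rw [Sym2.eq_iff] at h
        rcases h with ⟨rfl, rfl⟩ | ⟨rfl, rfl⟩ <;> rfl
      · exact hU b c h
    · exact h b c ((hm _).2 (.inr hbc))
    · exact h b c ((hm _).2 (.inr hbc))
  supp b c hbc := h.supp b c (Multiset.mem_cons_of_mem hbc)

/-- A lightest extension can be chosen without loops and without edges of multiplicity larger
than two. -/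
theorem Extends.exists_reduced {M X : Multiset (Sym2 V)} (h : Extends M X) (w : Sym2 V → ℕ) :
    ∃ X', Extends M X' ∧ (X'.map w).sum ≤ (X.map w).sum ∧ (∀ a, s(a, a) ∉ X') ∧
      ∀ e X₀, X' ≠ e ::ₘ e ::ₘ e ::ₘ X₀ := by
  induction hn : X.card using Nat.strong_induction_on generalizing X with
  | _ n ih =>
    subst hn
    by_cases h1 : ∃ a, s(a, a) ∈ X
    · obtain ⟨a, ha⟩ := h1
      obtain ⟨X₀, rfl⟩ := Multiset.exists_cons_of_mem ha
      obtain ⟨X', a1, a2, a3⟩ := ih X₀.card (by simp) h.of_loop rfl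
      exact ⟨X', a1, a2.trans (by simp), a3⟩
    · by_cases h2 : ∃ e X₀, X = e ::ₘ e ::ₘ e ::ₘ X₀
      · obtain ⟨e, X₀, rfl⟩ := h2
        obtain ⟨X', a1, a2, a3⟩ := ih (e ::ₘ X₀).card (by simp) h.of_add_two rfl
        refine ⟨X', a1, a2.trans ?_, a3⟩
        simp only [Multiset.map_cons, Multiset.sum_cons]
        omega
      · push Not at h1 h2
        exact ⟨X, h, le_rfl, h1, h2⟩

theorem deg_le_of_reduced [Fintype V] {X : Multiset (Sym2 V)} (h1 : ∀ a, s(a, a) ∉ X)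
    (h2 : ∀ e X₀, X ≠ e ::ₘ e ::ₘ e ::ₘ X₀) (v : V) : deg X v ≤ 2 * Fintype.card V := by
  classical
  rw [deg, Finset.sum_multiset_map_count]
  have hcount : ∀ e, X.count e ≤ 2 := by
    intro e
    by_contra! h
    obtain ⟨X₀, hX₀⟩ := Multiset.le_iff_exists_add.1 (Multiset.le_count_iff_replicate_le.1 h)
    exact h2 e X₀ (by rw [hX₀]; simp [Multiset.replicate_succ, Multiset.cons_add])
  calc ∑ e ∈ X.toFinset, X.count e • endCount v e
      ≤ ∑ e ∈ X.toFinset, if v ∈ e then 2 else 0 := by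
        refine Finset.sum_le_sum fun e he => ?_
        rw [Multiset.mem_toFinset] at he
        induction e with
        | h a b =>
          have hab : a ≠ b := fun h => h1 a (by rw [h] at he ⊢; exact he)
          have := hcount s(a, b)
          rw [endCount_mk, smul_eq_mul]
          by_cases ha : a = v
          · have hb : b ≠ v := fun h => hab (ha.trans h.symm)
            subst ha
            simpa [hb] using this
          · by_cases hb : b = v
            · subst hb
              simpa [ha] using this
            · simp [ha, hb]
    _ = 2 * (X.toFinset.filter (v ∈ ·)).card := by
        rw [← Finset.sum_filter, Finset.sum_const, smul_eq_mul, mul_comm]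
    _ ≤ 2 * Fintype.card V := by
        refine Nat.mul_le_mul_left _ ?_
        have hsub : X.toFinset.filter (v ∈ ·) ⊆ Finset.univ.image fun u => s(v, u) := by
          intro e he
          obtain ⟨u, rfl⟩ := (Finset.mem_filter.1 he).2
          exact Finset.mem_image_of_mem _ (Finset.mem_univ u)
        exact (Finset.card_le_card hsub).trans Finset.card_image_le

/-- A multigraph `X` is realized by a perfect matching of copies of vertices, if the number of
copies of each vertex is large enough and of the same parity as its degree: superfluous copies are
matched with copies of the same vertex. -/
theorem exists_matching [DecidableEq P] [DecidableEq V] (g : P → V) (wt : V → V → ℕ)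
    (hdiag : ∀ v, wt v v = 0) (hsymm : ∀ u v, wt u v = wt v u) (w : Sym2 V → ℕ)
    (hw : ∀ u v, wt u v ≤ w s(u, v)) (A : Finset P) (X : Multiset (Sym2 V))
    (hX : ∀ a, s(a, a) ∉ X)
    (hle : ∀ v, deg X v ≤ (A.filter fun p => g p = v).card)
    (hpar : ∀ v, Even (deg X v + (A.filter fun p => g p = v).card)) :
    ∃ σ : P → P, (∀ p ∈ A, σ p ∈ A ∧ σ p ≠ p ∧ σ (σ p) = p) ∧
      ∑ p ∈ A, wt (g (σ p)) (g p) ≤ 2 * (X.map w).sum ∧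
      ∀ a b, s(a, b) ∈ X → ∃ p ∈ A, s(g p, g (σ p)) = s(a, b) := by
  -- A matching of the copies other than `p` and `q` is completed by the pair of `p` and `q`.
  have add : ∀ (A : Finset P) (p q : P), p ∈ A → q ∈ A → p ≠ q → ∀ (X X' : Multiset (Sym2 V)),
      wt (g p) (g q) + (X.map w).sum ≤ (X'.map w).sum →
      (∀ a b, s(a, b) ∈ X' → s(g p, g q) = s(a, b) ∨ s(a, b) ∈ X) →
      (∃ σ : P → P, (∀ r ∈ (A.erase p).erase q, σ r ∈ (A.erase p).erase q ∧ σ r ≠ r ∧ σ (σ r) = r) ∧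
        ∑ r ∈ (A.erase p).erase q, wt (g (σ r)) (g r) ≤ 2 * (X.map w).sum ∧
        ∀ a b, s(a, b) ∈ X → ∃ r ∈ (A.erase p).erase q, s(g r, g (σ r)) = s(a, b)) →
      ∃ σ : P → P, (∀ r ∈ A, σ r ∈ A ∧ σ r ≠ r ∧ σ (σ r) = r) ∧
        ∑ r ∈ A, wt (g (σ r)) (g r) ≤ 2 * (X'.map w).sum ∧
        ∀ a b, s(a, b) ∈ X' → ∃ r ∈ A, s(g r, g (σ r)) = s(a, b) := by
    rintro A p q hp hq hpq X X' hsum hmem ⟨σ, h1, h2, h3⟩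
    have hqp : q ∈ A.erase p := Finset.mem_erase.2 ⟨hpq.symm, hq⟩
    have hA : ∀ r ∈ A, r = p ∨ r = q ∨ r ∈ (A.erase p).erase q := by
      intro r hr
      simp only [Finset.mem_erase]
      tauto
    have hsub : ∀ r ∈ (A.erase p).erase q, r ∈ A ∧ r ≠ p ∧ r ≠ q := by
      intro r hr
      simp only [Finset.mem_erase] at hr
      tauto
    set τ : P → P := fun r => if r = p then q else if r = q then p else σ r with hτ
    have hτp : τ p = q := by simp [hτ]
    have hτq : τ q = p := by simp [hτ, hpq.symm]
    have hτr : ∀ r ∈ (A.erase p).erase q, τ r = σ r := by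
      intro r hr
      obtain ⟨-, hr1, hr2⟩ := hsub r hr
      simp [hτ, hr1, hr2]
    refine ⟨τ, ?_, ?_, ?_⟩
    · intro r hr
      rcases hA r hr with rfl | rfl | hr'
      · rw [hτp, hτq]
        exact ⟨hq, hpq.symm, rfl⟩
      · rw [hτq, hτp]
        exact ⟨hp, hpq, rfl⟩
      · obtain ⟨a1, a2, a3⟩ := h1 r hr'
        rw [hτr r hr', hτr _ a1]
        exact ⟨(hsub _ a1).1, a2, a3⟩
    · rw [← Finset.add_sum_erase _ _ hp, ← Finset.add_sum_erase _ _ hqp, hτp, hτq,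
        Finset.sum_congr rfl fun r hr => by rw [hτr r hr], hsymm (g q)]
      omega
    · intro a b hab
      rcases hmem a b hab with h | h
      · exact ⟨p, hp, by rw [hτp, h]⟩
      · obtain ⟨r, hr, h'⟩ := h3 a b h
        exact ⟨r, (hsub r hr).1, by rw [hτr r hr, h']⟩
  -- Removing two copies changes the numbers of copies like removing an edge changes the degrees.
  have hcard : ∀ (A : Finset P) (p q : P), p ∈ A → q ∈ A → p ≠ q → ∀ v,
      (((A.erase p).erase q).filter fun r => g r = v).card + endCount v s(g p, g q) =
        (A.filter fun r => g r = v).card := by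
    intro A p q hp hq hpq v
    rw [Finset.card_filter, Finset.card_filter, endCount_mk]
    rw [← Finset.add_sum_erase A _ hp, ← Finset.add_sum_erase (A.erase p) _
      (Finset.mem_erase.2 ⟨hpq.symm, hq⟩)]
    have e1 : (@ite ℕ (g p = v) (Classical.propDecidable _) 1 0) = if g p = v then 1 else 0 := by
      congr
    have e2 : (@ite ℕ (g q = v) (Classical.propDecidable _) 1 0) = if g q = v then 1 else 0 := by
      congr
    rw [e1, e2]
    ring
  induction X using Multiset.induction generalizing A with
  | empty =>
    induction hn : A.card using Nat.strong_induction_on generalizing A with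
    | _ n ih =>
      subst hn
      rcases A.eq_empty_or_nonempty with rfl | ⟨p, hp⟩
      · exact ⟨id, by simp, by simp, by simp⟩
      -- The number of copies of the vertex `g p` is even and positive, so there is another copy of it.
      · have h1 : p ∈ A.filter fun r => g r = g p := Finset.mem_filter.2 ⟨hp, rfl⟩
        have h2 : 1 < (A.filter fun r => g r = g p).card := by
          have h3 : 0 < (A.filter fun r => g r = g p).card := Finset.card_pos.2 ⟨p, h1⟩
          have h4 := hpar (g p)
          rw [deg_zero, zero_add, Nat.even_iff] at h4
          omega
        obtain ⟨q, hq, hqp⟩ := Finset.exists_mem_ne h2 p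
        obtain ⟨hqA, hgq⟩ := Finset.mem_filter.1 hq
        refine add A p q hp hqA hqp.symm 0 0 (by simp [hgq, hdiag]) (by simp)
          (ih _ ?_ _ (fun _ => by simp) ?_ rfl)
        · exact (Finset.card_le_card (Finset.erase_subset _ _)).trans_lt
            (Finset.card_erase_lt_of_mem hp)
        · intro v
          have h5 := hcard A p q hp hqA hqp.symm v
          have h6 := hpar v
          rw [hgq, endCount_mk] at h5
          rw [deg_zero, zero_add, Nat.even_iff] at h6 ⊢
          omega
  | cons e X ih =>
    induction e with
    | h a b =>
      have hab : a ≠ b := by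
        rintro rfl
        exact hX a (Multiset.mem_cons_self _ _)
      have ha : 0 < (A.filter fun p => g p = a).card := by
        refine lt_of_lt_of_le ?_ (hle a)
        rw [deg_cons, endCount_mk]
        simp
      have hb : 0 < (A.filter fun p => g p = b).card := by
        refine lt_of_lt_of_le ?_ (hle b)
        rw [deg_cons, endCount_mk]
        simp
      obtain ⟨p, hp⟩ := Finset.card_pos.1 ha
      obtain ⟨q, hq⟩ := Finset.card_pos.1 hb
      obtain ⟨hpA, hpa⟩ := Finset.mem_filter.1 hp
      obtain ⟨hqA, hqb⟩ := Finset.mem_filter.1 hq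
      subst hpa hqb
      have hpq : p ≠ q := fun h => hab (by rw [h])
      refine add A p q hpA hqA hpq X _ ?_ ?_ (ih _ ?_ ?_ ?_)
      · rw [Multiset.map_cons, Multiset.sum_cons]
        exact Nat.add_le_add_right (hw _ _) _
      · intro a b hab
        rcases Multiset.mem_cons.1 hab with h | h
        · exact .inl h.symm
        · exact .inr h
      · exact fun a h => hX a (Multiset.mem_cons_of_mem h)
      · intro v
        have h1 := hle v
        rw [deg_cons, ← hcard A p q hpA hqA hpq v] at h1
        omega
      · intro v
        have h1 := hpar v
        rw [deg_cons, ← hcard A p q hpA hqA hpq v, Nat.even_iff] at h1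
        rw [Nat.even_iff]
        omega

end Matching

/-! ### Linkings and Eulerian extensions -/

namespace RAM

namespace Inp

variable (I : Inp)

/-- The classes of the vertices after the first `t` edges have been processed. -/
def cls (t : ℕ) : ℕ → ℕ :=
  Nat.rec (fun v => v) (fun t u v => if u v = u (I.e (2 * t + 1)) then u (I.e (2 * t)) else u v) t

theorem cls_succ (t v : ℕ) : I.cls (t + 1) v =
    if I.cls t v = I.cls t (I.e (2 * t + 1)) then I.cls t (I.e (2 * t)) else I.cls t v := rfl

/-- The ends of processed edges are in the same class. -/
theorem cls_edge {t i : ℕ} (hi : i < t) : I.cls t (I.e (2 * i)) = I.cls t (I.e (2 * i + 1)) := by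
  induction t with
  | zero => omega
  | succ t ih =>
    simp only [cls_succ]
    rcases Nat.lt_succ_iff_lt_or_eq.1 hi with h | rfl
    · rw [ih h]
    · simp

/-- Vertices in the same class are on the same side of each union of components. -/
theorem cls_closed {t : ℕ} {U : ℕ → Prop} (hU : ∀ i < t, (U (I.e (2 * i)) ↔ U (I.e (2 * i + 1))))
    {v v' : ℕ} (h : I.cls t v = I.cls t v') : U v ↔ U v' := by
  induction t generalizing v v' with
  | zero =>
    have : v = v' := h
    rw [this]
  | succ t ih =>
    have ih' := fun {v v'} => @ih (fun i hi => hU i (hi.trans t.lt_succ_self)) v v'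
    have ht := hU t t.lt_succ_self
    simp only [cls_succ] at h
    split_ifs at h with h1 h2 h2
    · exact ih' (h1.trans h2.symm)
    · exact (ih' h1).trans (ht.symm.trans (ih' h))
    · exact (ih' h).trans (ht.trans (ih' h2).symm)
    · exact ih' h

section

variable {I} (he : ∀ q, I.e q ≤ I.n)
include he

theorem cls_le (t : ℕ) {v : ℕ} (hv : v ≤ I.n) : I.cls t v ≤ I.n := by
  induction t generalizing v with
  | zero => exact hv
  | succ t ih =>
    rw [cls_succ]
    split_ifs
    · exact ih (he _)
    · exact ih hv

theorem lab_eq {v : ℕ} (hv : v ≤ I.n) : I.lab v = I.cls I.m v := by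
  refine digit_vecIter (Nat.succ_pos _) (fun t v => I.cls t v) (T := I.m) (fun i _ => rfl) ?_ ?_ _ le_rfl
    _ (by omega)
  · intro t _ u hu i hi
    rw [cls_succ, hu i hi, hu _ (Nat.lt_succ_of_le (he _)), hu _ (Nat.lt_succ_of_le (he _))]
  · intro t _ i hi
    exact Nat.lt_succ_of_le (cls_le he t (by omega))

theorem comp_edge {i : ℕ} (hi : i < I.m) : I.comp (I.e (2 * i)) = I.comp (I.e (2 * i + 1)) := by
  rw [comp, comp, lab_eq he (he _), lab_eq he (he _), cls_edge I hi]

omit he in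
theorem att_lab {q : ℕ} (hq : q < 2 * I.m) : I.att (I.lab (I.e q)) = 1 := by
  have : 1 ≤ ∑ q' ∈ Finset.range (2 * I.m), if I.lab (I.e q') = I.lab (I.e q) then 1 else 0 := by
    rw [← Finset.card_filter]
    exact Finset.card_pos.2 ⟨q, by simp [hq]⟩
  rw [att, min_eq_left this]

theorem comp_lt {q : ℕ} (hq : q < 2 * I.m) : I.comp (I.e q) < I.k := by
  have h1 : I.lab (I.e q) + 1 ≤ I.n + 1 := by
    rw [lab_eq he (he _)]
    exact Nat.succ_le_succ (cls_le he _ (he _))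
  have h2 : ∑ j ∈ Finset.range (I.lab (I.e q) + 1), I.att j ≤ I.k :=
    Finset.sum_le_sum_of_subset (Finset.range_subset_range.2 h1)
  rw [Finset.sum_range_succ, att_lab hq] at h2
  exact h2

omit he in
theorem lab_eq_of_comp_eq {q q' : ℕ} (hq : q < 2 * I.m) (hq' : q' < 2 * I.m)
    (h : I.comp (I.e q) = I.comp (I.e q')) : I.lab (I.e q) = I.lab (I.e q') := by
  have key : ∀ q q', q < 2 * I.m → I.lab (I.e q) < I.lab (I.e q') →
      I.comp (I.e q) < I.comp (I.e q') := by
    intro q q' hq h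
    have h2 : ∑ j ∈ Finset.range (I.lab (I.e q) + 1), I.att j ≤ I.comp (I.e q') :=
      Finset.sum_le_sum_of_subset (Finset.range_subset_range.2 h)
    rw [Finset.sum_range_succ, att_lab hq] at h2
    exact h2
  rcases lt_trichotomy (I.lab (I.e q)) (I.lab (I.e q')) with h1 | h1 | h1
  · exact absurd h (key _ _ hq h1).ne
  · exact h1
  · exact absurd h (key _ _ hq' h1).ne'

omit he in
/-- All numbers below `k` are numbers of components. -/
theorem exists_comp_eq {c : ℕ} (hc : c < I.k) : ∃ q < 2 * I.m, I.comp (I.e q) = c := by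
  have key : ∀ n, c < ∑ j ∈ Finset.range n, I.att j →
      ∃ j, I.att j ≠ 0 ∧ ∑ i ∈ Finset.range j, I.att i = c := by
    intro n
    induction n with
    | zero => simp
    | succ n ih =>
      intro h
      by_cases h' : c < ∑ j ∈ Finset.range n, I.att j
      · exact ih h'
      · have := I.att_le n
        rw [Finset.sum_range_succ] at h
        exact ⟨n, by omega, by omega⟩
  obtain ⟨j, hj, hc'⟩ := key _ hc
  have : (∑ q ∈ Finset.range (2 * I.m), if I.lab (I.e q) = j then 1 else 0) ≠ 0 := by
    intro h
    simp [att, h] at hj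
  obtain ⟨q, hq, hq'⟩ := Finset.exists_ne_zero_of_sum_ne_zero this
  refine ⟨q, Finset.mem_range.1 hq, ?_⟩
  rw [comp, of_not_not fun h => hq' (if_neg h), hc']

omit he in
theorem k_le_card {T : Type} [Finite T] (τ : Fin (2 * I.m) → T)
    (hτ : ∀ q q', τ q = τ q' → I.comp (I.e q) = I.comp (I.e q')) : I.k ≤ Nat.card T := by
  choose f hf hf' using fun c : Fin I.k => exists_comp_eq c.2
  have : Function.Injective fun c => τ ⟨f c, hf c⟩ := by
    intro c c' h
    have := hτ _ _ h
    rw [hf', hf'] at this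
    exact Fin.ext this
  simpa using Nat.card_le_card_of_injective _ this

end

/-- The data describe the multigraph with edges `s(a i, b i)` and the weights `pw`, where `ν` gives
numbers to the vertices. -/
structure Rep {V : Type} (ν : V → ℕ) (a b : Fin I.m → V) (pw : Sym2 V → ℕ) : Prop where
  inj : Function.Injective ν
  lt : ∀ v, ν v < I.n
  e_le : ∀ q, I.e q ≤ I.n
  left : ∀ i : Fin I.m, I.e (2 * i) = ν (a i)
  right : ∀ i : Fin I.m, I.e (2 * i + 1) = ν (b i)
  w : ∀ u v, I.w (ν u) (ν v) = pw s(u, v)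

namespace Rep

variable {I} {V : Type} {ν : V → ℕ} {a b : Fin I.m → V} {pw : Sym2 V → ℕ} (hI : I.Rep ν a b pw)

/-- The multiset of the edges `s(a i, b i)`. -/
def _root_.edgeMultiset {V : Type} {m : ℕ} (a b : Fin m → V) : Multiset (Sym2 V) :=
  Finset.univ.val.map fun i => s(a i, b i)

theorem _root_.mem_edgeMultiset {V : Type} {m : ℕ} {a b : Fin m → V} {e : Sym2 V} :
    e ∈ edgeMultiset a b ↔ ∃ i, s(a i, b i) = e := by
  simp [edgeMultiset]

include hI

theorem exists_edge {q : ℕ} (hq : q < 2 * I.m) :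
    ∃ x y, s(x, y) ∈ edgeMultiset a b ∧ ν x = I.e q := by
  have hi : q / 2 < I.m := by omega
  rcases Nat.mod_two_eq_zero_or_one q with h | h
  · refine ⟨a ⟨q / 2, hi⟩, b ⟨q / 2, hi⟩, mem_edgeMultiset.2 ⟨_, rfl⟩, ?_⟩
    rw [← hI.left]
    congr 1
    dsimp only
    omega
  · refine ⟨b ⟨q / 2, hi⟩, a ⟨q / 2, hi⟩, mem_edgeMultiset.2 ⟨_, Sym2.eq_swap⟩, ?_⟩
    rw [← hI.right]
    congr 1
    dsimp only
    omega

theorem exists_end {x y : V} (h : s(x, y) ∈ edgeMultiset a b) : ∃ q < 2 * I.m, I.e q = ν x := by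
  obtain ⟨i, hi⟩ := mem_edgeMultiset.1 h
  rw [Sym2.eq_iff] at hi
  have := i.2
  rcases hi with ⟨rfl, -⟩ | ⟨-, rfl⟩
  · exact ⟨2 * i, by omega, hI.left i⟩
  · exact ⟨2 * i + 1, by omega, hI.right i⟩

theorem comp_eq {x y : V} (h : s(x, y) ∈ edgeMultiset a b) : I.comp (ν x) = I.comp (ν y) := by
  obtain ⟨i, hi⟩ := mem_edgeMultiset.1 h
  have := comp_edge hI.e_le i.2
  rw [hI.left, hI.right] at this
  rw [Sym2.eq_iff] at hi
  rcases hi with ⟨rfl, rfl⟩ | ⟨rfl, rfl⟩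
  · exact this
  · exact this.symm

/-- Vertices with the same component number are on the same side of each union of components. -/
theorem closed {U : V → Prop} (hU : ∀ x y, s(x, y) ∈ edgeMultiset a b → (U x ↔ U y)) {x y : V}
    {q q' : ℕ} (hq : q < 2 * I.m) (hq' : q' < 2 * I.m) (hx : I.e q = ν x) (hy : I.e q' = ν y)
    (h : I.comp (ν x) = I.comp (ν y)) : U x ↔ U y := by
  rw [← hx, ← hy] at h
  have h1 := lab_eq_of_comp_eq hq hq' h
  rw [lab_eq hI.e_le (hI.e_le _), lab_eq hI.e_le (hI.e_le _)] at h1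
  have hiff : ∀ v, (∃ v', ν v' = ν v ∧ U v') ↔ U v := fun v =>
    ⟨fun ⟨v', h, h'⟩ => hI.inj h ▸ h', fun h => ⟨v, rfl, h⟩⟩
  have := cls_closed I (t := I.m) (U := fun z => ∃ v, ν v = z ∧ U v) (fun i hi => by
    rw [hI.left ⟨i, hi⟩, hI.right ⟨i, hi⟩, hiff, hiff]
    exact hU _ _ (mem_edgeMultiset.2 ⟨_, rfl⟩)) h1
  rwa [hx, hy, hiff, hiff] at this

theorem exists_copy_map : ∃ g : Fin I.N → V, ∀ p, ν (g p) = I.h p := by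
  have : ∀ p : Fin I.N, ∃ v, ν v = I.h p := by
    intro p
    have hm : 0 < 2 * I.m := by
      rcases Nat.eq_zero_or_pos (2 * I.m) with h | h
      · have := p.2
        simp [N, h] at this
      · exact h
    obtain ⟨x, -, -, hx⟩ := hI.exists_edge (Nat.mod_lt (p : ℕ) hm)
    exact ⟨x, hx⟩
  choose g hg using this
  exact ⟨g, hg⟩

omit hI in
theorem exists_edge_of_copy {g : Fin I.N → V} (hg : ∀ p, ν (g p) = I.h p) (p : Fin I.N) :
    ∃ q < 2 * I.m, I.e q = ν (g p) := by
  have hm : 0 < 2 * I.m := by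
    rcases Nat.eq_zero_or_pos (2 * I.m) with h | h
    · have := p.2
      simp [N, h] at this
    · exact h
  exact ⟨p % (2 * I.m), Nat.mod_lt _ hm, (hg p).symm⟩

/-- The number of copies of a vertex. -/
theorem card_copies [DecidableEq V] {g : Fin I.N → V} (hg : ∀ p, ν (g p) = I.h p) (v : V) :
    (Finset.univ.filter fun p => g p = v).card = (2 * I.n + 1) * deg (edgeMultiset a b) v := by
  have h1 : (Finset.univ.filter fun p => g p = v).card =
      ∑ p ∈ Finset.range I.N, if I.e (p % (2 * I.m)) = ν v then 1 else 0 := by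
    rw [Finset.card_filter, ← Fin.sum_univ_eq_sum_range
      (fun p => if I.e (p % (2 * I.m)) = ν v then 1 else 0)]
    refine Finset.sum_congr rfl fun p _ => ?_
    have : I.e (p % (2 * I.m)) = ν v ↔ g p = v := by
      rw [← hI.inj.eq_iff, hg, h]
    simp only [this]
  -- Each end of an edge occurs `2 * n + 1` times among the residues modulo `2 * m`.
  have h2 : ∀ (f : ℕ → ℕ) (A B : ℕ), ∑ p ∈ Finset.range (A * B), f (p % A) =
      B * ∑ p ∈ Finset.range A, f p := by
    intro f A B
    induction B with
    | zero => simp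
    | succ B ih =>
      rw [mul_add, mul_one, Finset.sum_range_add, ih, add_mul, one_mul]
      congr 1
      refine Finset.sum_congr rfl fun p hp => ?_
      rw [Nat.mul_add_mod, Nat.mod_eq_of_lt (Finset.mem_range.1 hp)]
  have h3 : ∀ (f : ℕ → ℕ) (m : ℕ), ∑ q ∈ Finset.range (2 * m), f q =
      ∑ i ∈ Finset.range m, (f (2 * i) + f (2 * i + 1)) := by
    intro f m
    induction m with
    | zero => simp
    | succ m ih =>
      rw [mul_add, mul_one, Finset.sum_range_succ, Finset.sum_range_succ, ih,
        Finset.sum_range_succ, add_assoc]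
  rw [h1, N, h2 fun q => if I.e q = ν v then 1 else 0, h3, ← Fin.sum_univ_eq_sum_range
    (fun i => (if I.e (2 * i) = ν v then 1 else 0) + if I.e (2 * i + 1) = ν v then 1 else 0)]
  congr 1
  rw [deg, edgeMultiset, Multiset.map_map]
  refine Finset.sum_congr rfl fun i _ => ?_
  rw [Function.comp_apply, endCount_mk, hI.left, hI.right]
  simp only [hI.inj.eq_iff]
  congr

/-- A reduced extension is realized by a matching of the copies, and if the multigraph becomes
connected, no nontrivial cut of the set of components is respected by the matching. -/
theorem linking_of_extends [Fintype V] (hw : ∀ u v, I.w u v = I.w v u) {X : Multiset (Sym2 V)}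
    (hX : Extends (edgeMultiset a b) X) (hℓ : (X.map pw).sum ≤ I.ℓ) :
    ∃ σ, I.Linking σ ∧ I.cost σ ≤ 2 * I.ℓ := by
  classical
  obtain ⟨X', h1, h2, h3, h4⟩ := hX.exists_reduced pw
  obtain ⟨g, hg⟩ := hI.exists_copy_map
  have hcard : Fintype.card V ≤ I.n := by
    have := Fintype.card_le_of_injective (fun v => (⟨ν v, hI.lt v⟩ : Fin I.n))
      fun v v' h => hI.inj (congrArg Fin.val h)
    simpa using this
  obtain ⟨σ, s1, s2, s3⟩ := exists_matching g (fun u v => I.wt (ν u) (ν v)) (fun v => if_pos rfl)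
    (fun u v => by simp only [wt, hw (ν u), eq_comm (a := ν u)]) pw
    (fun u v => by
      unfold wt
      split_ifs
      · exact Nat.zero_le _
      · exact (min_le_left _ _).trans (hI.w u v).le) Finset.univ X' h3
    -- There are enough copies: a vertex of the extension is an end of an edge.
    (fun v => by
      by_cases h0 : deg X' v = 0
      · omega
      obtain ⟨y, hy⟩ := exists_mem_of_deg_ne_zero h0
      obtain ⟨c, hc⟩ := h1.supp _ _ hy
      have h5 := Nat.mul_le_mul_left (2 * I.n + 1) (Nat.pos_of_ne_zero (deg_ne_zero_of_mem hc))
      rw [hI.card_copies hg]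
      have := deg_le_of_reduced h3 h4 v
      omega)
    -- The number of copies, an odd multiple of the degree, has the right parity.
    (fun v => by
      have := h1.even v
      rw [deg_add, add_comm] at this
      rw [hI.card_copies hg, Nat.add_mul, one_mul, add_left_comm, mul_assoc]
      exact (even_two_mul _).add this)
  have hinv : Function.Involutive σ := fun p => (s1 p (Finset.mem_univ _)).2.2
  refine ⟨hinv.toPerm, ⟨?_, fun p => (s1 p (Finset.mem_univ _)).2.1, ?_⟩, ?_⟩
  · ext p
    simp [hinv p]
  · intro S hS hσ
    rcases Nat.eq_zero_or_pos I.k with hk | hk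
    · rw [hk] at hS
      simpa using hS
    -- A cut that the matching respects is a union of components of the extended multigraph.
    have hU := h1.conn (fun v => S.testBit (I.comp (ν v))) ?_
    · obtain ⟨q, hq, hqk⟩ := exists_comp_eq (I := I) (c := I.k - 1) (by omega)
      obtain ⟨x, y, hxy, hx⟩ := hI.exists_edge hq
      -- The component `k - 1` is on the side `0`, hence all components are.
      have htop : S.testBit (I.comp (ν x)) = false := by
        rw [hx, hqk]
        exact Nat.testBit_lt_two_pow hS
      have hU' := hU.resolve_left fun h => by
        have := h x y (Multiset.mem_add.2 (.inl hxy))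
        rw [htop] at this
        exact absurd this (by simp)
      refine Nat.eq_of_testBit_eq fun c => ?_
      rw [Nat.zero_testBit]
      by_cases hc : c < I.k
      · obtain ⟨q, hq, hqc⟩ := exists_comp_eq hc
        obtain ⟨x, y, hxy, hx⟩ := hI.exists_edge hq
        have := hU' x y (Multiset.mem_add.2 (.inl hxy))
        rw [hx, hqc] at this
        simpa using this
      · exact Nat.testBit_lt_two_pow (hS.trans_le (Nat.pow_le_pow_right (by simp) (by omega)))
    · intro x y hxy
      rcases Multiset.mem_add.1 hxy with h | h
      · rw [hI.comp_eq h]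
      · obtain ⟨p, -, hp⟩ := s3 x y h
        have h6 : S.testBit (I.comp (I.h (σ p))) = S.testBit (I.comp (I.h p)) := hσ p
        rw [← hg, ← hg] at h6
        rw [Sym2.eq_iff] at hp
        rcases hp with ⟨rfl, rfl⟩ | ⟨rfl, rfl⟩
        · rw [h6]
        · rw [h6]
  · have : I.cost hinv.toPerm = ∑ p, I.wt (ν (g (σ p))) (ν (g p)) := by
      simp only [cost, hg]
      rfl
    rw [this]
    exact s2.trans (Nat.mul_le_mul_left _ (h2.trans hℓ))

/-- The pairs of a linking are the edges of an extension. Here weights above `ℓ` do not occur, so it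
does not matter that the weights in the algorithm are capped. -/
theorem extends_of_linking (hw : ∀ u v, I.w u v = I.w v u) {σ : Equiv.Perm (Fin I.N)}
    (hσ : I.Linking σ) (hcost : I.cost σ ≤ 2 * I.ℓ) :
    ∃ X, Extends (edgeMultiset a b) X ∧ (X.map pw).sum ≤ I.ℓ := by
  classical
  obtain ⟨g, hg⟩ := hI.exists_copy_map
  have hσσ : ∀ p, σ (σ p) = p := fun p => congrArg (fun τ : Equiv.Perm (Fin I.N) => τ p) hσ.invol
  set X₀ : Multiset (Sym2 V) :=
    (Finset.univ.filter fun p => p < σ p).val.map fun p => s(g p, g (σ p)) with hX₀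
  have hmem : ∀ p, s(g p, g (σ p)) ∈ X₀ := by
    intro p
    rcases lt_or_gt_of_ne (hσ.ne p) with h | h
    · exact Multiset.mem_map.2 ⟨σ p, by simp [hσσ, h], by rw [hσσ, Sym2.eq_swap]⟩
    · exact Multiset.mem_map.2 ⟨p, by simp [h], rfl⟩
  have hmem' : ∀ x y, s(x, y) ∈ X₀ → ∃ p, s(g p, g (σ p)) = s(x, y) := by
    intro x y h
    obtain ⟨p, -, hp⟩ := Multiset.mem_map.1 h
    exact ⟨p, hp⟩
  have hend : ∀ x y, s(x, y) ∈ X₀ → ∃ p, g p = x := by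
    intro x y h
    obtain ⟨p, hp⟩ := hmem' x y h
    rw [Sym2.eq_iff] at hp
    rcases hp with ⟨rfl, -⟩ | ⟨-, rfl⟩
    · exact ⟨p, rfl⟩
    · exact ⟨σ p, rfl⟩
  have hsupp : ∀ x y, s(x, y) ∈ X₀ → ∃ c, s(x, c) ∈ edgeMultiset a b := by
    intro x y h
    obtain ⟨p, rfl⟩ := hend x y h
    obtain ⟨q, hq, hqp⟩ := exists_edge_of_copy hg p
    obtain ⟨x, c, hxc, hx⟩ := hI.exists_edge hq
    rw [hqp] at hx
    exact ⟨c, hI.inj hx ▸ hxc⟩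
  have hext : Extends (edgeMultiset a b) X₀ := by
    refine ⟨fun v => ?_, fun U hU => ?_, hsupp⟩
    · have hdeg : deg X₀ v = (2 * I.n + 1) * deg (edgeMultiset a b) v := by
        rw [← hI.card_copies hg, Finset.card_filter,
          sum_involution_eq hσσ hσ.ne fun p => if g p = v then 1 else 0, deg, hX₀,
          Multiset.map_map]
        refine Finset.sum_congr rfl fun p _ => ?_
        rw [Function.comp_apply, endCount_mk]
      rw [deg_add, hdeg]
      exact ⟨(I.n + 1) * deg (edgeMultiset a b) v, by ring⟩
    · by_cases hk : I.k = 0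
      · refine .inl fun x y hxy => ?_
        have : ∃ c, s(x, c) ∈ edgeMultiset a b :=
          (Multiset.mem_add.1 hxy).elim (fun h => ⟨y, h⟩) (hsupp x y)
        obtain ⟨c, hc⟩ := this
        obtain ⟨q, hq, -⟩ := hI.exists_end hc
        have := comp_lt hI.e_le hq
        omega
      obtain ⟨qt, hqt, hqk⟩ := exists_comp_eq (I := I) (c := I.k - 1) (by omega)
      obtain ⟨t, -, -, ht⟩ := hI.exists_edge hqt
      have hUR : ∀ x y, s(x, y) ∈ edgeMultiset a b → (U x ↔ U y) := fun x y h =>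
        hU x y (Multiset.mem_add.2 (.inl h))
      -- The components whose side of `U` differs from that of the component `k - 1` form a cut that the
      -- linking respects, so there are none.
      set S : ℕ := Nat.ofBits fun c : Fin (I.k - 1) => decide
        (∃ x q, q < 2 * I.m ∧ I.e q = ν x ∧ I.comp (ν x) = c ∧ ¬ (U x ↔ U t)) with hS
      have hbit : ∀ x q, q < 2 * I.m → I.e q = ν x →
          (S.testBit (I.comp (ν x)) = true ↔ ¬ (U x ↔ U t)) := by
        intro x q hq hx
        have hlt := comp_lt hI.e_le hq
        rw [hx] at hlt
        by_cases hc : I.comp (ν x) < I.k - 1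
        · rw [hS, Nat.testBit_ofBits_lt _ _ hc, decide_eq_true_iff]
          constructor
          · rintro ⟨y, q', hq', hy, hxy, h⟩
            rwa [← hI.closed hUR hq' hq hy hx hxy]
          · intro h
            exact ⟨x, q, hq, hx, rfl, h⟩
        · rw [hS, Nat.testBit_ofBits_ge _ _ (by omega)]
          have := hI.closed hUR hq hqt hx ht.symm (by rw [ht, hqk]; omega)
          simp [this]
      have hS0 := hσ.conn S (Nat.ofBits_lt_two_pow _) fun p => by
        obtain ⟨q, hq, hqp⟩ := exists_edge_of_copy hg p
        obtain ⟨q', hq', hqp'⟩ := exists_edge_of_copy hg (σ p)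
        rw [Bool.eq_iff_iff, ← hg, ← hg, hbit _ _ hq hqp, hbit _ _ hq' hqp',
          hU _ _ (Multiset.mem_add.2 (.inr (hmem p)))]
      have hall : ∀ x y, s(x, y) ∈ edgeMultiset a b + X₀ → (U x ↔ U t) := by
        intro x y hxy
        have : ∃ c, s(x, c) ∈ edgeMultiset a b :=
          (Multiset.mem_add.1 hxy).elim (fun h => ⟨y, h⟩) (hsupp x y)
        obtain ⟨c, hc⟩ := this
        obtain ⟨q, hq, hqx⟩ := hI.exists_end hc
        have := hbit x q hq hqx
        rw [hS0, Nat.zero_testBit] at this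
        simpa using this
      by_cases h : U t
      · exact .inl fun x y hxy => (hall x y hxy).2 h
      · exact .inr fun x y hxy hx => h ((hall x y hxy).1 hx)
  -- Pairs of copies of the same vertex cost nothing, but loops may have a positive weight `pw`;
  -- they are therefore removed, together with superfluous parallel edges.
  obtain ⟨X, h1, h2, h3, -⟩ := hext.exists_reduced fun e => if e.IsDiag then 0 else pw e
  refine ⟨X, h1, ?_⟩
  have h4 : X.map pw = X.map fun e => if e.IsDiag then 0 else pw e := by
    refine Multiset.map_congr rfl fun e he => ?_
    rw [if_neg]
    induction e with
    | h x y =>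
      intro h
      obtain rfl : x = y := h
      exact h3 _ he
  rw [h4]
  refine h2.trans ?_
  have h5 : I.cost σ = ∑ p : Fin I.N with p < σ p, 2 * I.wt (I.h p) (I.h (σ p)) := by
    have hsymm : ∀ u v, I.wt u v = I.wt v u := fun u v => by
      simp only [wt, hw u, eq_comm (a := u)]
    rw [cost, sum_involution_eq hσσ hσ.ne]
    refine Finset.sum_congr rfl fun p _ => ?_
    rw [hσσ, hsymm (I.h (σ p))]
    ring
  rw [h5, ← Finset.mul_sum] at hcost
  have h6 : ∑ p : Fin I.N with p < σ p, I.wt (I.h p) (I.h (σ p)) ≤ I.ℓ := by omega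
  rw [hX₀, Multiset.map_map]
  refine le_trans (le_of_eq ?_) h6
  refine Finset.sum_congr rfl fun p hp => ?_
  have h7 := (Finset.single_le_sum (f := fun p : Fin I.N => I.wt (I.h p) (I.h (σ p)))
    (fun _ _ => Nat.zero_le _) hp).trans h6
  simp only [Function.comp_apply, Sym2.mk_isDiag_iff, ← hg] at h7 ⊢
  rw [wt] at h7 ⊢
  simp only [hI.inj.eq_iff, hI.w] at h7 ⊢
  split_ifs at h7 ⊢ with h8
  · rfl
  · omega

end Rep

end Inp

end RAM

/-! ### Random bits -/

namespace RAM

open MeasureTheory Polynomial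

/-- The number with the binary digits `ω 0, …, ω (T - 1)`. -/
def bitsVal (ω : ℕ → Bool) : ℕ → ℕ
  | 0 => 0
  | T + 1 => 2 * bitsVal ω T + (ω T).toNat

theorem bitsVal_lt (ω : ℕ → Bool) (T : ℕ) : bitsVal ω T < 2 ^ T := by
  induction T with
  | zero => simp [bitsVal]
  | succ T ih =>
    have := (ω T).toNat_le
    rw [bitsVal, pow_succ]
    omega

/-- Each number with `T` binary digits is obtained from a specific sequence of bits. -/
theorem exists_bits (T : ℕ) : ∀ R < 2 ^ T, ∃ b : ℕ → Bool, ∀ ω : ℕ → Bool,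
    (∀ j < T, ω j = b j) → bitsVal ω T = R := by
  induction T with
  | zero =>
    intro R hR
    refine ⟨fun _ => false, fun ω _ => ?_⟩
    simp only [pow_zero, Nat.lt_one_iff] at hR
    simp [bitsVal, hR]
  | succ T ih =>
    intro R hR
    rw [pow_succ] at hR
    obtain ⟨b, hb⟩ := ih (R / 2) (by omega)
    refine ⟨fun j => if j = T then decide (R % 2 = 1) else b j, fun ω hω => ?_⟩
    have h1 := hb ω fun j hj => by
      exact (hω j (by omega)).trans (if_neg hj.ne)
    have h2 : ω T = decide (R % 2 = 1) := (hω T (by omega)).trans (if_pos rfl)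
    rw [bitsVal, h1, h2]
    rcases Nat.mod_two_eq_zero_or_one R with h | h <;> simp [h] <;> omega

theorem coins_cylinder (T : ℕ) (b : ℕ → Bool) :
    coins {ω | ∀ j < T, ω j = b j} = ((2 : ℝ≥0∞) ^ T)⁻¹ := by
  have h : {ω : ℕ → Bool | ∀ j < T, ω j = b j} =
      Set.pi (Finset.range T : Set ℕ) fun j => {b j} := by
    ext ω
    simp [Set.mem_pi]
  rw [h, coins, Measure.infinitePi_pi _ fun _ _ => measurableSet_singleton _]
  simp [ENNReal.inv_pow]

/-- The first `T` random bits form a random number below `2 ^ T`; each number has its cylinder set. -/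
theorem card_le_coins (T : ℕ) (G : Finset ℕ) (hG : ∀ R ∈ G, R < 2 ^ T) :
    (G.card : ℝ≥0∞) * ((2 : ℝ≥0∞) ^ T)⁻¹ ≤ coins {ω | bitsVal ω T ∈ G} := by
  have : ∀ R : G, ∃ b : ℕ → Bool, ∀ ω : ℕ → Bool, (∀ j < T, ω j = b j) → bitsVal ω T = R :=
    fun R => exists_bits T R (hG R R.2)
  choose b hb using this
  calc (G.card : ℝ≥0∞) * ((2 : ℝ≥0∞) ^ T)⁻¹
      = ∑ R : G, coins {ω | ∀ j < T, ω j = b R j} := by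
        simp only [coins_cylinder, Finset.sum_const, Finset.card_univ, Fintype.card_coe,
          nsmul_eq_mul]
    _ = coins (⋃ R ∈ (Finset.univ : Finset G), {ω | ∀ j < T, ω j = b R j}) := by
        rw [measure_biUnion_finset]
        · intro R _ R' _ hR
          refine Set.disjoint_left.2 fun ω h h' => hR (Subtype.ext ?_)
          rw [← hb R ω h, ← hb R' ω h']
        · intro R _
          have : {ω : ℕ → Bool | ∀ j < T, ω j = b R j} =
              Set.pi (Finset.range T : Set ℕ) fun j => {b R j} := by
            ext ω
            simp [Set.mem_pi]
          rw [this]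
          exact MeasurableSet.pi (Set.to_countable _) fun _ _ => measurableSet_singleton _
    _ ≤ coins {ω | bitsVal ω T ∈ G} := by
        refine measure_mono fun ω hω => ?_
        simp only [Set.mem_iUnion] at hω
        obtain ⟨R, -, h⟩ := hω
        change bitsVal ω T ∈ G
        rw [hb R ω h]
        exact R.2

theorem two_thirds_le_coins {T : ℕ} {f : ℕ → ℕ}
    (h : 3 * ((Finset.range (2 ^ T)).filter fun R => f R = 0).card ≤ 2 ^ T) :
    (2 / 3 : ℝ≥0∞) ≤ coins {ω | f (bitsVal ω T) ≠ 0} := by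
  have h1 := Finset.card_filter_add_card_filter_not (s := Finset.range (2 ^ T)) fun R => f R = 0
  rw [Finset.card_range] at h1
  have h2 : 2 * 2 ^ T ≤ 3 * ((Finset.range (2 ^ T)).filter fun R => ¬ f R = 0).card := by omega
  have h4 : {ω | bitsVal ω T ∈ (Finset.range (2 ^ T)).filter fun R => ¬ f R = 0} ⊆
      {ω | f (bitsVal ω T) ≠ 0} := by
    intro ω hω
    have h : bitsVal ω T ∈ (Finset.range (2 ^ T)).filter fun R => ¬ f R = 0 := hω
    exact (Finset.mem_filter.1 h).2
  refine le_trans ?_ ((card_le_coins T ((Finset.range (2 ^ T)).filter fun R => ¬ f R = 0)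
    fun R hR => Finset.mem_range.1 (Finset.mem_filter.1 hR).1).trans (measure_mono h4))
  rw [← div_eq_mul_inv, ENNReal.le_div_iff_mul_le (by simp) (by simp), mul_comm, ← mul_div_assoc]
  refine ENNReal.div_le_of_le_mul ?_
  have h3 : ((2 * 2 ^ T : ℕ) : ℝ≥0∞) ≤
      ((3 * ((Finset.range (2 ^ T)).filter fun R => ¬ f R = 0).card : ℕ) : ℝ≥0∞) :=
    Nat.cast_le.2 h2
  push_cast at h3
  rw [mul_comm, mul_comm _ (3 : ℝ≥0∞)]
  exact h3

/-! ### The randomized program -/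

/-- Replace the number `T` in register `0` by zero, and fill register `1` with `T` random bits. -/
def flipLoop : Prog :=
  .loop 0 (.seq (.flip 2) (.seq (.op .add 1 1 1) (.seq (.op .add 1 1 2)
    (.seq (.const 2 1) (.op .sub 0 0 2)))))

theorem run_flipLoop (ω : ℕ → Bool) (T : ℕ) : ∀ s : State, s.reg 0 = T →
    s.reg 1 = bitsVal ω s.flips → ∃ t s', Run ω flipLoop s t s' ∧
      t ≤ T * (20 * (s.flips + T) + 20) + 1 ∧
      s'.reg 1 = bitsVal ω (s.flips + T) ∧ s'.mem = s.mem := by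
  induction T with
  | zero =>
    intro s h0 h1
    exact ⟨_, s, .loop_false h0, by simp [h0], h1, rfl⟩
  | succ T ih =>
    intro s h0 h1
    have hb := bitsVal_lt ω s.flips
    have hb' := bitsVal_lt ω (s.flips + 1)
    set s₁ : State := { s.setReg 2 (ω s.flips).toNat with flips := s.flips + 1 } with hs₁
    set s₂ := s₁.setReg 1 (s₁.reg 1 + s₁.reg 1) with hs₂
    set s₃ := s₂.setReg 1 (s₂.reg 1 + s₂.reg 2) with hs₃
    set s₄ := s₃.setReg 2 1 with hs₄
    set s₅ := s₄.setReg 0 (s₄.reg 0 - s₄.reg 2) with hs₅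
    have e1 : s₁.reg 1 = bitsVal ω s.flips := by
      have : s₁.reg = (s.setReg 2 (ω s.flips).toNat).reg := rfl
      rw [this, State.setReg_reg, if_neg (by simp), h1]
    have e2 : s₁.reg 2 = (ω s.flips).toNat := by
      have : s₁.reg = (s.setReg 2 (ω s.flips).toNat).reg := rfl
      rw [this, State.setReg_reg, if_pos rfl]
    have e0 : s₁.reg 0 = T + 1 := by
      have : s₁.reg = (s.setReg 2 (ω s.flips).toNat).reg := rfl
      rw [this, State.setReg_reg, if_neg (by simp), h0]
    have f1 : s₂.reg 1 = 2 * bitsVal ω s.flips := by simp [hs₂, e1, two_mul]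
    have f2 : s₂.reg 2 = (ω s.flips).toNat := by simp [hs₂, e2]
    have f0 : s₂.reg 0 = T + 1 := by simp [hs₂, e0]
    have g1 : s₃.reg 1 = bitsVal ω (s.flips + 1) := by simp [hs₃, f1, f2, bitsVal]
    have g0 : s₃.reg 0 = T + 1 := by simp [hs₃, f0]
    have i0 : s₄.reg 0 = T + 1 := by simp [hs₄, g0]
    have i1 : s₄.reg 1 = bitsVal ω (s.flips + 1) := by simp [hs₄, g1]
    have i2 : s₄.reg 2 = 1 := by simp [hs₄]
    have j0 : s₅.reg 0 = T := by simp [hs₅, i0, i2]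
    have j1 : s₅.reg 1 = bitsVal ω (s.flips + 1) := by simp [hs₅, i1]
    have jf : s₅.flips = s.flips + 1 := rfl
    have jm : s₅.mem = s.mem := rfl
    obtain ⟨t, s', r, ht, h3, h4⟩ := ih s₅ j0 (by rw [j1, jf])
    have hs : ∀ a j : ℕ, a < 2 ^ j → a.size ≤ j := fun a j => Nat.size_le.2
    refine ⟨_, s', Run.loop_true (by omega) ((Run.basic (.flip s 2)).seq
      ((Run.basic (.op s₁ .add 1 1 1)).seq ((Run.basic (.op s₂ .add 1 1 2)).seq
      ((Run.basic (.const s₃ 2 1)).seq (Run.basic (.op s₄ .sub 0 0 2)))))) r, ?_, ?_, ?_⟩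
    · simp only [Op.eval, e1, f1, f2, i0, i2, h0]
      have k1 := hs _ _ hb
      have k2 : (bitsVal ω s.flips + bitsVal ω s.flips).size ≤ s.flips + 1 :=
        hs _ _ (by rw [pow_succ]; omega)
      have k3 : (2 * bitsVal ω s.flips).size ≤ s.flips + 1 := hs _ _ (by rw [pow_succ]; omega)
      have k4 : (2 * bitsVal ω s.flips + (ω s.flips).toNat).size ≤ s.flips + 1 := hs _ _ hb'
      have k5 : (ω s.flips).toNat.size ≤ 1 := hs _ _ (by have := (ω s.flips).toNat_le; omega)
      have k6 : (T + 1).size ≤ T + 1 := hs _ _ Nat.lt_two_pow_self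
      have k7 : (T + 1 - 1).size ≤ T + 1 := hs _ _ (by
        have := Nat.lt_two_pow_self (n := T + 1)
        omega)
      have k8 : (1 : ℕ).size = 1 := Nat.size_one
      rw [jf] at ht
      have k9 : (T + 1) * (20 * (s.flips + (T + 1)) + 20) = T * (20 * (s.flips + 1 + T) + 20) +
        (20 * (s.flips + (T + 1)) + 20) := by ring
      omega
    · rw [h3, jf]
      congr 1
      omega
    · rw [h4, jm]

/-- The input occupies polynomial space. -/
theorem init_space_le (l : List ℕ) : (init l).space ≤ inputSize l * inputSize l + inputSize l := by
  have hlen : l.length ≤ inputSize l := by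
    rw [inputSize]
    induction l with
    | nil => simp
    | cons a l ih =>
      rw [List.length_cons, List.map_cons, List.sum_cons]
      omega
  have h1 : (init l).space = l.toFinsupp.sum fun a c => a.size + c.size := by
    simp [State.space, init]
  have h2 : ∀ l : List ℕ, ∑ a ∈ Finset.range l.length, (l.getD a 0).size ≤ inputSize l := by
    intro l
    induction l with
    | nil => simp
    | cons a l ih =>
      rw [List.length_cons, Finset.sum_range_succ']
      simp only [List.getD_cons_succ, List.getD_cons_zero, inputSize, List.map_cons,
        List.sum_cons] at ih ⊢
      omega
  rw [h1, Finsupp.sum]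
  calc ∑ a ∈ l.toFinsupp.support, (a.size + (l.toFinsupp a).size)
      ≤ ∑ a ∈ Finset.range l.length, (a.size + (l.getD a 0).size) :=
        Finset.sum_le_sum_of_subset (by
          intro a ha
          rw [List.toFinsupp_support] at ha
          exact Finset.mem_of_mem_filter _ ha)
    _ ≤ inputSize l * inputSize l + inputSize l := by
        rw [Finset.sum_add_distrib]
        refine Nat.add_le_add ?_ (h2 l)
        refine (Finset.sum_le_card_nsmul _ _ l.length fun a ha => ?_).trans ?_
        · exact Nat.size_le.2 ((Finset.mem_range.1 ha).trans Nat.lt_two_pow_self)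
        · rw [Finset.card_range, smul_eq_mul]
          exact Nat.mul_le_mul hlen hlen

/-- The context of the instances `x`, with encodings `enc x`. -/
def instCx {X : Type} (enc : X → List ℕ) (κ : X → ℕ) (D : X → Prop) : Cx X where
  mem x := (enc x).toFinsupp
  sz x := inputSize (enc x)
  κ := κ
  D := D
  Γ := []

/-- Instances whose answer is yes if the guard is nonzero and there is a cheap linking are decided
by a randomized program. -/
theorem exists_decides {X : Type} {enc : X → List ℕ} {κ : X → ℕ} {D : X → Prop} {d : X → Inp}
    {g : X → ℕ} {answer : X → Prop} (hd : InpOK (instCx enc κ D) d)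
    (hg : Comp (instCx enc κ D) false g) (hκ : ∀ x, D x → (d x).k ≤ κ x)
    (hw : ∀ x, D x → ∀ u v, (d x).w u v = (d x).w v u)
    (hans : ∀ x, D x → (answer x ↔ g x ≠ 0 ∧ ∃ σ, (d x).Linking σ ∧ (d x).cost σ ≤ 2 * (d x).ℓ)) :
    ∃ (A : Prog) (q : ℕ[X]), ∀ x, D x →
      Decides A (enc x) (answer x) (2 ^ κ x * q.eval (inputSize (enc x))) := by
  set C := instCx enc κ D with hC
  set T : X → ℕ := fun x => (3 * (d x).N ^ 2).size * ((d x).N * (d x).N) with hT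
  have cT : Comp C false T := hd.cs.mul (hd.cN.mul hd.cN)
  have pT : PB C false T := (PB.size hd.p3N).mul (hd.pN.mul hd.pN)
  set C' := C.push fun x R => R < 2 ^ T x with hC'
  have hE : Ext C C' Prod.fst := Cx.ext_push _ _
  have hR : Comp C' false fun z => z.2 := Comp.var_push
    ((pT.lift (Cx.ext_push _ _)).mono fun z hz => Nat.size_le.2 hz.2)
  have hd' : InpOK C' fun z => ({d z.1 with R := z.2} : Inp) :=
    { hd.lift hE with }
  have hacc := (hd'.caccept hR fun z hz => hκ _ hz.1).mul ((hg.lift hE).weaken true)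
  obtain ⟨-, PT, tT, ⟨qT, hqT⟩, HT⟩ := cT
  have hacc0 := hacc
  obtain ⟨-, PA, tA, ⟨qA, hqA⟩, HA⟩ := hacc
  obtain ⟨q1, hq1⟩ := pT
  obtain ⟨q3, hq3⟩ := hacc0.size
  -- The number `T` of bits is computed in register `0`, the random number in register `1`, and the
  -- result in register `2`, from which it is copied to the output register `0`.
  set A : Prog := .seq (PT [] 0) (.seq (.const 1 0) (.seq flipLoop
    (.seq (PA [1] 2) (.seq (.const 0 0) (.op .add 0 2 0))))) with hA
  set f : X → ℕ → ℕ := fun x R => ({d x with R := R} : Inp).accept * g x with hf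
  have hrun : ∀ x, D x → ∀ ω, ∃ t s, Run ω A (init (enc x)) t s ∧
      s.reg 0 = f x (bitsVal ω (T x)) ∧
      t ≤ 2 ^ κ x * (qT + q1 * (20 * q1 + 20) + qA + 2 * q3 + 6).eval (inputSize (enc x)) := by
    intro x hx ω
    obtain ⟨t₁, s₁, r₁, ht₁, h0₁, -, hm₁, hf₁⟩ := HT [] 0 (by simp) ω x (init (enc x)) hx rfl rfl
    have hf₁' : s₁.flips = 0 := hf₁
    obtain ⟨t₂, s₂, r₂, ht₂, h1₂, hm₂⟩ := run_flipLoop ω (T x) (s₁.setReg 1 0) (by simp [h0₁])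
      (by simp [hf₁', bitsVal])
    rw [State.setReg_flips, hf₁', zero_add] at ht₂ h1₂
    have hlt := bitsVal_lt ω (T x)
    obtain ⟨t₃, s₃, r₃, ht₃, h2₃, -, -, -⟩ := HA [1] 2 (by simp) ω (x, bitsVal ω (T x)) s₂
      ⟨hx, hlt⟩ (by simp [hC', Cx.push, hC, instCx, h1₂]) (by rw [hm₂, State.setReg_mem, hm₁]; rfl)
    have h2₃' : s₃.reg 2 = f x (bitsVal ω (T x)) := h2₃
    refine ⟨_, _, r₁.seq ((Run.basic (.const _ 1 0)).seq (r₂.seq (r₃.seq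
      ((Run.basic (.const _ 0 0)).seq (Run.basic (.op _ .add 0 2 0)))))), ?_, ?_⟩
    · simp [Op.eval, h2₃']
    · have b1 : tT x ≤ qT.eval (inputSize (enc x)) :=
        le_of_le_of_eq (hqT x hx) (one_mul _)
      have b2 : T x ≤ q1.eval (inputSize (enc x)) :=
        le_of_le_of_eq (hq1 x hx) (one_mul _)
      have b3 : tA (x, bitsVal ω (T x)) ≤ 2 ^ κ x * qA.eval (inputSize (enc x)) :=
        hqA (x, bitsVal ω (T x)) ⟨hx, hlt⟩
      have b4 : (f x (bitsVal ω (T x))).size ≤ q3.eval (inputSize (enc x)) :=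
        le_of_le_of_eq (hq3 (x, bitsVal ω (T x)) ⟨hx, hlt⟩) (one_mul _)
      have b5 : T x * (20 * T x + 20) ≤
          q1.eval (inputSize (enc x)) * (20 * q1.eval (inputSize (enc x)) + 20) :=
        Nat.mul_le_mul b2 (by omega)
      have b6 : qT.eval (inputSize (enc x)) + q1.eval (inputSize (enc x)) *
          (20 * q1.eval (inputSize (enc x)) + 20) + 2 * q3.eval (inputSize (enc x)) + 6 ≤
          2 ^ κ x * (qT.eval (inputSize (enc x)) + q1.eval (inputSize (enc x)) *
          (20 * q1.eval (inputSize (enc x)) + 20) + 2 * q3.eval (inputSize (enc x)) + 6) :=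
        Nat.le_mul_of_pos_left _ (by positivity)
      simp only [eval_add, eval_mul, eval_ofNat]
      have e0 : (0 : ℕ).size = 0 := Nat.size_zero
      simp only [Op.eval, State.setReg_reg, h2₃', if_true, add_zero, e0]
      simp only [OfNat.ofNat_ne_zero, if_false]
      refine le_trans ?_ (le_of_le_of_eq (Nat.add_le_add b6 b3) (by ring))
      omega
  have hacc_iff : ∀ x, D x → ∀ ω, Accepts A (enc x) ω ↔ f x (bitsVal ω (T x)) ≠ 0 := by
    intro x hx ω
    obtain ⟨t, s, ⟨b, r⟩, h0, -⟩ := hrun x hx ω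
    rw [← h0]
    constructor
    · rintro ⟨t', b', s', r', h'⟩
      rwa [r.det r']
    · intro h
      exact ⟨t, b, s, r, h⟩
  refine ⟨A, Polynomial.X * Polynomial.X + Polynomial.X + Polynomial.C (A.regSize + 1) * (qT + q1 * (20 * q1 + 20) + qA + 2 * q3 + 6),
    fun x hx => ⟨fun ω => ?_, fun hyes => ?_, fun hno ω hacc => ?_⟩⟩
  · obtain ⟨t, s, ⟨b, r⟩, -, ht⟩ := hrun x hx ω
    -- The space is at most that of the input plus a constant times the time.
    have h1 := (r.space_le _ le_rfl).2
    have h2 := init_space_le (enc x)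
    refine ⟨t, b, s, r, ?_⟩
    rw [eval_add, eval_add, eval_mul, eval_mul, eval_X, eval_C, mul_add,
      mul_left_comm (2 ^ κ x) (A.regSize + 1)]
    set v := 2 ^ κ x * (qT + q1 * (20 * q1 + 20) + qA + 2 * q3 + 6).eval (inputSize (enc x))
    have h3 : (A.regSize + 1) * t ≤ (A.regSize + 1) * v := Nat.mul_le_mul_left _ ht
    have h4 : v ≤ (A.regSize + 1) * v := Nat.le_mul_of_pos_left _ (Nat.succ_pos _)
    have h5 : inputSize (enc x) * inputSize (enc x) + inputSize (enc x) ≤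
        2 ^ κ x * (inputSize (enc x) * inputSize (enc x) + inputSize (enc x)) :=
      Nat.le_mul_of_pos_left _ (by positivity)
    omega
  · obtain ⟨hg0, σ, hσ, hcost⟩ := (hans x hx).1 hyes
    have h1 := Inp.card_reject (d x) (hw x hx) hσ hcost
    -- Since `W` is a power of two, `T` random bits are a random number below `W ^ (N * N)`.
    have h2 : (d x).W ^ ((d x).N * (d x).N) = 2 ^ T x := by rw [Inp.W, ← pow_mul]
    rw [h2] at h1
    have h3 : {ω | Accepts A (enc x) ω} = {ω | f x (bitsVal ω (T x)) ≠ 0} :=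
      Set.ext fun ω => hacc_iff x hx ω
    rw [h3]
    refine two_thirds_le_coins (le_trans (le_of_eq ?_) h1)
    simp only [hf, mul_eq_zero, hg0, or_false]
  · have h1 := (hacc_iff x hx ω).1 hacc
    obtain ⟨σ, hσ, hcost⟩ := Inp.exists_linking (I := {d x with R := bitsVal ω (T x)}) (hw x hx)
      (left_ne_zero_of_mul h1)
    exact hno ((hans x hx).2 ⟨right_ne_zero_of_mul h1, σ, ⟨hσ.1, hσ.2, hσ.3⟩, hcost⟩)

end RAM

/-! ### Reading the input -/

namespace RAM

open Polynomial

theorem length_flatMap_finRange {m c : ℕ} (f : Fin m → List ℕ) (hf : ∀ i, (f i).length = c) :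
    ((List.finRange m).flatMap f).length = c * m := by
  rw [List.length_flatMap]
  simp [hf, mul_comm]

theorem getD_flatMap_finRange {m c : ℕ} (f : Fin m → List ℕ) (hf : ∀ i, (f i).length = c) (i : Fin m)
    {j : ℕ} (hj : j < c) (d : ℕ) :
    ((List.finRange m).flatMap f).getD (c * i + j) d = (f i).getD j d := by
  induction m with
  | zero => exact i.elim0
  | succ m ih =>
    rw [List.finRange_succ, List.flatMap_cons]
    cases i using Fin.cases with
    | zero =>
      rw [Fin.val_zero, mul_zero, zero_add, List.getD_append _ _ _ _ (by rwa [hf])]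
    | succ i =>
      have h1 : c * (i.succ : ℕ) + j = (c * i + j) + c := by
        rw [Fin.val_succ]
        ring
      rw [h1, List.getD_append_right _ _ _ _ (by rw [hf]; omega), hf, Nat.add_sub_cancel,
        List.flatMap_map]
      exact ih (fun i => f i.succ) (fun i => hf _) i

theorem size_getD_le (l : List ℕ) (i : ℕ) : (l.getD i 0).size ≤ inputSize l := by
  induction l generalizing i with
  | nil => simp
  | cons a l ih =>
    rw [inputSize, List.map_cons, List.sum_cons]
    cases i with
    | zero =>
      rw [List.getD_cons_zero]
      omega
    | succ i =>
      rw [List.getD_cons_succ]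
      exact (ih i).trans (Nat.le_add_left _ _)

theorem length_le_inputSize (l : List ℕ) : l.length ≤ inputSize l := by
  rw [inputSize]
  induction l with
  | nil => simp
  | cons a l ih =>
    rw [List.length_cons, List.map_cons, List.sum_cons]
    omega

theorem eval_le_eval (p : ℕ[X]) {a b : ℕ} (h : a ≤ b) : p.eval a ≤ p.eval b := by
  rw [eval_eq_sum, eval_eq_sum]
  exact Finset.sum_le_sum fun i _ => Nat.mul_le_mul_left _ (Nat.pow_le_pow_left h i)

variable {X Y : Type}

theorem PB.poly {C : Cx X} {f : X → ℕ} (hf : PB C false f) (p : ℕ[X]) :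
    PB C false fun x => p.eval (f x) := by
  obtain ⟨q, hq⟩ := hf
  refine ⟨p.comp q, fun x hx => ?_⟩
  rw [eval_comp]
  exact (eval_le_eval p (le_of_le_of_eq (hq x hx) (one_mul _))).trans (one_mul _).ge

/-- Reading the input. -/
theorem Comp.input {enc : X → List ℕ} {κ : X → ℕ} {D : X → Prop} {C' : Cx Y} {π : Y → X}
    (h : Ext (instCx enc κ D) C' π) {i : Y → ℕ} (hi : Comp C' false i) :
    Comp C' false fun y => (enc (π y)).getD (i y) 0 := by
  refine (hi.load ⟨Polynomial.X, fun y _ => ?_⟩).congr fun y _ => ?_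
  · dsimp only
    rw [h.mem, h.sz, eval_X, cond_false, one_mul]
    exact size_getD_le _ _
  · rw [h.mem]
    rfl

theorem PB.of_le_length {enc : X → List ℕ} {κ : X → ℕ} {D : X → Prop} {f : X → ℕ}
    (h : ∀ x, D x → f x ≤ (enc x).length) : PB (instCx enc κ D) false f := by
  refine ⟨Polynomial.X, fun x hx => ?_⟩
  rw [eval_X, cond_false, one_mul]
  exact (h x hx).trans (length_le_inputSize _)

namespace Inp.Rep

variable {I : Inp} {V : Type} {ν : V → ℕ} {a b : Fin I.m → V} {pw : Sym2 V → ℕ}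
  (hI : I.Rep ν a b pw)
include hI

/-- The number of components computed by the algorithm is at most the number of components of a
graph whose edges are edges of the multigraph. -/
theorem k_le_card {T : Type} [Finite T] (G : SimpleGraph T) (f : T → V)
    (hadj : ∀ x y, G.Adj x y → s(f x, f y) ∈ edgeMultiset a b)
    (hsurj : ∀ x y, s(x, y) ∈ edgeMultiset a b → ∃ t, f t = x) :
    I.k ≤ Nat.card G.ConnectedComponent := by
  have h1 : ∀ q : Fin (2 * I.m), ∃ t, ν (f t) = I.e q := by
    intro q
    obtain ⟨x, y, hxy, hx⟩ := hI.exists_edge q.2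
    obtain ⟨t, rfl⟩ := hsurj x y hxy
    exact ⟨t, hx⟩
  choose t ht using h1
  refine Inp.k_le_card (fun q => G.connectedComponentMk (t q)) fun q q' h => ?_
  obtain ⟨w⟩ := SimpleGraph.ConnectedComponent.exact h
  have : ∀ {x y : T}, G.Walk x y → I.comp (ν (f x)) = I.comp (ν (f y)) := by
    intro x y w
    induction w with
    | nil => rfl
    | cons h _ ih => exact (hI.comp_eq (hadj _ _ h)).trans ih
  rw [← ht, ← ht, this w]

end Inp.Rep

end RAM

/-! ### Undirected Eulerian Extension -/

/-- Without isolated vertices, Eulerian extensions are extensions with an Euler tour; only the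
empty graph has to be excluded, as a trail needs a starting point. -/
theorem isEulerian_add_iff {V : Type} {M X : Multiset (Sym2 V)} (hM : ∀ v, ∃ c, s(v, c) ∈ M) :
    IsEulerian (M + X) ↔ Nonempty V ∧ Extends M X := by
  constructor
  · rintro ⟨v, l, hl, hlM, -⟩
    refine ⟨⟨v⟩, ?_, ?_, fun a b _ => hM a⟩
    · rw [← hlM]
      exact even_deg_of_closed hl
    · rw [← hlM]
      exact edgeConn_of_walk hl
  · rintro ⟨⟨v⟩, h⟩
    obtain ⟨c, hc⟩ := hM v
    obtain ⟨l, hl, hlM⟩ := exists_euler_tour h.even h.conn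
      (.inr ⟨c, Multiset.mem_add.2 (.inl hc)⟩)
    refine ⟨v, l, hl, hlM, fun x => .inr ?_⟩
    obtain ⟨d, hd⟩ := hM x
    refine ⟨s(x, d), ?_, Sym2.mem_mk_left _ _⟩
    rw [← Multiset.mem_coe, hlM]
    exact Multiset.mem_add.2 (.inl hd)

namespace UEEInstance

variable (I : UEEInstance)

theorem encode_n : I.encode.getD 0 0 = I.n := rfl

theorem encode_m : I.encode.getD 1 0 = I.m := rfl

/-- The list of the edges. -/
def edgeList : List ℕ :=
  (List.finRange I.m).flatMap fun i => [((I.ends i).1 : ℕ), ((I.ends i).2 : ℕ)]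

/-- The weight matrix. -/
def weightList : List ℕ :=
  (List.finRange I.n).flatMap fun u => (List.finRange I.n).map fun v => I.weight u v

theorem encode_eq : I.encode = I.n :: I.m :: (I.edgeList ++ (I.weightList ++
    [if I.ℓ < 0 then 1 else 0, I.ℓ.natAbs])) := by
  simp [encode, edgeList, weightList]

theorem length_edgeList : I.edgeList.length = 2 * I.m :=
  RAM.length_flatMap_finRange (c := 2) _ fun _ => rfl

theorem length_weightList : I.weightList.length = I.n * I.n :=
  RAM.length_flatMap_finRange _ fun _ => by simp

theorem encode_edge (i : Fin I.m) : I.encode.getD (2 + 2 * i) 0 = (I.ends i).1 ∧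
    I.encode.getD (2 + (2 * i + 1)) 0 = (I.ends i).2 := by
  have hi := i.2
  have h1 := fun j (hj : j < 2) => RAM.getD_flatMap_finRange (c := 2)
    (fun i : Fin I.m => [((I.ends i).1 : ℕ), ((I.ends i).2 : ℕ)]) (fun _ => rfl) i hj 0
  rw [encode_eq, add_comm 2, add_comm 2]
  simp only [List.getD_cons_succ]
  rw [List.getD_append _ _ _ _ (by rw [length_edgeList]; omega),
    List.getD_append _ _ _ _ (by rw [length_edgeList]; omega)]
  exact ⟨h1 0 (by simp), h1 1 (by simp)⟩

theorem encode_weight (u v : Fin I.n) :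
    I.encode.getD (2 * I.m + 2 + (I.n * u + v)) 0 = I.weight u v := by
  have hlt : I.n * u + v < I.n * I.n := by
    have := Nat.mul_le_mul_left I.n (Nat.succ_le_of_lt u.2)
    have hv := v.2
    rw [Nat.mul_succ] at this
    omega
  have h1 := RAM.getD_flatMap_finRange
    (fun u : Fin I.n => (List.finRange I.n).map fun v => I.weight u v) (by simp) u v.2 0
  have h2 : 2 * I.m + 2 + (I.n * u + v) = 2 * I.m + (I.n * u + v) + 2 := by omega
  rw [encode_eq, h2]
  simp only [List.getD_cons_succ]
  rw [List.getD_append_right _ _ _ _ (by rw [length_edgeList]; omega), length_edgeList,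
    Nat.add_sub_cancel_left, List.getD_append _ _ _ _ (by rwa [length_weightList]), weightList, h1]
  simp

theorem encode_bound :
    I.encode.getD (2 * I.m + I.n * I.n + 2) 0 = (if I.ℓ < 0 then 1 else 0) ∧
    I.encode.getD (2 * I.m + I.n * I.n + 2 + 1) 0 = I.ℓ.natAbs := by
  rw [encode_eq]
  simp only [List.getD_cons_succ]
  rw [List.getD_append_right _ _ _ _ (by rw [length_edgeList]; omega),
    List.getD_append_right _ _ _ _ (by rw [length_edgeList, length_weightList]; omega),
    List.getD_append_right _ _ _ _ (by rw [length_edgeList]; omega),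
    List.getD_append_right _ _ _ _ (by rw [length_edgeList, length_weightList]; omega),
    length_edgeList, length_weightList]
  have h1 : 2 * I.m + I.n * I.n - 2 * I.m - I.n * I.n = 0 := by omega
  have h2 : 2 * I.m + I.n * I.n + 1 - 2 * I.m - I.n * I.n = 1 := by omega
  rw [h1, h2]
  exact ⟨rfl, rfl⟩

/-- The data for the main computation. -/
def inp : RAM.Inp where
  n := I.n
  m := I.m
  ℓ := I.ℓ.toNat
  R := 0
  e q := min (I.encode.getD (2 + q) 0) I.n
  w u v := I.encode.getD (2 * I.m + 2 + (I.n * min u v + max u v)) 0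

theorem rep : I.inp.Rep (fun v : Fin I.n => (v : ℕ)) (fun i : Fin I.m => (I.ends i).1)
    (fun i => (I.ends i).2) I.pairWeight where
  inj := Fin.val_injective
  lt v := v.2
  e_le q := min_le_right _ _
  left i := by
    change min _ _ = _
    rw [(I.encode_edge i).1, min_eq_left (Fin.is_le' ..)]
  right i := by
    change min _ _ = _
    rw [(I.encode_edge i).2, min_eq_left (Fin.is_le' ..)]
  w u v := by
    change I.encode.getD _ _ = I.weight u v
    rcases le_total u v with h | h
    · rw [min_eq_left (Fin.le_iff_val_le_val.1 h), max_eq_right (Fin.le_iff_val_le_val.1 h),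
        encode_weight]
    · rw [min_eq_right (Fin.le_iff_val_le_val.1 h), max_eq_left (Fin.le_iff_val_le_val.1 h),
        encode_weight, I.weight_symm]

theorem w_symm (u v : ℕ) : I.inp.w u v = I.inp.w v u := by
  change I.encode.getD _ _ = I.encode.getD _ _
  rw [min_comm, max_comm]

theorem exists_mem_edges (v : Fin I.n) : ∃ c, s(v, c) ∈ I.edges := by
  obtain ⟨i, h | h⟩ := I.no_isolated v
  · exact ⟨(I.ends i).2, Multiset.mem_map.2 ⟨i, Finset.mem_univ_val i, by rw [h]⟩⟩
  · exact ⟨(I.ends i).1, Multiset.mem_map.2 ⟨i, Finset.mem_univ_val i, by rw [h, Sym2.eq_swap]⟩⟩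

theorem yes_iff : I.Yes ↔ (if I.ℓ < 0 then 0 else I.m) ≠ 0 ∧
    ∃ σ, I.inp.Linking σ ∧ I.inp.cost σ ≤ 2 * I.inp.ℓ := by
  -- The guard excludes negative `ℓ`, which `toNat` would turn into `0`, and the empty graph.
  have hne : Nonempty (Fin I.n) ↔ I.m ≠ 0 := by
    constructor
    · rintro ⟨v⟩
      obtain ⟨i, -⟩ := I.no_isolated v
      exact Nat.ne_zero_of_lt i.2
    · intro h
      exact ⟨(I.ends ⟨0, Nat.pos_of_ne_zero h⟩).1⟩
  constructor
  · rintro ⟨X, hX, hℓ⟩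
    obtain ⟨h1, h2⟩ := (isEulerian_add_iff I.exists_mem_edges).1 hX
    have h0 : ¬ I.ℓ < 0 := by omega
    rw [if_neg h0]
    refine ⟨hne.1 h1, I.rep.linking_of_extends I.w_symm h2 ?_⟩
    change _ ≤ I.ℓ.toNat
    omega
  · rintro ⟨h1, σ, hσ, hcost⟩
    have h0 : ¬ I.ℓ < 0 := fun h => h1 (if_pos h)
    rw [if_neg h0] at h1
    obtain ⟨X, hX, hℓ⟩ := I.rep.extends_of_linking I.w_symm hσ hcost
    refine ⟨X, (isEulerian_add_iff I.exists_mem_edges).2 ⟨hne.2 h1, hX⟩, ?_⟩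
    have : (X.map I.pairWeight).sum ≤ I.ℓ.toNat := hℓ
    omega

theorem inp_k_le : I.inp.k ≤ I.k :=
  I.rep.k_le_card _ id (fun _ _ h => ((SimpleGraph.fromEdgeSet_adj _).1 h).1)
    fun x _ _ => ⟨x, rfl⟩

theorem length_encode : I.encode.length = 2 * I.m + I.n * I.n + 4 := by
  rw [encode_eq]
  simp only [List.length_cons, List.length_append, length_edgeList, length_weightList,
    List.length_nil]
  omega

open RAM in
theorem inpOK (p : Polynomial ℕ) :
    InpOK (instCx encode k fun I => I.ℓ ≤ ((p.eval I.n : ℕ) : ℤ)) inp ∧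
    Comp (instCx encode k fun I => I.ℓ ≤ ((p.eval I.n : ℕ) : ℤ)) false
      fun I => if I.ℓ < 0 then 0 else I.m := by
  set C := instCx encode k fun I => I.ℓ ≤ ((p.eval I.n : ℕ) : ℤ) with hC
  have cn : Comp C false n := (Comp.input (Ext.refl C) (Comp.const _ _ 0)).congr fun I _ => I.encode_n
  have cm : Comp C false m := (Comp.input (Ext.refl C) (Comp.const _ _ 1)).congr fun I _ => I.encode_m
  have pn : PB C false n := PB.of_le_length fun I _ => by
    rw [length_encode]
    have := Nat.le_mul_self I.n
    omega
  have pm : PB C false m := PB.of_le_length fun I _ => by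
    rw [length_encode]
    omega
  have cpos : Comp C false fun I => 2 * I.m + I.n * I.n + 2 :=
    (((Comp.const _ _ 2).mul cm).add (cn.mul cn)).add (Comp.const _ _ 2)
  have cs := Comp.input (Ext.refl C) cpos
  have ca := Comp.input (Ext.refl C) (cpos.add (Comp.const _ _ 1))
  refine ⟨⟨cn, cm, ?_, pn, pm, ?_, ?_, ?_, fun I _ => I.rep.e_le⟩, ?_⟩
  · refine (Comp.ite_eq cs (Comp.const _ _ 1) (Comp.const _ _ 0) ca).congr fun I _ => ?_
    change I.ℓ.toNat = _
    rw [I.encode_bound.1, I.encode_bound.2]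
    by_cases h : I.ℓ < 0
    · simp only [h, if_true]
      omega
    · simp only [h, if_false, zero_ne_one]
      omega
  · refine (pn.poly p).mono fun I hI => ?_
    have : I.ℓ ≤ ((p.eval I.n : ℕ) : ℤ) := hI
    change I.ℓ.toNat ≤ _
    omega
  · intro Y C' π i hE hi _
    exact (Comp.input hE ((Comp.const _ _ 2).add hi)).min (cn.lift hE)
  · intro Y C' π i j hE hi _ hj _
    have cm' : Comp C' false fun y => (π y).m := cm.lift hE
    have cn' : Comp C' false fun y => (π y).n := cn.lift hE
    exact Comp.input hE ((((Comp.const _ _ 2).mul cm').add (Comp.const _ _ 2)).add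
      ((cn'.mul (hi.min hj)).add (hi.max hj)))
  · refine (Comp.ite_eq cs (Comp.const _ _ 1) (Comp.const _ _ 0) cm).congr fun I _ => ?_
    rw [I.encode_bound.1]
    by_cases h : I.ℓ < 0 <;> simp [h]

theorem exists_decides (p : Polynomial ℕ) : ∃ (A : RAM.Prog) (q : Polynomial ℕ), ∀ I : UEEInstance,
    I.ℓ ≤ ((p.eval I.n : ℕ) : ℤ) →
      RAM.Decides A I.encode I.Yes (2 ^ I.k * q.eval (RAM.inputSize I.encode)) :=
  RAM.exists_decides (inpOK p).1 (inpOK p).2 (fun I _ => I.inp_k_le) (fun I _ => I.w_symm)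
    fun I _ => I.yes_iff

end UEEInstance

/-! ### Postman tours and Eulerian extensions -/

section Tours

variable {V E : Type} {ends : E → Sym2 V} {wE : E → ℕ} {pw : Sym2 V → ℕ}

/-- Cut a walk into required edges and the gaps between them: the gaps become edges of an extension. -/
theorem IsWalk.exists_gaps (hpw : ∀ u v es, IsWalk ends u es v → pw s(u, v) ≤ (es.map wE).sum)
    {u w : V} {es : List E} (h : IsWalk ends u es w) :
    ∀ Q : Multiset E, Q ≤ (es : Multiset E) → Q ≠ 0 →
      ∃ (x y : V) (X : Multiset (Sym2 V)) (l : List (Sym2 V)) (l₁ l₂ : List E),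
        IsWalk ends u l₁ x ∧ IsWalk ends y l₂ w ∧ IsWalk id x l y ∧
        (l : Multiset (Sym2 V)) = Q.map ends + X ∧
        (l₁.map wE).sum + (X.map pw).sum + (Q.map wE).sum + (l₂.map wE).sum ≤ (es.map wE).sum ∧
        (∀ a b, s(a, b) ∈ X → ∃ c, s(a, c) ∈ Q.map ends) ∧
        (∃ c, s(x, c) ∈ Q.map ends) ∧ ∃ c, s(y, c) ∈ Q.map ends := by
  classical
  induction h with
  | nil v =>
    intro Q hQ h0
    exact absurd (le_antisymm hQ (Multiset.zero_le _)) h0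
  | @cons u v w e es he hes ih =>
    intro Q hQ h0
    rw [← Multiset.cons_coe] at hQ
    by_cases heQ : e ∈ Q
    · obtain ⟨Q, rfl⟩ := Multiset.exists_cons_of_mem heQ
      have hQ' := (Multiset.cons_le_cons_iff e).1 hQ
      have hmem : ∀ a, (∃ c, s(a, c) ∈ Q.map ends) → ∃ c, s(a, c) ∈ (e ::ₘ Q).map ends :=
        fun a ⟨c, hc⟩ => ⟨c, by rw [Multiset.map_cons]; exact Multiset.mem_cons_of_mem hc⟩
      have hu : ∃ c, s(u, c) ∈ (e ::ₘ Q).map ends :=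
        ⟨v, by rw [Multiset.map_cons, he]; exact Multiset.mem_cons_self _ _⟩
      have hv : ∃ c, s(v, c) ∈ (e ::ₘ Q).map ends :=
        ⟨u, by rw [Multiset.map_cons, he, Sym2.eq_swap]; exact Multiset.mem_cons_self _ _⟩
      -- Either `e` is the last required edge, or a gap from `v` to `x` follows.
      by_cases hQ0 : Q = 0
      · subst hQ0
        refine ⟨u, v, 0, [s(u, v)], [], es, .nil u, hes, .cons rfl (.nil v), ?_, ?_, ?_, hu, hv⟩
        · simp [he]
        · simp
        · simp
      · obtain ⟨x, y, X, l, l₁, l₂, a1, a2, a3, a4, a5, a6, a7, a8⟩ := ih Q hQ' hQ0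
        refine ⟨u, y, s(v, x) ::ₘ X, s(u, v) :: s(v, x) :: l, [], l₂, .nil u, a2,
          .cons rfl (.cons rfl a3), ?_, ?_, ?_, hu, hmem _ a8⟩
        · rw [← Multiset.cons_coe, ← Multiset.cons_coe, a4, Multiset.map_cons, he,
            Multiset.add_cons, Multiset.cons_add, Multiset.cons_swap]
        · have := hpw _ _ _ a1
          simp only [List.map_nil, List.sum_nil, Multiset.map_cons, Multiset.sum_cons, List.map_cons,
            List.sum_cons]
          omega
        · intro a b hab
          rcases Multiset.mem_cons.1 hab with h | h
          · rw [Sym2.eq_iff] at h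
            rcases h with ⟨rfl, -⟩ | ⟨rfl, -⟩
            · exact hv
            · exact hmem _ a7
          · exact hmem _ (a6 a b h)
    · obtain ⟨x, y, X, l, l₁, l₂, a1, a2, a3, a4, a5, a6⟩ :=
        ih Q ((Multiset.le_cons_of_notMem heQ).1 hQ) h0
      refine ⟨x, y, X, l, e :: l₁, l₂, .cons he a1, a2, a3, a4, ?_, a6⟩
      simp only [List.map_cons, List.sum_cons]
      omega

/-- The gaps of a closed walk, including the one around its starting point, form an extension of
the multigraph of the required edges. -/
theorem exists_extends_of_walk (hpw : ∀ u v es, IsWalk ends u es v → pw s(u, v) ≤ (es.map wE).sum)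
    {v : V} {es : List E} (h : IsWalk ends v es v) {Q : Multiset E} (hQ : Q ≤ (es : Multiset E)) :
    ∃ X, Extends (Q.map ends) X ∧ (X.map pw).sum + (Q.map wE).sum ≤ (es.map wE).sum := by
  by_cases h0 : Q = 0
  · subst h0
    refine ⟨0, ⟨fun x => by simp, fun U _ => .inl (by simp), by simp⟩, by simp⟩
  obtain ⟨x, y, X, l, l₁, l₂, a1, a2, a3, a4, a5, a6, a7, a8⟩ := h.exists_gaps hpw Q hQ h0
  have hw : IsWalk id x (l ++ [s(y, x)]) x :=
    a3.append (IsWalk.single (ends := id) (show id s(y, x) = s(y, x) from rfl))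
  have hM : ((l ++ [s(y, x)] : List (Sym2 V)) : Multiset (Sym2 V)) = Q.map ends + s(y, x) ::ₘ X := by
    rw [← Multiset.coe_add, a4, Multiset.coe_singleton, add_assoc, add_comm X,
      Multiset.singleton_add]
  -- The gap from `y` to `x` leads through the starting point of the walk.
  refine ⟨s(y, x) ::ₘ X, ⟨?_, ?_, ?_⟩, ?_⟩
  · rw [← hM]
    exact even_deg_of_closed hw
  · rw [← hM]
    exact edgeConn_of_walk hw
  · intro a b hab
    rcases Multiset.mem_cons.1 hab with h | h
    · rw [Sym2.eq_iff] at h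
      rcases h with ⟨rfl, -⟩ | ⟨rfl, -⟩
      · exact a8
      · exact a7
    · exact a6 a b h
  · have := hpw _ _ _ (a2.append a1)
    rw [List.map_append, List.sum_append] at this
    rw [Multiset.map_cons, Multiset.sum_cons]
    omega

/-- Conversely, the edges of an extension may be replaced by walks. -/
theorem IsWalk.fill_gaps {u w : V} {l : List (Sym2 V)} (h : IsWalk id u l w) :
    ∀ (Q : Multiset E) (X : Multiset (Sym2 V)), (l : Multiset (Sym2 V)) = Q.map ends + X →
      (∀ u v, s(u, v) ∈ X → ∃ es, IsWalk ends u es v ∧ (es.map wE).sum ≤ pw s(u, v)) →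
      ∃ es, IsWalk ends u es w ∧ (∀ e ∈ Q, e ∈ es) ∧
        (es.map wE).sum ≤ (X.map pw).sum + (Q.map wE).sum := by
  classical
  induction h with
  | nil v =>
    intro Q X hl _
    have h1 : Q.map ends + X = 0 := hl.symm
    obtain ⟨h2, rfl⟩ := add_eq_zero.1 h1
    obtain rfl := Multiset.map_eq_zero.1 h2
    exact ⟨[], .nil v, by simp, by simp⟩
  | @cons u v w e l he hl ih =>
    intro Q X hQX hX
    obtain rfl : e = s(u, v) := he
    rw [← Multiset.cons_coe] at hQX
    have hmem : s(u, v) ∈ Q.map ends + X := hQX ▸ Multiset.mem_cons_self _ _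
    rcases Multiset.mem_add.1 hmem with h | h
    · obtain ⟨i, hi, hie⟩ := Multiset.mem_map.1 h
      obtain ⟨Q, rfl⟩ := Multiset.exists_cons_of_mem hi
      rw [Multiset.map_cons, hie, Multiset.cons_add, Multiset.cons_inj_right] at hQX
      obtain ⟨es, a1, a2, a3⟩ := ih Q X hQX hX
      refine ⟨i :: es, .cons hie a1, ?_, ?_⟩
      · intro e he
        rcases Multiset.mem_cons.1 he with rfl | h
        · exact List.mem_cons_self ..
        · exact List.mem_cons_of_mem _ (a2 e h)
      · rw [List.map_cons, List.sum_cons, Multiset.map_cons, Multiset.sum_cons]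
        omega
    · obtain ⟨X, rfl⟩ := Multiset.exists_cons_of_mem h
      rw [Multiset.add_cons, Multiset.cons_inj_right] at hQX
      obtain ⟨es, a1, a2, a3⟩ := ih Q X hQX fun u v h => hX u v (Multiset.mem_cons_of_mem h)
      obtain ⟨es', b1, b2⟩ := hX u v (Multiset.mem_cons_self _ _)
      refine ⟨es' ++ es, b1.append a1, fun e he => List.mem_append_right _ (a2 e he), ?_⟩
      rw [List.map_append, List.sum_append, Multiset.map_cons, Multiset.sum_cons]
      omega

end Tours

/-! ### Undirected Rural Postman Problem: the data -/

namespace URPPInstance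

variable (I : URPPInstance)

open scoped Classical in
/-- The list of the edges. -/
def edgeList : List ℕ :=
  (List.finRange I.m).flatMap fun i =>
    [((I.ends i).1 : ℕ), ((I.ends i).2 : ℕ), I.weight i, if i ∈ I.R then 1 else 0]

theorem encode_eq : I.encode = I.n :: I.m :: (I.edgeList ++ [if I.ℓ < 0 then 1 else 0, I.ℓ.natAbs]) := by
  simp [encode, edgeList]

theorem length_edgeList : I.edgeList.length = 4 * I.m :=
  RAM.length_flatMap_finRange (c := 4) _ fun _ => rfl

theorem length_encode : I.encode.length = 4 * I.m + 4 := by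
  rw [encode_eq]
  simp only [List.length_cons, List.length_append, length_edgeList, List.length_nil]

theorem encode_bound :
    I.encode.getD (4 * I.m + 2) 0 = (if I.ℓ < 0 then 1 else 0) ∧
    I.encode.getD (4 * I.m + 3) 0 = I.ℓ.natAbs := by
  rw [encode_eq]
  simp only [List.getD_cons_succ]
  rw [List.getD_append_right _ _ _ _ (by rw [length_edgeList]),
    List.getD_append_right _ _ _ _ (by rw [length_edgeList]; omega), length_edgeList]
  have h1 : 4 * I.m - 4 * I.m = 0 := by omega
  have h2 : 4 * I.m + 1 - 4 * I.m = 1 := by omega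
  rw [h1, h2]
  exact ⟨rfl, rfl⟩

/-- The entry `j < 4` of the description of edge `i`: its two ends, its weight, and whether it is
required. -/
def ent (i j : ℕ) : ℕ := I.encode.getD (4 * i + j + 2) 0

open scoped Classical in
theorem ent_eq (i : Fin I.m) : I.ent i 0 = (I.ends i).1 ∧ I.ent i 1 = (I.ends i).2 ∧
    I.ent i 2 = I.weight i ∧ I.ent i 3 = if i ∈ I.R then 1 else 0 := by
  have hi := i.2
  have h1 : ∀ j < 4, I.ent i j =
      [((I.ends i).1 : ℕ), ((I.ends i).2 : ℕ), I.weight i, if i ∈ I.R then 1 else 0].getD j 0 := by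
    intro j hj
    rw [ent, encode_eq]
    simp only [List.getD_cons_succ]
    rw [List.getD_append _ _ _ _ (by rw [length_edgeList]; omega), edgeList]
    exact RAM.getD_flatMap_finRange (c := 4) (fun i : Fin I.m =>
      [((I.ends i).1 : ℕ), ((I.ends i).2 : ℕ), I.weight i, if i ∈ I.R then 1 else 0])
      (fun _ => rfl) i hj 0
  exact ⟨h1 0 (by simp), h1 1 (by simp), h1 2 (by simp), h1 3 (by simp)⟩

/-- The end `j < 2` of the edge `i`. (For numbers `i` that do not belong to edges, the value is still
bounded.) -/
def vert (i j : ℕ) : ℕ := min (I.ent i j) I.n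

theorem vert_eq (i : Fin I.m) : I.vert i 0 = (I.ends i).1 ∧ I.vert i 1 = (I.ends i).2 := by
  rw [vert, vert, (I.ent_eq i).1, (I.ent_eq i).2.1]
  exact ⟨min_eq_left (Fin.is_le' ..), min_eq_left (Fin.is_le' ..)⟩

/-! ### Enumeration of the required edges -/

/-- The number of required edges before the edge `i`. -/
def rank (i : ℕ) : ℕ := ∑ i' ∈ Finset.range i, I.ent i' 3

/-- The required edge number `j`. -/
def sel (j : ℕ) : ℕ := ∑ i ∈ Finset.range I.m, if I.rank (i + 1) ≤ j then 1 else 0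

theorem rank_succ_of_mem {i : Fin I.m} (hi : i ∈ I.R) : I.rank (i + 1) = I.rank i + 1 := by
  rw [rank, Finset.sum_range_succ, (I.ent_eq i).2.2.2, if_pos hi]
  rfl

theorem rank_mono {i j : ℕ} (h : i ≤ j) : I.rank i ≤ I.rank j :=
  Finset.sum_le_sum_of_subset (Finset.range_subset_range.2 h)

theorem sel_rank {i : Fin I.m} (hi : i ∈ I.R) : I.sel (I.rank i) = i := by
  rw [sel, ← Finset.card_filter]
  have : (Finset.range I.m).filter (fun j => I.rank (j + 1) ≤ I.rank i) = Finset.range i := by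
    ext j
    rw [Finset.mem_filter, Finset.mem_range, Finset.mem_range]
    constructor
    · rintro ⟨-, h⟩
      by_contra! hij
      have : I.rank (i + 1) ≤ I.rank (j + 1) := I.rank_mono (Nat.succ_le_succ hij)
      rw [I.rank_succ_of_mem hi] at this
      omega
    · intro h
      exact ⟨h.trans i.2, I.rank_mono h⟩
  rw [this, Finset.card_range]

theorem exists_rank_eq {j : ℕ} (hj : j < I.rank I.m) : ∃ i ∈ I.R, I.rank i = j := by
  have key : ∀ n ≤ I.m, j < I.rank n → ∃ i ∈ I.R, I.rank i = j := by
    intro n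
    induction n with
    | zero => simp [rank]
    | succ n ih =>
      intro hn h
      by_cases h' : j < I.rank n
      · exact ih (by omega) h'
      · have h1 := (I.ent_eq ⟨n, hn⟩).2.2.2
        rw [rank, Finset.sum_range_succ, ← rank] at h
        dsimp only at h1
        rw [h1] at h
        by_cases hR : (⟨n, hn⟩ : Fin I.m) ∈ I.R
        · rw [if_pos hR] at h
          exact ⟨_, hR, by dsimp only; omega⟩
        · rw [if_neg hR] at h
          omega
  exact key _ le_rfl hj

/-- The required edges. -/
theorem exists_sel : ∃ f : Fin (I.rank I.m) → Fin I.m, (∀ j : Fin (I.rank I.m), I.sel j = f j) ∧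
    Finset.univ.val.map f = I.R.val := by
  choose f hf hf' using fun j : Fin (I.rank I.m) => I.exists_rank_eq j.2
  have hinj : Function.Injective f := fun j j' h => Fin.ext (by rw [← hf' j, ← hf' j', h])
  refine ⟨f, fun j => by rw [← hf' j, I.sel_rank (hf j)], ?_⟩
  have : Finset.univ.map ⟨f, hinj⟩ = I.R := by
    ext i
    rw [Finset.mem_map]
    constructor
    · rintro ⟨j, -, rfl⟩
      exact hf j
    · intro hi
      have hlt : I.rank i < I.rank I.m := by
        have := I.rank_mono (Nat.succ_le_of_lt i.2)
        rw [Nat.succ_eq_add_one, I.rank_succ_of_mem hi] at this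
        omega
      refine ⟨⟨I.rank i, hlt⟩, Finset.mem_univ _, Fin.ext ?_⟩
      change (f ⟨I.rank i, hlt⟩ : ℕ) = i
      rw [← I.sel_rank (hf _), hf', I.sel_rank hi]
  rw [← this]
  rfl

/-! ### Distances -/

/-- Distances are computed up to this bound. -/
def cap : ℕ := I.ℓ.toNat + 1

/-- Positive if for the pair `q` of vertices, encoded as `n * u + v`, a length at most `r` is found
from the table `a` using at most one edge more. -/
def near (a : ℕ → ℕ) (q r : ℕ) : ℕ :=
  (if a q ≤ r then 1 else 0) + ∑ i ∈ Finset.range I.m,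
    ((if q % I.n = I.vert i 1 then
        if a (I.n * (q / I.n) + I.vert i 0) + I.ent i 2 ≤ r then 1 else 0 else 0) +
      if q % I.n = I.vert i 0 then
        if a (I.n * (q / I.n) + I.vert i 1) + I.ent i 2 ≤ r then 1 else 0 else 0)

/-- One round of the computation of distances. -/
def relax (a : ℕ → ℕ) (q : ℕ) : ℕ :=
  ∑ r ∈ Finset.range I.cap, if I.near a q r = 0 then 1 else 0

/-- The distances for walks without edges. -/
def dist₀ (q : ℕ) : ℕ := if q / I.n = q % I.n then 0 else I.cap

/-- The table of distances after `t` rounds. -/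
def tab (t : ℕ) : ℕ → ℕ := Nat.rec I.dist₀ (fun _ a => I.relax a) t

/-- The table of distances as one number. -/
def distTable : ℕ :=
  RAM.vecIter (I.cap + 1) (I.n * I.n) I.dist₀ (fun _ a => I.relax a) (I.n * I.n * I.cap + 1)

theorem near_ne_zero {a : ℕ → ℕ} {q r : ℕ} : I.near a q r ≠ 0 ↔ a q ≤ r ∨ ∃ i < I.m,
    (q % I.n = I.vert i 1 ∧ a (I.n * (q / I.n) + I.vert i 0) + I.ent i 2 ≤ r) ∨
    (q % I.n = I.vert i 0 ∧ a (I.n * (q / I.n) + I.vert i 1) + I.ent i 2 ≤ r) := by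
  rw [near, ← not_iff_not, not_not, Nat.add_eq_zero_iff, Finset.sum_eq_zero_iff]
  simp only [Nat.add_eq_zero_iff, ite_eq_right_iff, one_ne_zero, imp_false, Finset.mem_range]
  push Not
  rfl

/-- Below the cap, `relax` computes the least `r` such that `near` is positive, by counting the
smaller numbers. -/
theorem relax_le_iff {a : ℕ → ℕ} {q c : ℕ} (hc : c < I.cap) :
    I.relax a q ≤ c ↔ I.near a q c ≠ 0 := by
  have hmono : ∀ r r', r ≤ r' → I.near a q r ≠ 0 → I.near a q r' ≠ 0 := by
    intro r r' hr
    rw [near_ne_zero, near_ne_zero]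
    rintro (h | ⟨i, hi, h⟩)
    · exact .inl (h.trans hr)
    · exact .inr ⟨i, hi, h.imp (fun h => ⟨h.1, h.2.trans hr⟩) fun h => ⟨h.1, h.2.trans hr⟩⟩
  rw [relax, ← Finset.card_filter]
  constructor
  · intro h h0
    have : Finset.range (c + 1) ⊆ (Finset.range I.cap).filter fun r => I.near a q r = 0 := by
      intro r hr
      rw [Finset.mem_range] at hr
      rw [Finset.mem_filter, Finset.mem_range]
      refine ⟨by omega, ?_⟩
      by_contra h1
      exact hmono r c (by omega) h1 h0
    have := Finset.card_le_card this
    rw [Finset.card_range] at this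
    omega
  · intro h
    have : ((Finset.range I.cap).filter fun r => I.near a q r = 0) ⊆ Finset.range c := by
      intro r hr
      rw [Finset.mem_filter] at hr
      rw [Finset.mem_range]
      by_contra! h1
      exact hmono c r h1 h hr.2
    have := Finset.card_le_card this
    rwa [Finset.card_range] at this

theorem relax_le_cap (a : ℕ → ℕ) (q : ℕ) : I.relax a q ≤ I.cap := by
  rw [relax, ← Finset.card_filter]
  exact (Finset.card_filter_le _ _).trans (Finset.card_range _).le

theorem tab_le_cap (t q : ℕ) : I.tab t q ≤ I.cap := by
  cases t with
  | zero =>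
    change I.dist₀ q ≤ _
    unfold dist₀
    split_ifs
    · exact Nat.zero_le _
    · exact le_rfl
  | succ t => exact I.relax_le_cap _ _

theorem tab_succ_le (t q : ℕ) : I.tab (t + 1) q ≤ I.tab t q := by
  rcases (I.tab_le_cap t q).lt_or_eq with h | h
  · exact (I.relax_le_iff h).2 (I.near_ne_zero.2 (.inl le_rfl))
  · rw [h]
    exact I.tab_le_cap _ _

theorem vert_lt {i j : ℕ} (hi : i < I.m) (hj : j < 2) : I.vert i j < I.n := by
  obtain ⟨h0, h1⟩ := I.vert_eq ⟨i, hi⟩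
  interval_cases j
  · exact h0 ▸ (I.ends _).1.2
  · exact h1 ▸ (I.ends _).2.2

theorem pair_lt {u v : ℕ} (hu : u < I.n) (hv : v < I.n) : I.n * u + v < I.n * I.n := by
  have := Nat.mul_le_mul_left I.n (Nat.succ_le_of_lt hu)
  rw [Nat.mul_succ] at this
  omega

theorem relax_congr {a a' : ℕ → ℕ} (h : ∀ q < I.n * I.n, a q = a' q) {q : ℕ} (hq : q < I.n * I.n) :
    I.relax a q = I.relax a' q := by
  have hn : I.near a q = I.near a' q := by
    funext r
    unfold near
    rw [h q hq]
    congr 1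
    refine Finset.sum_congr rfl fun i hi => ?_
    rw [Finset.mem_range] at hi
    rw [h _ (I.pair_lt (Nat.div_lt_of_lt_mul hq) (I.vert_lt hi (by omega))),
      h _ (I.pair_lt (Nat.div_lt_of_lt_mul hq) (I.vert_lt hi (by omega)))]
  rw [relax, relax, hn]

/-- The table is stable after so many rounds, since the sum of its entries decreases before. -/
theorem tab_stable {q : ℕ} (hq : q < I.n * I.n) :
    I.tab (I.n * I.n * I.cap + 1 + 1) q = I.tab (I.n * I.n * I.cap + 1) q := by
  have key : ∀ t, (∑ q ∈ Finset.range (I.n * I.n), I.tab t q) + t ≤ I.n * I.n * I.cap ∨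
      ∀ q < I.n * I.n, I.tab (t + 1) q = I.tab t q := by
    intro t
    induction t with
    | zero =>
      left
      rw [add_zero]
      refine (Finset.sum_le_card_nsmul _ _ I.cap fun q _ => I.tab_le_cap 0 q).trans ?_
      rw [Finset.card_range, smul_eq_mul]
    | succ t ih =>
      by_cases hst : ∀ q < I.n * I.n, I.tab (t + 1) q = I.tab t q
      · exact .inr fun q hq => I.relax_congr hst hq
      · left
        have h1 := ih.resolve_right hst
        push Not at hst
        obtain ⟨q, hq, hne⟩ := hst
        have : ∑ q ∈ Finset.range (I.n * I.n), I.tab (t + 1) q <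
            ∑ q ∈ Finset.range (I.n * I.n), I.tab t q :=
          Finset.sum_lt_sum (fun q _ => I.tab_succ_le t q)
            ⟨q, Finset.mem_range.2 hq, lt_of_le_of_ne (I.tab_succ_le t q) hne⟩
        omega
  exact (key (I.n * I.n * I.cap + 1)).resolve_left (by omega) q hq

theorem digit_distTable {q : ℕ} (hq : q < I.n * I.n) :
    RAM.digit (I.cap + 1) I.distTable q = I.tab (I.n * I.n * I.cap + 1) q :=
  RAM.digit_vecIter (Nat.succ_pos _) I.tab (T := I.n * I.n * I.cap + 1) (fun _ _ => rfl)
    (fun _ _ _ hv _ hi => I.relax_congr hv hi) (fun t _ q _ => Nat.lt_succ_of_le (I.tab_le_cap t q))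
    _ le_rfl _ hq

theorem tab_succ_le_iff {t c : ℕ} (hc : c < I.cap) (u v : Fin I.n) :
    I.tab (t + 1) (I.n * u + v) ≤ c ↔ I.tab t (I.n * u + v) ≤ c ∨
      ∃ i x, I.endPair i = s(x, v) ∧ I.tab t (I.n * u + x) + I.weight i ≤ c := by
  refine ((I.relax_le_iff hc).trans I.near_ne_zero).trans (or_congr Iff.rfl ?_)
  have h1 : (I.n * u + v) / I.n = u := by
    rw [Nat.mul_add_div (Nat.zero_lt_of_lt u.2), Nat.div_eq_of_lt v.2, add_zero]
  have h2 : (I.n * u + v) % I.n = v := by rw [Nat.mul_add_mod, Nat.mod_eq_of_lt v.2]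
  rw [h1, h2]
  constructor
  · rintro ⟨i, hi, h⟩
    obtain ⟨e0, e1⟩ := I.vert_eq ⟨i, hi⟩
    have e2 := (I.ent_eq ⟨i, hi⟩).2.2.1
    dsimp only at e0 e1 e2
    rw [e0, e1, e2] at h
    rcases h with ⟨h, h'⟩ | ⟨h, h'⟩
    · exact ⟨_, _, by rw [endPair, Fin.ext h], h'⟩
    · exact ⟨_, _, by rw [endPair, Sym2.eq_swap, Fin.ext h], h'⟩
  · rintro ⟨i, x, hi, h⟩
    obtain ⟨e0, e1⟩ := I.vert_eq i
    have e2 := (I.ent_eq i).2.2.1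
    refine ⟨i, i.2, ?_⟩
    rw [e0, e1, e2]
    rw [endPair, Sym2.eq_iff] at hi
    rcases hi with ⟨rfl, rfl⟩ | ⟨rfl, rfl⟩
    · exact .inl ⟨rfl, h⟩
    · exact .inr ⟨rfl, h⟩

/-- Entries below the cap are lengths of walks. -/
theorem exists_walk_of_tab (t : ℕ) (u : Fin I.n) : ∀ v : Fin I.n, I.tab t (I.n * u + v) < I.cap →
    ∃ es, IsWalk I.endPair u es v ∧ (es.map I.weight).sum ≤ I.tab t (I.n * u + v) := by
  induction t with
  | zero =>
    intro v h
    have h0 : I.tab 0 (I.n * u + v) = if (u : ℕ) = v then 0 else I.cap := by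
      change I.dist₀ _ = _
      rw [dist₀, Nat.mul_add_div (Nat.zero_lt_of_lt u.2), Nat.div_eq_of_lt v.2, add_zero,
        Nat.mul_add_mod, Nat.mod_eq_of_lt v.2]
    rw [h0] at h
    split_ifs at h with huv
    · obtain rfl := Fin.ext huv
      exact ⟨[], .nil u, by simp⟩
    · exact absurd h (lt_irrefl _)
  | succ t ih =>
    intro v h
    rcases (I.tab_succ_le_iff h u v).1 le_rfl with h1 | ⟨i, x, hi, h1⟩
    · obtain ⟨es, h2, h3⟩ := ih v (h1.trans_lt h)
      exact ⟨es, h2, h3.trans h1⟩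
    · obtain ⟨es, h2, h3⟩ := ih x (by omega)
      refine ⟨es ++ [i], h2.append (.single hi), ?_⟩
      rw [List.map_append, List.sum_append, List.map_singleton, List.sum_singleton]
      omega

/-- The stable table contains lower bounds for the lengths of all walks. -/
theorem tab_le_of_walk {u v : Fin I.n} {es : List (Fin I.m)} (h : IsWalk I.endPair u es v) :
    I.tab (I.n * I.n * I.cap + 1) (I.n * u + v) ≤ (es.map I.weight).sum := by
  set T := I.n * I.n * I.cap + 1 with hT
  have hrefl : ∀ t, I.tab t (I.n * u + u) = 0 := by
    intro t
    induction t with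
    | zero =>
      change I.dist₀ _ = _
      rw [dist₀, Nat.mul_add_div (Nat.zero_lt_of_lt u.2), Nat.div_eq_of_lt u.2, add_zero,
        Nat.mul_add_mod, Nat.mod_eq_of_lt u.2, if_pos rfl]
    | succ t ih =>
      have := I.tab_succ_le t (I.n * u + u)
      omega
  have key : ∀ {x w : Fin I.n} {es : List (Fin I.m)}, IsWalk I.endPair x es w →
      I.tab T (I.n * u + w) ≤ I.tab T (I.n * u + x) + (es.map I.weight).sum := by
    intro x w es h
    induction h with
    | nil => simp
    | @cons x y w e es he _ ih =>
      have h1 : I.tab T (I.n * u + y) ≤ I.tab T (I.n * u + x) + I.weight e := by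
        by_cases hc : I.tab T (I.n * u + x) + I.weight e < I.cap
        · rw [← I.tab_stable (I.pair_lt u.2 y.2)]
          exact (I.tab_succ_le_iff hc u y).2 (.inr ⟨e, x, he, le_rfl⟩)
        · have := I.tab_le_cap T (I.n * u + y)
          omega
      rw [List.map_cons, List.sum_cons]
      omega
  have := key h
  rwa [hrefl, zero_add] at this

end URPPInstance

/-! ### Undirected Rural Postman Problem: the algorithm -/

namespace URPPInstance

variable (I : URPPInstance)

/-- The data for the main computation: the multigraph of the required edges, with the distances as
weights. -/
def inp : RAM.Inp where
  n := I.n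
  m := I.rank I.m
  ℓ := I.ℓ.toNat
  R := 0
  e q := I.vert (I.sel (q / 2)) (q % 2)
  w u v := RAM.digit (I.cap + 1) I.distTable (I.n * min u v + max u v)

theorem w_symm (u v : ℕ) : I.inp.w u v = I.inp.w v u := by
  change RAM.digit _ _ _ = RAM.digit _ _ _
  rw [min_comm, max_comm]

/-- The distance of two vertices, capped. -/
def pairDist : Sym2 (Fin I.n) → ℕ := Sym2.lift ⟨fun u v => I.inp.w u v, fun u v => I.w_symm u v⟩

theorem pairDist_eq (u v : Fin I.n) : ∃ x y : Fin I.n, s(u, v) = s(x, y) ∧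
    I.pairDist s(u, v) = I.tab (I.n * I.n * I.cap + 1) (I.n * x + y) := by
  have h : I.pairDist s(u, v) = RAM.digit (I.cap + 1) I.distTable
    (I.n * min (u : ℕ) v + max (u : ℕ) v) := rfl
  rw [h]
  rcases le_total (u : ℕ) v with h | h
  · refine ⟨u, v, rfl, ?_⟩
    rw [min_eq_left h, max_eq_right h, I.digit_distTable (I.pair_lt u.2 v.2)]
  · refine ⟨v, u, Sym2.eq_swap, ?_⟩
    rw [min_eq_right h, max_eq_left h, I.digit_distTable (I.pair_lt v.2 u.2)]

theorem pairDist_le (u v : Fin I.n) (es : List (Fin I.m)) (h : IsWalk I.endPair u es v) :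
    I.pairDist s(u, v) ≤ (es.map I.weight).sum := by
  obtain ⟨x, y, hxy, hd⟩ := I.pairDist_eq u v
  rw [hd]
  rw [Sym2.eq_iff] at hxy
  rcases hxy with ⟨rfl, rfl⟩ | ⟨rfl, rfl⟩
  · exact I.tab_le_of_walk h
  · have := I.tab_le_of_walk h.reverse
    rwa [List.map_reverse, List.sum_reverse] at this

theorem exists_walk_of_pairDist (u v : Fin I.n) (h : I.pairDist s(u, v) ≤ I.ℓ.toNat) :
    ∃ es, IsWalk I.endPair u es v ∧ (es.map I.weight).sum ≤ I.pairDist s(u, v) := by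
  obtain ⟨x, y, hxy, hd⟩ := I.pairDist_eq u v
  rw [hd] at h ⊢
  obtain ⟨es, h1, h2⟩ := I.exists_walk_of_tab _ x y (Nat.lt_succ_of_le h)
  rw [Sym2.eq_iff] at hxy
  rcases hxy with ⟨rfl, rfl⟩ | ⟨rfl, rfl⟩
  · exact ⟨es, h1, h2⟩
  · refine ⟨es.reverse, h1.reverse, ?_⟩
    rwa [List.map_reverse, List.sum_reverse]

theorem exists_rep : ∃ a b, I.inp.Rep (fun v : Fin I.n => (v : ℕ)) a b I.pairDist ∧
    edgeMultiset a b = I.R.val.map I.endPair := by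
  obtain ⟨f, hf, hfR⟩ := I.exists_sel
  refine ⟨fun j => (I.ends (f j)).1, fun j => (I.ends (f j)).2,
    ⟨Fin.val_injective, fun v => v.2, fun q => min_le_right _ _, fun j => ?_, fun j => ?_,
      fun u v => rfl⟩, ?_⟩
  · change I.vert (I.sel (2 * j / 2)) (2 * j % 2) = _
    have h1 : 2 * (j : ℕ) / 2 = j := by omega
    have h2 : 2 * (j : ℕ) % 2 = 0 := by omega
    rw [h1, h2, hf j, (I.vert_eq _).1]
  · change I.vert (I.sel ((2 * j + 1) / 2)) ((2 * j + 1) % 2) = _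
    have h1 : (2 * (j : ℕ) + 1) / 2 = j := by omega
    have h2 : (2 * (j : ℕ) + 1) % 2 = 1 := by omega
    rw [h1, h2, hf j, (I.vert_eq _).2]
  · rw [← hfR, Multiset.map_map]
    rfl

theorem yes_iff_extends : I.Yes ↔ ¬ I.ℓ < 0 ∧
    ∃ X, Extends (I.R.val.map I.endPair) X ∧ (X.map I.pairDist).sum ≤ I.ℓ.toNat := by
  constructor
  · rintro ⟨v, es, hes, hR, hℓ⟩
    have hle : I.R.val ≤ (es : Multiset (Fin I.m)) := (Multiset.le_iff_subset I.R.nodup).2 hR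
    obtain ⟨X, h1, h2⟩ := exists_extends_of_walk (wE := I.weight) I.pairDist_le hes hle
    have h3 : (I.R.val.map I.weight).sum = ∑ e ∈ I.R, I.weight e := rfl
    rw [h3] at h2
    exact ⟨by omega, X, h1, by omega⟩
  · rintro ⟨hℓ, X, hX, hsum⟩
    have h3 : (I.R.val.map I.weight).sum = ∑ e ∈ I.R, I.weight e := rfl
    -- Without required edges, the walk of length zero is a solution.
    by_cases hR : I.R = ∅
    · obtain ⟨v⟩ := I.connected.nonempty
      refine ⟨v, [], .nil v, by simp [hR], ?_⟩
      simp only [List.map_nil, List.sum_nil, hR, Finset.sum_empty]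
      omega
    · obtain ⟨e, he⟩ := Finset.nonempty_iff_ne_empty.2 hR
      have hv : s((I.ends e).1, (I.ends e).2) ∈ I.R.val.map I.endPair + X :=
        Multiset.mem_add.2 (.inl (Multiset.mem_map_of_mem I.endPair he))
      obtain ⟨l, hl, hlM⟩ := exists_euler_tour hX.even hX.conn (.inr ⟨_, hv⟩)
      obtain ⟨es, h1, h2, h4⟩ := hl.fill_gaps (wE := I.weight) (pw := I.pairDist) I.R.val X hlM
        fun u v huv => I.exists_walk_of_pairDist u v
          ((Multiset.single_le_sum (fun _ _ => Nat.zero_le _) _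
            (Multiset.mem_map_of_mem I.pairDist huv)).trans hsum)
      refine ⟨_, es, h1, h2, ?_⟩
      rw [h3] at h4
      omega

theorem yes_iff : I.Yes ↔ (if I.ℓ < 0 then 0 else 1) ≠ 0 ∧
    ∃ σ, I.inp.Linking σ ∧ I.inp.cost σ ≤ 2 * I.inp.ℓ := by
  obtain ⟨a, b, hI, hR⟩ := I.exists_rep
  rw [yes_iff_extends, ← hR]
  refine and_congr (by simp) ⟨?_, ?_⟩
  · rintro ⟨X, hX, hℓ⟩
    exact hI.linking_of_extends I.w_symm hX hℓ
  · rintro ⟨σ, hσ, hcost⟩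
    exact hI.extends_of_linking I.w_symm hσ hcost

theorem inp_k_le : I.inp.k ≤ I.k := by
  obtain ⟨a, b, hI, hR⟩ := I.exists_rep
  have hmem : ∀ e, e ∈ edgeMultiset a b ↔ e ∈ I.endPair '' (I.R : Set (Fin I.m)) := by
    intro e
    rw [hR, Multiset.mem_map]
    rfl
  refine hI.k_le_card _ Subtype.val (fun x y h => (hmem _).2 ?_) fun x y h => ?_
  · exact ((SimpleGraph.fromEdgeSet_adj _).1 h).1
  · obtain ⟨e, he, hexy⟩ := (hmem _).1 h
    exact ⟨⟨x, e, he, hexy ▸ Sym2.mem_mk_left x y⟩, rfl⟩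

/-- As the multigraph is connected, the number of vertices is polynomially bounded in the length of
the input. -/
theorem n_le : I.n ≤ I.m + 1 := by
  have h := I.connected.card_vert_le_card_edgeSet_add_one
  rw [Nat.card_eq_fintype_card, Fintype.card_fin] at h
  refine h.trans (Nat.succ_le_succ ?_)
  rw [SimpleGraph.edgeSet_fromEdgeSet]
  refine (Set.ncard_le_ncard Set.sdiff_subset (Set.finite_range _)).trans ?_
  rw [← Set.image_univ]
  refine (Set.ncard_image_le Set.finite_univ).trans ?_
  rw [Set.ncard_univ, Nat.card_eq_fintype_card, Fintype.card_fin]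

section

open RAM

variable (p : Polynomial ℕ)

/-- The context of the instances in which `ℓ` is bounded by the polynomial `p`. -/
def cx : Cx URPPInstance := instCx encode k fun I => I.ℓ ≤ ((p.eval I.n : ℕ) : ℤ)

variable {Y : Type}

theorem comp_n : Comp (cx p) false n := (Comp.input (Ext.refl (cx p)) (Comp.const _ _ 0)).congr
  fun _ _ => rfl

theorem comp_m : Comp (cx p) false m := (Comp.input (Ext.refl (cx p)) (Comp.const _ _ 1)).congr
  fun _ _ => rfl

theorem bound_m : PB (cx p) false m := PB.of_le_length fun I _ => by
  rw [length_encode]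
  omega

theorem bound_n : PB (cx p) false n := PB.of_le_length fun I _ => by
  rw [length_encode]
  have := I.n_le
  omega

theorem comp_sign : Comp (cx p) false fun I => if I.ℓ < 0 then 1 else 0 :=
  (Comp.input (Ext.refl (cx p)) (((Comp.const _ _ 4).mul (comp_m p)).add (Comp.const _ _ 2))).congr
    fun I _ => I.encode_bound.1.symm

theorem comp_ℓ : Comp (cx p) false fun I => I.ℓ.toNat := by
  refine (Comp.ite_eq (comp_sign p) (Comp.const _ _ 1) (Comp.const _ _ 0)
    (Comp.input (Ext.refl (cx p)) (((Comp.const _ _ 4).mul (comp_m p)).add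
      (Comp.const _ _ 3)))).congr fun I _ => ?_
  rw [I.encode_bound.2]
  by_cases h : I.ℓ < 0
  · simp only [h, if_true]
    omega
  · simp only [h, if_false, zero_ne_one]
    omega

theorem bound_ℓ : PB (cx p) false fun I => I.ℓ.toNat := by
  refine ((bound_n p).poly p).mono fun I hI => ?_
  have : I.ℓ ≤ ((p.eval I.n : ℕ) : ℤ) := hI
  omega

variable {p} {C' : Cx Y} {π : Y → URPPInstance} (hE : Ext (cx p) C' π)
include hE

theorem comp_ent {i : Y → ℕ} (hi : Comp C' false i) {j : Y → ℕ} (hj : Comp C' false j) :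
    Comp C' false fun y => (π y).ent (i y) (j y) :=
  Comp.input hE ((((Comp.const _ _ 4).mul hi).add hj).add (Comp.const _ _ 2))

theorem comp_rank {i : Y → ℕ} (hi : Comp C' false i) (hi' : PB C' false i) :
    Comp C' false fun y => (π y).rank (i y) :=
  Comp.sum (f := fun y i' => (π y).ent i' 3) hi hi' fun _ hE' h _ =>
    comp_ent (hE.trans hE') (h _) (Comp.const _ _ 3)

theorem comp_sel {j : Y → ℕ} (hj : Comp C' false j) : Comp C' false fun y => (π y).sel (j y) :=
  Comp.sum (f := fun y i => if (π y).rank (i + 1) ≤ j y then 1 else 0) ((comp_m p).lift hE)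
    ((bound_m p).lift hE) fun _ hE' h h' =>
    Comp.ite_le (comp_rank (hE.trans hE') ((h _).add (Comp.const _ _ 1)) (h'.add (PB.const _ _ 1)))
      (hj.lift hE') (Comp.const _ _ 1) (Comp.const _ _ 0)

theorem comp_vert {i : Y → ℕ} (hi : Comp C' false i) {j : Y → ℕ} (hj : Comp C' false j) :
    Comp C' false fun y => (π y).vert (i y) (j y) :=
  (comp_ent hE hi hj).min ((comp_n p).lift hE)

theorem bound_vert (i j : Y → ℕ) : PB C' false fun y => (π y).vert (i y) (j y) :=
  ((bound_n p).lift hE).mono fun _ _ => min_le_right _ _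

theorem comp_near {H a q r : Y → ℕ} (hH : Comp C' false H) (ha : Comp C' false a)
    (hq : Comp C' false q) (hq' : PB C' false q) (hr : Comp C' false r) :
    Comp C' false fun y => (π y).near (digit (H y) (a y)) (q y) (r y) := by
  refine (Comp.ite_le (Comp.digit hH ha hq hq') hr (Comp.const _ _ 1) (Comp.const _ _ 0)).add ?_
  refine Comp.sum (f := fun y i =>
    (if q y % (π y).n = (π y).vert i 1 then
        if digit (H y) (a y) ((π y).n * (q y / (π y).n) + (π y).vert i 0) + (π y).ent i 2 ≤ r y
        then 1 else 0 else 0) +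
      if q y % (π y).n = (π y).vert i 0 then
        if digit (H y) (a y) ((π y).n * (q y / (π y).n) + (π y).vert i 1) + (π y).ent i 2 ≤ r y
        then 1 else 0 else 0) ((comp_m p).lift hE) ((bound_m p).lift hE) ?_
  intro C'' hE' h h'
  have hE'' := hE.trans hE'
  have cn : Comp C'' false fun z => (π z.1).n := (comp_n p).lift hE''
  have pn : PB C'' false fun z => (π z.1).n := (bound_n p).lift hE''
  have cq : Comp C'' false fun z => q z.1 := hq.lift hE'
  have pq : PB C'' false fun z => q z.1 := hq'.lift hE'
  have cr : Comp C'' false fun z => r z.1 := hr.lift hE'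
  have cH : Comp C'' false fun z => H z.1 := hH.lift hE'
  have ca : Comp C'' false fun z => a z.1 := ha.lift hE'
  have key : ∀ j j' : ℕ, Comp C'' false fun z =>
      if q z.1 % (π z.1).n = (π z.1).vert z.2 j then
        if digit (H z.1) (a z.1) ((π z.1).n * (q z.1 / (π z.1).n) + (π z.1).vert z.2 j') +
          (π z.1).ent z.2 2 ≤ r z.1 then 1 else 0 else 0 := fun j j' =>
    Comp.ite_eq (cq.mod cn) (comp_vert hE'' (h _) (Comp.const _ _ j)) (Comp.ite_le
      ((Comp.digit cH ca ((cn.mul (cq.div cn)).add (comp_vert hE'' (h _) (Comp.const _ _ j')))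
        ((pn.mul pq.div).add (bound_vert hE'' _ _))).add (comp_ent hE'' (h _) (Comp.const _ _ 2)))
      cr (Comp.const _ _ 1) (Comp.const _ _ 0)) (Comp.const _ _ 0)
  exact (key 1 0).add (key 0 1)

omit hE

theorem comp_cap : Comp (cx p) false cap := (comp_ℓ p).add (Comp.const _ _ 1)

theorem bound_cap : PB (cx p) false cap := (bound_ℓ p).add (PB.const _ _ 1)

theorem comp_distTable : Comp (cx p) false distTable := by
  refine Comp.vecIter (X := URPPInstance) (H := fun I => I.cap + 1) (n := fun I => I.n * I.n)
    (init := fun I => I.dist₀) (step := fun I _ a => I.relax a)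
    (T := fun I => I.n * I.n * I.cap + 1) (fun _ _ => Nat.succ_pos _)
    (comp_cap.add (Comp.const _ _ 1)) ((comp_n p).mul (comp_n p)) ((bound_n p).mul (bound_n p))
    ((((comp_n p).mul (comp_n p)).mul comp_cap).add (Comp.const _ _ 1))
    ((((bound_n p).mul (bound_n p)).mul bound_cap).add (PB.const _ _ 1)) ?_ ?_
  · intro C' hE h _
    have cn : Comp C' false fun z => z.1.n := (comp_n p).lift hE
    exact Comp.ite_eq ((h _).div cn) ((h _).mod cn) (Comp.const _ _ 0) (comp_cap.lift hE)
  · intro C' hE _ _ ha hq hq'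
    have cc : Comp C' false fun z => z.1.1.1.cap := comp_cap.lift hE
    have pc : PB C' false fun z => z.1.1.1.cap := bound_cap.lift hE
    have hsum := Comp.sum (X := ((URPPInstance × ℕ) × ℕ) × ℕ)
      (f := fun z r => if z.1.1.1.near (digit (z.1.1.1.cap + 1) z.1.2) z.2 r = 0 then 1 else 0)
      cc pc ?_
    · exact hsum
    intro C'' hE' h _
    have cH : Comp C'' false fun z => z.1.1.1.1.cap + 1 := (cc.add (Comp.const _ _ 1)).lift hE'
    have ca : Comp C'' false fun z => z.1.1.2 := (ha _).lift hE'
    have cq : Comp C'' false fun z => z.1.2 := (hq _).lift hE'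
    have pq : PB C'' false fun z => z.1.2 := hq'.lift hE'
    exact Comp.ite_eq (comp_near (hE.trans hE') cH ca cq pq (h _)) (Comp.const _ _ 0)
      (Comp.const _ _ 1) (Comp.const _ _ 0)

variable (p) in
theorem inpOK : InpOK (cx p) inp where
  n := comp_n p
  m := comp_rank (Ext.refl _) (comp_m p) (bound_m p)
  ℓ := comp_ℓ p
  n' := bound_n p
  m' := (bound_m p).mono fun I _ => by
    have h : I.rank I.m ≤ _ := Finset.sum_le_card_nsmul (Finset.range I.m) _ 1 fun i hi => by
      rw [(I.ent_eq ⟨i, Finset.mem_range.1 hi⟩).2.2.2]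
      split_ifs <;> simp
    rwa [Finset.card_range, smul_eq_mul, mul_one] at h
  ℓ' := bound_ℓ p
  e C' π i hE hi _ := comp_vert hE (comp_sel hE (hi.div (Comp.const _ _ 2))) (hi.mod (Comp.const _ _ 2))
  w {Y} C' π i j hE hi hi' hj hj' := by
    have cn : Comp C' false fun y => (π y).n := (comp_n p).lift hE
    have pn : PB C' false fun y => (π y).n := (bound_n p).lift hE
    have cH : Comp C' false fun y => (π y).cap + 1 := (comp_cap.add (Comp.const _ _ 1)).lift hE
    have cD : Comp C' false fun y => (π y).distTable := comp_distTable.lift hE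
    exact Comp.digit cH cD ((cn.mul (hi.min hj)).add (hi.max hj)) ((pn.mul (PB.min_right hj')).add
      ((hi'.add hj').mono fun _ _ => max_le (Nat.le_add_right _ _) (Nat.le_add_left _ _)))
  e_le _ _ _ := min_le_right _ _

end

theorem exists_decides (p : Polynomial ℕ) : ∃ (A : RAM.Prog) (q : Polynomial ℕ), ∀ I : URPPInstance,
    I.ℓ ≤ ((p.eval I.n : ℕ) : ℤ) →
      RAM.Decides A I.encode I.Yes (2 ^ I.k * q.eval (RAM.inputSize I.encode)) :=
  RAM.exists_decides (inpOK p) (g := fun I => if I.ℓ < 0 then 0 else 1)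
    (((RAM.Comp.const _ _ 1).sub (comp_sign p)).congr fun I _ => by split_ifs <;> rfl)
    (fun I _ => I.inp_k_le) (fun I _ => I.w_symm) fun I _ => I.yes_iff

end URPPInstance

theorem theorem6 (p : Polynomial ℕ) :
    (∃ (A : RAM.Prog) (q : Polynomial ℕ), ∀ I : UEEInstance, I.ℓ ≤ ((p.eval I.n : ℕ) : ℤ) →
      RAM.Decides A I.encode I.Yes (2 ^ I.k * q.eval (RAM.inputSize I.encode))) ∧
    (∃ (A : RAM.Prog) (q : Polynomial ℕ), ∀ I : URPPInstance, I.ℓ ≤ ((p.eval I.n : ℕ) : ℤ) →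
      RAM.Decides A I.encode I.Yes (2 ^ I.k * q.eval (RAM.inputSize I.encode))) :=
  ⟨UEEInstance.exists_decides p, URPPInstance.exists_decides p⟩

end
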